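/- **Proposition 4.1** (Davies–Gaffney estimate and finite speed of propagation). Let $C=(c_{ij})$ be a real $d\times d$-matrix of measurable, locally integrable functions on $\mathbf R^d$ such that $C(x)$ is symmetric and positive semi-definite for almost every $x$. Let $h$ be the form $$h(\varphi)=\sum_{i,j=1}^d(\partial_i\varphi,c_{ij}\,\partial_j\varphi)$$ on $L_2(\mathbf R^d)$, where $D(h)$ consists of those $\varphi\in W^{1,2}(\mathbf R^d)$ for which the integral converges. Let $h_0$ be the relaxation of $h$, i.e. the largest positive closed quadratic form with $h_0\le h$, let $H_0$ be the positive operator associated with $h_0$, and let $S^{(0)}_t=e^{-tH_0}$. (In particular, $h_0$ exists, $H_0$ is self-adjoint, and the bounded operators $e^{-tH_0}$, $t>0$, and $\cos(tH_0^{1/2})$, $t\in\mathbf R$, are well defined.) Let $$d(x;y)=\sup_{\psi\in D}(\psi(x)-\psi(y))\in[0,\infty],\qquad D=\Big\{\psi\in W^{1,\infty}(\mathbf R^d;\mathbf R):\ \sum_{i,j=1}^dc_{ij}(\partial_i\psi)(\partial_j\psi)\le1 \text{ a.e.}\Big\},$$ where each $\psi\in D$ is taken to be continuous, and let $d(A;B)=\inf_{x\in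 A,\,y\in B}d(x;y)$, which is $\infty$ if $A$ or $B$ is empty. Let $A,B$ be open subsets of $\mathbf R^d$. 1. For all $\varphi_A\in L_2(A)$, $\varphi_B\in L_2(B)$ and $t>0$, $$|(\varphi_A,S^{(0)}_t\varphi_B)|\le e^{-d(A;B)^2/(4t)}\,\|\varphi_A\|_2\,\|\varphi_B\|_2,$$ with the convention $e^{-\infty}=0$. 2. If $A\cap B=\emptyset$, then $$(\varphi_A,\cos(tH_0^{1/2})\varphi_B)=0$$ for all $\varphi_A\in L_2(A)$, $\varphi_B\in L_2(B)$ and all $t\in\mathbf R$ with $|t|\le d(A;B)$. -/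

import Mathlib

open MeasureTheory Filter Topology
open scoped ENNReal ContDiff

noncomputable section

namespace Relax

/-! ### Positive quadratic forms and their associated operators -/

section Forms

variable {E : Type*} [NormedAddCommGroup E] [InnerProductSpace ℂ E]

/-- A positive quadratic form on a complex Hilbert space: a subspace (the form domain) with a
positive symmetric sesquilinear form on it, conjugate-linear in the first variable. -/
structure PositiveForm (E : Type*) [NormedAddCommGroup E] [InnerProductSpace ℂ E] where
  domain : Submodule ℂ E
  form : domain →ₗ⋆[ℂ] domain →ₗ[ℂ] ℂ
  symm : ∀ u v, starRingEnd ℂ (form u v) = form v u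
  nonneg : ∀ u, 0 ≤ (form u u).re

namespace PositiveForm

/-- The value `q(u) = q(u, u)` for `u` in the domain. -/
def quad (q : PositiveForm E) (u : q.domain) : ℝ := (q.form u u).re

open Classical in
/-- The quadratic form as a functional with values in `[0, ∞]`, equal to `∞` off its domain.
For forms `p`, `q` the usual order `p ≤ q`, i.e. `D(q) ⊆ D(p)` and `p(u) ≤ q(u)` for all
`u ∈ D(q)`, is the pointwise order `p.energy ≤ q.energy`. -/
def energy (q : PositiveForm E) (u : E) : ℝ≥0∞ :=
  if hu : u ∈ q.domain then ENNReal.ofReal (q.quad ⟨u, hu⟩) else ∞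

/-- The form `q` is closed: its domain is complete for the norm `(q(u) + ‖u‖ ^ 2) ^ (1/2)`. -/
def IsClosed (q : PositiveForm E) : Prop :=
  ∀ (u : ℕ → q.domain) (x : E),
    Tendsto (fun n => (u n : E)) atTop (𝓝 x) →
    (∀ ε : ℝ, 0 < ε → ∃ N, ∀ m ≥ N, ∀ n ≥ N, q.quad (u m - u n) < ε) →
    ∃ hx : x ∈ q.domain, Tendsto (fun n => q.quad (u n - ⟨x, hx⟩)) atTop (𝓝 0)

instance : Inhabited (PositiveForm E) := ⟨⟨⊤, 0, by simp, by simp⟩⟩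

/-- The graph of the operator `H` associated with the form `q`: `u ∈ D(H)` and `H u = f` if and
only if `u ∈ D(q)` and `q(v, u) = (v, f)` for all `v ∈ D(q)`. -/
def operatorGraph (q : PositiveForm E) : Submodule ℂ (E × E) where
  carrier := {p | ∃ hu : p.1 ∈ q.domain, ∀ v : q.domain,
    q.form v ⟨p.1, hu⟩ = inner ℂ (v : E) p.2}
  zero_mem' := ⟨q.domain.zero_mem, fun v => by
    have h0 : (⟨(0 : E × E).1, q.domain.zero_mem⟩ : q.domain) = 0 := rfl
    rw [h0, map_zero]
    exact (inner_zero_right (v : E)).symm⟩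
  add_mem' := by
    rintro a b ⟨ha, ha'⟩ ⟨hb, hb'⟩
    refine ⟨q.domain.add_mem ha hb, fun v => ?_⟩
    have h0 : (⟨(a + b).1, q.domain.add_mem ha hb⟩ : q.domain) = ⟨a.1, ha⟩ + ⟨b.1, hb⟩ := rfl
    rw [h0, map_add, ha', hb']
    exact (inner_add_right (v : E) a.2 b.2).symm
  smul_mem' := by
    rintro c a ⟨ha, ha'⟩
    refine ⟨q.domain.smul_mem c ha, fun v => ?_⟩
    have h0 : (⟨(c • a).1, q.domain.smul_mem c ha⟩ : q.domain) = c • ⟨a.1, ha⟩ := rfl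
    rw [h0, map_smul, ha']
    exact (inner_smul_right (v : E) a.2 c).symm

/-- The (in general unbounded) operator associated with a densely defined form. -/
def operator (q : PositiveForm E) : E →ₗ.[ℂ] E := q.operatorGraph.toLinearPMap

end PositiveForm

/-- `h₀` is the relaxation of the functional `h`: the largest positive closed quadratic form
with `h₀ ≤ h`. -/
def IsRelaxation (h : E → ℝ≥0∞) (h₀ : PositiveForm E) : Prop :=
  (h₀.IsClosed ∧ h₀.energy ≤ h) ∧
    ∀ q : PositiveForm E, q.IsClosed → q.energy ≤ h → q.energy ≤ h₀.energy

/-- The relaxation of `h`; it is unique when it exists. -/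
def relaxation (h : E → ℝ≥0∞) : PositiveForm E := Classical.epsilon (IsRelaxation h)

end Forms

/-! ### Functions of a positive self-adjoint operator -/

section FunctionalCalculus

variable {E : Type*} [NormedAddCommGroup E] [InnerProductSpace ℂ E] [CompleteSpace E]

/-- `R` is the bounded, everywhere defined operator `(I + H)⁻¹`. -/
def IsResolvent (H : E →ₗ.[ℂ] E) (R : E →L[ℂ] E) : Prop :=
  ∀ f u : E, R f = u ↔ (u, f - u) ∈ H.graph

/-- `T = f(H)`, for a positive self-adjoint operator `H` and a function `f` that is bounded and
continuous on `[0, ∞)`. With `R = (I + H)⁻¹`, a bounded self-adjoint operator with spectrum in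
`[0, 1]`, one has `f(H) (I + H)⁻¹ = g(R)` where `g(r) = r f(1/r - 1)`, `g(0) = 0`, is continuous
on `[0, 1]` and satisfies `g((1 + l)⁻¹) = f(l) (1 + l)⁻¹` for `l ≥ 0`. As `R` has
dense range this determines the bounded operator `f(H)`. -/
def IsFunctionOf (H : E →ₗ.[ℂ] E) (f : ℝ → ℝ) (T : E →L[ℂ] E) : Prop :=
  ∃ R : E →L[ℂ] E, IsResolvent H R ∧ T * R = cfc (fun r : ℝ => r * f (r⁻¹ - 1)) R

/-- The bounded operator `f(H)`. -/
def functionOf (H : E →ₗ.[ℂ] E) (f : ℝ → ℝ) : E →L[ℂ] E :=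
  Classical.epsilon (IsFunctionOf H f)

end FunctionalCalculus

/-! ### The elliptic form with coefficients `C` on `L₂(ℝᵈ)` -/

variable {d : ℕ}

/-- The Hilbert space `L₂(ℝᵈ)`. -/
abbrev L2 (d : ℕ) : Type := Lp ℂ 2 (volume : Measure (EuclideanSpace ℝ (Fin d)))

/-- `g` is the weak partial derivative `∂ᵢ u` on `ℝᵈ`, for locally integrable `u` and `g`. -/
def IsWeakPartialDeriv {F : Type*} [NormedAddCommGroup F] [NormedSpace ℝ F] (i : Fin d)
    (u g : EuclideanSpace ℝ (Fin d) → F) : Prop :=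
  ∀ η : EuclideanSpace ℝ (Fin d) → ℝ, ContDiff ℝ ∞ η → HasCompactSupport η →
    ∫ x, (fderiv ℝ η x (EuclideanSpace.single i 1)) • u x = - ∫ x, η x • g x

/-- The elliptic form `h(u) = ∑ᵢⱼ (∂ᵢu, cᵢⱼ ∂ⱼu) = ∫ ∑ᵢⱼ cᵢⱼ ∂ⱼu conj(∂ᵢu)` as a functional with
values in `[0, ∞]`, equal to `∞` if `u` is not in `W^{1,2}(ℝᵈ)` or if the integral diverges. The
infimum runs over the at most one family `g` of weak derivatives of `u` in `L₂(ℝᵈ)`. -/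
def ellipticForm (C : EuclideanSpace ℝ (Fin d) → Matrix (Fin d) (Fin d) ℝ) (u : L2 d) : ℝ≥0∞ :=
  ⨅ (g : Fin d → L2 d) (_ : ∀ i, IsWeakPartialDeriv i (u : EuclideanSpace ℝ (Fin d) → ℂ) (g i)),
    ∫⁻ x, ENNReal.ofReal
      (∑ i, ∑ j, (C x i j : ℂ) * (starRingEnd ℂ (g i x) * g j x)).re

/-- The relaxation `h₀` of the elliptic form with coefficients `C`. -/
def relaxedForm (C : EuclideanSpace ℝ (Fin d) → Matrix (Fin d) (Fin d) ℝ) :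
    PositiveForm (L2 d) := relaxation (ellipticForm C)

/-- The operator `H₀` associated with the relaxation `h₀`. -/
def relaxedOperator (C : EuclideanSpace ℝ (Fin d) → Matrix (Fin d) (Fin d) ℝ) :
    L2 d →ₗ.[ℂ] L2 d := (relaxedForm C).operator

/-- The semigroup `S⁽⁰⁾ₜ = exp (-t H₀)`, for `t ≥ 0`. -/
def semigroup (C : EuclideanSpace ℝ (Fin d) → Matrix (Fin d) (Fin d) ℝ) (t : ℝ) :
    L2 d →L[ℂ] L2 d := functionOf (relaxedOperator C) (fun l => Real.exp (-t * l))

/-- The wave operator `cos (t H₀^{1/2})`. -/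
def waveOperator (C : EuclideanSpace ℝ (Fin d) → Matrix (Fin d) (Fin d) ℝ) (t : ℝ) :
    L2 d →L[ℂ] L2 d := functionOf (relaxedOperator C) (fun l => Real.cos (t * Real.sqrt l))

/-! ### The Riemannian quasi-distance -/

/-- The set of (continuous representatives of) real functions `ψ ∈ W^{1,∞}(ℝᵈ)` with
`∑ᵢⱼ cᵢⱼ ∂ᵢψ ∂ⱼψ ≤ 1` almost everywhere. -/
def testFunctions (C : EuclideanSpace ℝ (Fin d) → Matrix (Fin d) (Fin d) ℝ) :
    Set (EuclideanSpace ℝ (Fin d) → ℝ) :=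
  {ψ | Continuous ψ ∧ MemLp ψ ∞ volume ∧
    ∃ g : Fin d → EuclideanSpace ℝ (Fin d) → ℝ,
      (∀ i, MemLp (g i) ∞ volume ∧ IsWeakPartialDeriv i ψ (g i)) ∧
      ∀ᵐ x, ∑ i, ∑ j, C x i j * g i x * g j x ≤ 1}

/-- The quasi-distance `d(x; y) = sup (ψ(x) - ψ(y)) ∈ [0, ∞]` over the test functions `ψ`
(among which is `ψ = 0`). -/
def quasiDist (C : EuclideanSpace ℝ (Fin d) → Matrix (Fin d) (Fin d) ℝ)
    (x y : EuclideanSpace ℝ (Fin d)) : ℝ≥0∞ :=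
  ⨆ ψ ∈ testFunctions C, ENNReal.ofReal (ψ x - ψ y)

/-- `d(A; B) = inf d(x; y)` over `x ∈ A` and `y ∈ B`; it is `∞` if `A` or `B` is empty. -/
def setDist (C : EuclideanSpace ℝ (Fin d) → Matrix (Fin d) (Fin d) ℝ)
    (A B : Set (EuclideanSpace ℝ (Fin d))) : ℝ≥0∞ :=
  ⨅ x ∈ A, ⨅ y ∈ B, quasiDist C x y

/-- `φ ∈ L₂(A)`, as a subspace of `L₂(ℝᵈ)`: `φ` vanishes almost everywhere off `A`. -/
def SupportedIn (φ : L2 d) (A : Set (EuclideanSpace ℝ (Fin d))) : Prop :=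
  ∀ᵐ x, x ∉ A → φ x = 0

open Classical in
/-- `exp (-r ^ 2 / (4 t))` for `r ∈ [0, ∞]`, with the convention `exp (-∞) = 0`. -/
def gaussFactor (r : ℝ≥0∞) (t : ℝ) : ℝ :=
  if r = ⊤ then 0 else Real.exp (-(r.toReal ^ 2 / (4 * t)))

end Relax

end

/-!
Write `C = S²` with a measurable symmetric square root `S`. Then `h(φ) = ‖S ∇φ‖²` is the energy of
the linear relation `Γ = {(φ, S ∇φ)}` between `L₂(ℝᵈ)` and the square integrable vector fields. In
general `Γ` is not closable as an operator; its closure `K` may be multivalued. Discarding from `K`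
the multivalued part `{m | (0, m) ∈ K}` leaves a closed operator `T`, and `φ ↦ ‖T φ‖²` is the
relaxation (`isRelaxation_relForm`). The projection onto `K`, compressed to `L₂(ℝᵈ)`, is the
resolvent `R = (I + H₀)⁻¹` (`exists_resolvent`), so self-adjointness of `H₀` and the existence of
bounded functions `f(H₀)` follow from the functional calculus of the bounded operator `R`
(`isFunctionOf_functionOf`).

Both estimates come from Davies' perturbation method. For a test function `ψ`, the product rule
`S ∇(e^{2ρψ} φ) = e^{2ρψ} (S ∇φ + 2ρ (S ∇ψ) φ)` holds on `Γ` with bounded multipliers, hence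
passes to the closure `K` by continuity (`IsWeight.topologicalClosure`). It does not pass to `T`,
but an element of `K` is only ever paired with an element of the graph of `T`, and such a pairing
does not see the multivalued part (`inner_operatorPart_eq`). Since `|S ∇ψ| ≤ 1`, energy estimates
yield
`‖e^{ρψ} e^{-tH₀} φ‖ ≤ e^{ρ²t} ‖e^{ρψ} φ‖` and `‖e^{ρψ} cos(tH₀^{1/2}) φ‖ ≤ e^{|ρt|} ‖e^{ρψ} φ‖`.
To avoid differentiating vector valued functions, they are proved for the implicit Euler schemes of
the heat and the wave equation, which are explicit continuous functions of `R`
(`IsWeight.norm_heat_le`, `IsWeight.norm_wave_le`).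

The test functions are the bounded Lipschitz functions whose almost everywhere defined gradient
satisfies the pointwise constraint, and they form a lattice. So two compact sets at distance larger
than `r` are separated by one test function, with `ψ ≥ 0` on the first and `ψ ≤ -r` on the second
(`exists_testFunction_separating`). The weighted estimates then bound the matrix elements by
`e^{ρ²t - ρr}` and `e^{ρ(|t| - r)}`. The choice `ρ = r / (2t)` gives the Gaussian factor; letting
`ρ → ∞` gives finite speed of propagation for `|t| < r`, and strong continuity in `t` covers the
boundary case `|t| = d(A; B)`.
-/

noncomputable section

namespace Relax

/-! ### Linear relations and relaxation -/

section LinearRelations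

variable {E F : Type*} [NormedAddCommGroup E] [InnerProductSpace ℂ E]
  [NormedAddCommGroup F] [InnerProductSpace ℂ F]

/-- The functional `u ↦ inf {‖w‖ ^ 2 | (u, w) ∈ Γ}` defined by a linear relation `Γ ⊆ E × F`. -/
def relEnergy (Γ : Submodule ℂ (E × F)) (u : E) : ℝ≥0∞ :=
  ⨅ (w : F) (_ : (u, w) ∈ Γ), ENNReal.ofReal (‖w‖ ^ 2)

/-- The operator part of a linear relation `K`: the pairs `(u, w) ∈ K` with `w` orthogonal to the
multivalued part `{m | (0, m) ∈ K}`. It is the graph of an operator. -/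
def operatorPart (K : Submodule ℂ (E × F)) : Submodule ℂ (E × F) where
  carrier := {p | p ∈ K ∧ ∀ m : F, ((0 : E), m) ∈ K → inner ℂ m p.2 = 0}
  zero_mem' := ⟨K.zero_mem, fun m _ => inner_zero_right m⟩
  add_mem' := by
    rintro a b ⟨ha, ha'⟩ ⟨hb, hb'⟩
    refine ⟨K.add_mem ha hb, fun m hm => ?_⟩
    rw [Prod.snd_add, inner_add_right, ha' m hm, hb' m hm, add_zero]
  smul_mem' := by
    rintro c a ⟨ha, ha'⟩
    refine ⟨K.smul_mem c ha, fun m hm => ?_⟩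
    rw [Prod.smul_snd, inner_smul_right, ha' m hm, mul_zero]

variable {K : Submodule ℂ (E × F)}

lemma operatorPart_le : operatorPart K ≤ K := fun _ h => h.1

lemma operatorPart_singleValued :
    ∀ p ∈ operatorPart K, p.1 = 0 → p.2 = 0 := by
  rintro ⟨u, w⟩ ⟨hK, hm⟩ (rfl : u = 0)
  exact inner_self_eq_zero.1 (hm w hK)

lemma operatorPart_unique {u : E} {w w' : F} (h : (u, w) ∈ operatorPart K)
    (h' : (u, w') ∈ operatorPart K) : w = w' := by
  have := operatorPart_singleValued _ ((operatorPart K).sub_mem h h') (sub_self u)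
  exact sub_eq_zero.1 this

/-- Only the operator part of one of the two elements of `K` matters when they are paired. -/
lemma inner_operatorPart_eq {u v : E} {w w₀ z : F} (h : (u, w) ∈ K)
    (h₀ : (u, w₀) ∈ operatorPart K) (hz : (v, z) ∈ operatorPart K) :
    inner ℂ w₀ z = inner ℂ w z := by
  have h1 : ((0 : E), w - w₀) ∈ K := by
    simpa using K.sub_mem h (operatorPart_le h₀)
  have := hz.2 _ h1
  rw [inner_sub_left, sub_eq_zero] at this
  exact this.symm

lemma isClosed_operatorPart (hK : IsClosed (K : Set (E × F))) :
    IsClosed (operatorPart K : Set (E × F)) := by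
  have : (operatorPart K : Set (E × F)) = (K : Set (E × F)) ∩ ⋂ (m : F) (_ : ((0 : E), m) ∈ K),
      {p : E × F | inner ℂ m p.2 = 0} := by
    ext p
    simp only [Set.mem_inter_iff, Set.mem_iInter, Set.mem_ofPred_eq, SetLike.mem_coe]
    rfl
  rw [this]
  refine hK.inter (isClosed_iInter fun m => isClosed_iInter fun _ => ?_)
  exact isClosed_eq (by fun_prop) continuous_const

/-- The operator part of a closed relation has the same domain as the relation, since the orthogonal
projection off the multivalued part does not increase the norm. -/
lemma exists_operatorPart [CompleteSpace F] (hK : IsClosed (K : Set (E × F))) {u : E} {w : F}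
    (h : (u, w) ∈ K) : ∃ w₀ : F, (u, w₀) ∈ operatorPart K ∧ ‖w₀‖ ≤ ‖w‖ := by
  let M : Submodule ℂ F := K.comap (LinearMap.inr ℂ E F)
  have hM : IsClosed (M : Set F) :=
    hK.preimage (f := fun m : F => ((0 : E), m)) (by fun_prop)
  have : CompleteSpace M := hM.completeSpace_coe
  refine ⟨Mᗮ.starProjection w, ⟨?_, fun m hm => ?_⟩, ?_⟩
  · have h1 : M.starProjection w ∈ M := M.starProjection_apply_mem w
    have h2 : ((0 : E), M.starProjection w) ∈ K := h1
    have h3 := K.sub_mem h h2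
    rw [Submodule.starProjection_orthogonal_val]
    simpa using h3
  · exact Submodule.inner_right_of_mem_orthogonal (K := M) hm
      (Mᗮ.starProjection_apply_mem w)
  · exact Mᗮ.norm_starProjection_apply_le w

variable (K)

/-- The positive form `q(u, v) = (T u, T v)`, where `T` is the operator part of `K`. -/
def relForm : PositiveForm E where
  domain := (operatorPart K).toLinearPMap.domain
  form := LinearMap.mk₂'ₛₗ (starRingEnd ℂ) (RingHom.id ℂ)
    (fun u v => inner ℂ ((operatorPart K).toLinearPMap u) ((operatorPart K).toLinearPMap v))
    (fun u v w => by rw [LinearPMap.map_add, inner_add_left])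
    (fun c u v => by rw [LinearPMap.map_smul, inner_smul_left, smul_eq_mul])
    (fun u v w => by rw [LinearPMap.map_add, inner_add_right])
    (fun c u v => by rw [LinearPMap.map_smul, inner_smul_right, smul_eq_mul, RingHom.id_apply])
  symm u v := inner_conj_symm _ _
  nonneg u := inner_self_nonneg (𝕜 := ℂ)

variable {K}

lemma mem_relForm_domain {u : E} : u ∈ (relForm K).domain ↔ ∃ w, (u, w) ∈ operatorPart K := by
  change u ∈ (operatorPart K).map (LinearMap.fst ℂ E F) ↔ _
  simp

lemma relForm_apply {u v : (relForm K).domain} {w z : F} (hu : ((u : E), w) ∈ operatorPart K)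
    (hv : ((v : E), z) ∈ operatorPart K) : (relForm K).form u v = inner ℂ w z := by
  have key : ∀ (u : (relForm K).domain) (w : F), ((u : E), w) ∈ operatorPart K →
      (operatorPart K).toLinearPMap u = w := fun u w h =>
    operatorPart_unique
      (Submodule.mem_graph_toLinearPMap operatorPart_singleValued u) h
  change inner ℂ ((operatorPart K).toLinearPMap u) ((operatorPart K).toLinearPMap v) = _
  rw [key u w hu, key v z hv]

lemma relForm_quad {u : (relForm K).domain} {w : F} (hu : ((u : E), w) ∈ operatorPart K) :
    (relForm K).quad u = ‖w‖ ^ 2 := by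
  rw [PositiveForm.quad, relForm_apply hu hu, inner_self_eq_norm_sq_to_K]
  norm_cast

lemma relForm_isClosed [CompleteSpace F] (hK : IsClosed (K : Set (E × F))) :
    (relForm K).IsClosed := by
  intro u x hx hcauchy
  choose w hw using fun n => mem_relForm_domain.1 (u n).2
  have hsub : ∀ m n, (((u m - u n : (relForm K).domain) : E), w m - w n) ∈ operatorPart K :=
    fun m n => (operatorPart K).sub_mem (hw m) (hw n)
  have hw_cauchy : CauchySeq w := by
    rw [Metric.cauchySeq_iff]
    intro ε hε
    obtain ⟨N, hN⟩ := hcauchy (ε ^ 2) (by positivity)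
    refine ⟨N, fun m hm n hn => ?_⟩
    have := hN m hm n hn
    rw [relForm_quad (hsub m n)] at this
    rw [dist_eq_norm]
    exact lt_of_pow_lt_pow_left₀ 2 hε.le this
  obtain ⟨z, hz⟩ := cauchySeq_tendsto_of_complete hw_cauchy
  have hxz : (x, z) ∈ operatorPart K :=
    (isClosed_operatorPart hK).mem_of_tendsto (hx.prodMk_nhds hz) (Eventually.of_forall hw)
  refine ⟨mem_relForm_domain.2 ⟨z, hxz⟩, ?_⟩
  have : ∀ n, (relForm K).quad (u n - ⟨x, mem_relForm_domain.2 ⟨z, hxz⟩⟩) = ‖w n - z‖ ^ 2 :=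
    fun n => relForm_quad ((operatorPart K).sub_mem (hw n) hxz)
  simp_rw [this]
  have h0 : Tendsto (fun n => ‖w n - z‖) atTop (𝓝 0) := tendsto_iff_norm_sub_tendsto_zero.1 hz
  simpa using h0.pow 2

namespace PositiveForm

variable (q : PositiveForm E)

lemma quad_nonneg (u : q.domain) : 0 ≤ q.quad u := q.nonneg u

lemma quad_add (u v : q.domain) : q.quad (u + v) = q.quad u + q.quad v + 2 * (q.form u v).re := by
  have h := congrArg Complex.re (q.symm u v)
  simp only [Complex.conj_re] at h
  simp only [quad, map_add, LinearMap.add_apply, Complex.add_re]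
  linarith

lemma quad_smul_real (c : ℝ) (u : q.domain) : q.quad ((c : ℂ) • u) = c ^ 2 * q.quad u := by
  simp only [quad, map_smulₛₗ, LinearMap.smul_apply, smul_eq_mul, Complex.conj_ofReal,
    RingHom.id_apply]
  rw [← mul_assoc, ← Complex.ofReal_mul, Complex.re_ofReal_mul]
  simp [pow_two]

lemma form_cauchy_schwarz (u v : q.domain) : (q.form u v).re ^ 2 ≤ q.quad u * q.quad v := by
  have key : ∀ c : ℝ, 0 ≤ q.quad v * (c * c) + 2 * (q.form u v).re * c + q.quad u := by
    intro c
    have h := q.quad_nonneg (u + (c : ℂ) • v)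
    rw [quad_add, quad_smul_real] at h
    have h2 : (q.form u ((c : ℂ) • v)).re = c * (q.form u v).re := by
      simp
    rw [h2] at h
    nlinarith
  have := discrim_le_zero key
  rw [discrim] at this
  nlinarith

lemma energy_of_mem {u : E} (hu : u ∈ q.domain) :
    q.energy u = ENNReal.ofReal (q.quad ⟨u, hu⟩) := dif_pos hu

lemma energy_ne_top_iff {u : E} : q.energy u ≠ ⊤ ↔ u ∈ q.domain := by
  by_cases hu : u ∈ q.domain <;> simp [energy, hu]

/-- A form is determined by its energy, by polarization. -/
lemma ext_energy {p q : PositiveForm E} (h : p.energy = q.energy) : p = q := by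
  have hdom : p.domain = q.domain := by
    ext u
    rw [← energy_ne_top_iff, ← energy_ne_top_iff, h]
  have hquad : ∀ (u : E) (hp : u ∈ p.domain) (hq : u ∈ q.domain),
      p.quad ⟨u, hp⟩ = q.quad ⟨u, hq⟩ := by
    intro u hp hq
    have := congrFun h u
    rw [energy_of_mem p hp, energy_of_mem q hq] at this
    exact (ENNReal.ofReal_eq_ofReal_iff (p.quad_nonneg _) (q.quad_nonneg _)).1 this
  obtain ⟨D, f, hf, hf'⟩ := p
  obtain ⟨D', g, hg, hg'⟩ := q
  obtain rfl : D = D' := hdom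
  set p : PositiveForm E := ⟨D, f, hf, hf'⟩
  set q : PositiveForm E := ⟨D, g, hg, hg'⟩
  have hre : ∀ u v : D, (f u v).re = (g u v).re := by
    intro u v
    have h1 := p.quad_add u v
    have h2 := q.quad_add u v
    have e1 := hquad (u + v) (u + v).2 (u + v).2
    have e2 := hquad u u.2 u.2
    have e3 := hquad v v.2 v.2
    have e1' : p.quad (u + v) = q.quad (u + v) := e1
    have e2' : p.quad u = q.quad u := e2
    have e3' : p.quad v = q.quad v := e3
    have : (p.form u v).re = (q.form u v).re := by linarith
    exact this
  have : f = g := by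
    ext u v
    refine Complex.ext (hre u v) ?_
    have := hre u (Complex.I • v)
    simpa using this
  subst this
  rfl

/-- A closed form which is dominated by `‖w‖ ^ 2` on a linear relation is also dominated on the
closure of the relation. -/
lemma IsClosed.quad_le_of_closure (hq : q.IsClosed) {Γ : Submodule ℂ (E × F)}
    (hΓ : ∀ u w, (u, w) ∈ Γ → ∃ hu : u ∈ q.domain, q.quad ⟨u, hu⟩ ≤ ‖w‖ ^ 2) {u : E} {w : F}
    (h : (u, w) ∈ Γ.topologicalClosure) : ∃ hu : u ∈ q.domain, q.quad ⟨u, hu⟩ ≤ ‖w‖ ^ 2 := by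
  obtain ⟨p, hp, hlim⟩ := mem_closure_iff_seq_limit.1 h
  have hlim1 : Tendsto (fun n => (p n).1) atTop (𝓝 u) := (continuous_fst.tendsto _).comp hlim
  have hlim2 : Tendsto (fun n => (p n).2) atTop (𝓝 w) := (continuous_snd.tendsto _).comp hlim
  choose hd hle using fun n => hΓ (p n).1 (p n).2 (hp n)
  let U : ℕ → q.domain := fun n => ⟨(p n).1, hd n⟩
  have hsub : ∀ m n, q.quad (U m - U n) ≤ ‖(p m).2 - (p n).2‖ ^ 2 := fun m n =>
    (hΓ _ _ (Γ.sub_mem (hp m) (hp n))).2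
  obtain ⟨hu, hconv⟩ := hq U u hlim1 (fun ε hε => by
    obtain ⟨N, hN⟩ := Metric.cauchySeq_iff.1 hlim2.cauchySeq (√ε) (Real.sqrt_pos.2 hε)
    refine ⟨N, fun m hm n hn => (hsub m n).trans_lt ?_⟩
    have := hN m hm n hn
    rw [dist_eq_norm] at this
    exact (Real.lt_sqrt (norm_nonneg _)).1 this)
  refine ⟨hu, ?_⟩
  -- the triangle inequality for the seminorm `√q`
  have hbound : ∀ n, q.quad ⟨u, hu⟩ ≤
      (√(q.quad (U n - ⟨u, hu⟩)) + ‖(p n).2‖) ^ 2 := by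
    intro n
    set a := U n - ⟨u, hu⟩
    have h1 : (⟨u, hu⟩ : q.domain) = U n + ((-1 : ℝ) : ℂ) • a := by
      simp [a]
    have h2 := q.quad_add (U n) (((-1 : ℝ) : ℂ) • a)
    rw [← h1, quad_smul_real] at h2
    have h3 := q.form_cauchy_schwarz (U n) (((-1 : ℝ) : ℂ) • a)
    rw [quad_smul_real] at h3
    have h4 : q.quad (U n) ≤ ‖(p n).2‖ ^ 2 := hle n
    have h5 : √(q.quad a) ^ 2 = q.quad a := Real.sq_sqrt (q.quad_nonneg _)
    have h6 : (q.form (U n) (((-1 : ℝ) : ℂ) • a)).re ≤ ‖(p n).2‖ * √(q.quad a) := by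
      apply le_of_sq_le_sq _ (by positivity)
      rw [mul_pow, h5]
      refine h3.trans ?_
      have := q.quad_nonneg a
      nlinarith
    nlinarith
  have hl : Tendsto (fun n => (√(q.quad (U n - ⟨u, hu⟩)) + ‖(p n).2‖) ^ 2) atTop
      (𝓝 ((√0 + ‖w‖) ^ 2)) :=
    (((Real.continuous_sqrt.tendsto _).comp hconv).add hlim2.norm).pow 2
  have := ge_of_tendsto' hl hbound
  simpa using this

end PositiveForm

/-- The relaxation of `u ↦ inf {‖w‖ ^ 2 | (u, w) ∈ Γ}` is the form of the operator part of the
closure of `Γ`. -/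
theorem isRelaxation_relForm [CompleteSpace F] (Γ : Submodule ℂ (E × F)) :
    IsRelaxation (relEnergy Γ) (relForm Γ.topologicalClosure) := by
  have hK := Γ.isClosed_topologicalClosure
  refine ⟨⟨relForm_isClosed hK, fun u => ?_⟩, fun q hq hle u => ?_⟩
  · refine le_iInf₂ fun w hw => ?_
    obtain ⟨w₀, h₀, hle⟩ := exists_operatorPart hK (Γ.le_topologicalClosure hw)
    rw [PositiveForm.energy_of_mem _ (mem_relForm_domain.2 ⟨w₀, h₀⟩), relForm_quad h₀]
    gcongr
  · by_cases hu : u ∈ (relForm Γ.topologicalClosure).domain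
    · obtain ⟨w, hw⟩ := mem_relForm_domain.1 hu
      have hΓ : ∀ u w, (u, w) ∈ Γ → ∃ hu : u ∈ q.domain, q.quad ⟨u, hu⟩ ≤ ‖w‖ ^ 2 := by
        intro u w h
        have h1 : q.energy u ≤ ENNReal.ofReal (‖w‖ ^ 2) := (hle u).trans (iInf₂_le w h)
        have hu : u ∈ q.domain :=
          q.energy_ne_top_iff.1 (ne_top_of_le_ne_top ENNReal.ofReal_ne_top h1)
        rw [q.energy_of_mem hu] at h1
        exact ⟨hu, (ENNReal.ofReal_le_ofReal_iff (by positivity)).1 h1⟩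
      obtain ⟨hq', hle'⟩ := hq.quad_le_of_closure q hΓ (operatorPart_le hw)
      rw [q.energy_of_mem hq', PositiveForm.energy_of_mem _ hu, relForm_quad hw]
      exact ENNReal.ofReal_le_ofReal hle'
    · have : (relForm Γ.topologicalClosure).energy u = ⊤ := dif_neg hu
      rw [this]
      exact le_top

lemma IsRelaxation.relaxation_eq {h : E → ℝ≥0∞} {q : PositiveForm E} (hq : IsRelaxation h q) :
    relaxation h = q := by
  have h1 : IsRelaxation h (relaxation h) := Classical.epsilon_spec ⟨q, hq⟩
  exact PositiveForm.ext_energy (le_antisymm (hq.2 _ h1.1.1 h1.1.2) (h1.2 _ hq.1.1 hq.1.2))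

/-! ### The associated operator and its resolvent -/

lemma PositiveForm.graph_operator {q : PositiveForm E} (hq : Dense (q.domain : Set E)) :
    q.operator.graph = q.operatorGraph := by
  refine Submodule.toLinearPMap_graph_eq _ ?_
  rintro ⟨u, f⟩ ⟨hu, h⟩ (rfl : u = 0)
  refine hq.eq_zero_of_inner_left (𝕜 := ℂ) fun v hv => ?_
  rw [← inner_conj_symm, ← h ⟨v, hv⟩]
  rw [show q.form ⟨v, hv⟩ ⟨((0 : E), f).1, hu⟩ = 0 from map_zero (q.form ⟨v, hv⟩), map_zero]

lemma mem_relForm_operatorGraph {u f : E} :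
    (u, f) ∈ (relForm K).operatorGraph ↔ ∃ w, (u, w) ∈ operatorPart K ∧
      ∀ v z, (v, z) ∈ operatorPart K → inner ℂ z w = inner ℂ v f := by
  constructor
  · rintro ⟨hu, h⟩
    obtain ⟨w, hw⟩ := mem_relForm_domain.1 hu
    refine ⟨w, hw, fun v z hz => ?_⟩
    rw [← h ⟨v, mem_relForm_domain.2 ⟨z, hz⟩⟩]
    exact (relForm_apply hz hw).symm
  · rintro ⟨w, hw, h⟩
    refine ⟨mem_relForm_domain.2 ⟨w, hw⟩, fun v => ?_⟩
    obtain ⟨z, hz⟩ := mem_relForm_domain.1 v.2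
    rw [← h v z hz]
    exact relForm_apply hz hw

/-- The resolvent `(I + H)⁻¹` of the operator of `relForm K` is the compression to `E` of the
orthogonal projection of `E ⊕ F` onto `K`. -/
theorem exists_resolvent [CompleteSpace E] [CompleteSpace F] (hK : IsClosed (K : Set (E × F))) :
    ∃ R : E →L[ℂ] E, (∀ f u : E, R f = u ↔ (u, f - u) ∈ (relForm K).operatorGraph) ∧
      R.IsPositive ∧ ‖R‖ ≤ 1 := by
  let e := WithLp.prodContinuousLinearEquiv 2 ℂ E F
  let L : Submodule ℂ (WithLp 2 (E × F)) := K.comap (e : WithLp 2 (E × F) →ₗ[ℂ] E × F)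
  have hL : IsClosed (L : Set (WithLp 2 (E × F))) := hK.preimage e.continuous
  have : CompleteSpace L := hL.completeSpace_coe
  let ι : E →L[ℂ] WithLp 2 (E × F) := e.symm.toContinuousLinearMap ∘L .inl ℂ E F
  let R : E →L[ℂ] E := .fst ℂ E F ∘L e.toContinuousLinearMap ∘L L.starProjection ∘L ι
  have hι : ∀ f, ι f = WithLp.toLp 2 (f, (0 : F)) := fun f => rfl
  have hιn : ∀ f, ‖ι f‖ = ‖f‖ := fun f => by
    rw [hι, WithLp.prod_norm_eq_of_L2]
    simp
  have hR : ∀ f, R f = (L.starProjection (ι f)).fst := fun f => rfl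
  have hin : ∀ f g, inner ℂ (R f) g = inner ℂ (L.starProjection (ι f)) (ι g) := fun f g => by
    rw [WithLp.prod_inner_apply, hι g, hR]
    simp
  have hin' : ∀ f g, inner ℂ f (R g) = inner ℂ (ι f) (L.starProjection (ι g)) := fun f g => by
    rw [WithLp.prod_inner_apply, hι f, hR]
    simp
  have hmem : ∀ f, (R f, f - R f) ∈ (relForm K).operatorGraph := by
    intro f
    set p := L.starProjection (ι f) with hp
    have hpL : (p.fst, p.snd) ∈ K := L.starProjection_apply_mem (ι f)
    have horth : ∀ v z, (v, z) ∈ K → inner ℂ v (f - p.fst) = inner ℂ z p.snd := by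
      intro v z h
      have h1 : inner ℂ (WithLp.toLp 2 (v, z)) (ι f - p) = 0 :=
        Submodule.inner_right_of_mem_orthogonal (K := L) h
          (L.sub_starProjection_mem_orthogonal (ι f))
      rw [WithLp.prod_inner_apply, hι f] at h1
      simp only [WithLp.ofLp_sub, Prod.fst_sub, Prod.snd_sub, zero_sub, inner_neg_right] at h1
      rw [← sub_eq_add_neg, sub_eq_zero] at h1
      exact h1
    refine mem_relForm_operatorGraph.2 ⟨p.snd, ⟨hpL, fun m hm => ?_⟩, fun v z hz => ?_⟩
    · rw [← horth 0 m hm, inner_zero_left]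
    · exact (horth v z (operatorPart_le hz)).symm
  refine ⟨R, fun f u => ⟨?_, fun h => ?_⟩, ?_, ?_⟩
  · rintro rfl
    exact hmem f
  · have h1 := (relForm K).operatorGraph.sub_mem (hmem f) h
    obtain ⟨w, hw, h2⟩ := mem_relForm_operatorGraph.1 h1
    have h3 := h2 _ _ hw
    have h4 : f - R f - (f - u) = -(R f - u) := by abel
    simp only [h4, inner_neg_right, inner_self_eq_norm_sq_to_K] at h3
    have h5 : ‖w‖ ^ 2 = -‖R f - u‖ ^ 2 := by exact_mod_cast h3
    have h6 : ‖R f - u‖ ^ 2 = 0 := le_antisymm (by nlinarith [sq_nonneg ‖w‖]) (by positivity)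
    simpa [sub_eq_zero] using h6
  · refine ⟨fun f g => ?_, fun f => ?_⟩
    · change inner ℂ (R f) g = inner ℂ f (R g)
      rw [hin, hin']
      exact L.inner_starProjection_left_eq_right _ _
    · change 0 ≤ (inner ℂ (R f) f).re
      rw [hin]
      exact L.re_inner_starProjection_nonneg (ι f)
  · refine R.opNorm_le_bound zero_le_one fun f => ?_
    rw [one_mul, ← hιn f, hR]
    exact (WithLp.norm_fst_le _ _).trans (L.norm_starProjection_apply_le (ι f))

/-- The kernel of the self-adjoint `R` is the orthogonal complement of its range, and `R f = 0` means
`H 0 = f`. -/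
lemma denseRange_of_resolvent [CompleteSpace E] {q : PositiveForm E}
    (hq : Dense (q.domain : Set E)) {R : E →L[ℂ] E}
    (hR : ∀ f u : E, R f = u ↔ (u, f - u) ∈ q.operatorGraph) (hpos : R.IsPositive) :
    DenseRange R := by
  have h : Dense (LinearMap.range R.toLinearMap : Set E) := by
    rw [Submodule.dense_iff_topologicalClosure_eq_top, Submodule.topologicalClosure_eq_top_iff,
      Submodule.eq_bot_iff]
    intro f hf
    have h3 : R f = 0 := by
      refine ext_inner_left ℂ fun g => ?_
      rw [inner_zero_right, ← (Submodule.mem_orthogonal _ _).1 hf _ (LinearMap.mem_range_self _ g)]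
      exact (hpos.1 g f).symm
    have h4 : ((0 : E), f) ∈ q.operatorGraph := by simpa [h3] using (hR f (R f)).1 rfl
    rw [← PositiveForm.graph_operator hq] at h4
    exact LinearPMap.graph_fst_eq_zero_snd _ h4 rfl
  exact h

/-- The graph of the adjoint consists of the pairs `(y, z)` with `R (y + z) = y`, by symmetry of the
resolvent `R`; these form the graph of the operator itself. -/
theorem isSelfAdjoint_of_resolvent [CompleteSpace E] {q : PositiveForm E}
    {R : E →L[ℂ] E} (hR : IsResolvent q.operator R)
    (hpos : R.IsPositive) (hd : DenseRange R) : IsSelfAdjoint q.operator := by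
  have hdense : Dense (q.operator.domain : Set E) := hd.mono (Set.range_subset_iff.2 fun f =>
    LinearPMap.mem_domain_of_mem_graph ((hR f (R f)).1 rfl))
  rw [LinearPMap.isSelfAdjoint_def]
  refine LinearPMap.eq_of_eq_graph ?_
  have hsymm : ∀ f g, inner ℂ (R f) g = inner ℂ f (R g) := hpos.1
  rw [LinearPMap.adjoint_graph_eq_graph_adjoint hdense]
  ext ⟨y, z⟩
  rw [Submodule.mem_adjoint_iff]
  constructor
  · intro h
    have h1 : R (y + z) = y := by
      refine ext_inner_left ℂ fun f => ?_
      have h2 := h _ _ ((hR f (R f)).1 rfl)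
      simp only [inner_sub_left] at h2
      rw [← hsymm, inner_add_right]
      linear_combination -h2
    simpa using (hR (y + z) y).1 h1
  · intro h a b hab
    have h1 : R (a + b) = a := (hR _ _).2 (by simpa using hab)
    have h2 : R (y + z) = y := (hR _ _).2 (by simpa using h)
    have h3 := hsymm (a + b) (y + z)
    rw [h1, h2, inner_add_left, inner_add_right] at h3
    dsimp only
    linear_combination -h3

end LinearRelations

/-! ### Functional calculus through the resolvent -/

section Calculus

variable {E : Type*} [NormedAddCommGroup E] [InnerProductSpace ℂ E]

lemma IsResolvent.unique {H : E →ₗ.[ℂ] E} {R R' : E →L[ℂ] E} (h : IsResolvent H R)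
    (h' : IsResolvent H R') : R = R' := by
  ext f
  exact ((h f _).2 ((h' f _).1 rfl))

/-- Strong convergence of a bounded sequence of operators needs to be checked on a dense range
only. -/
lemma tendsto_apply_of_denseRange {S : ℕ → E →L[ℂ] E} {T Q : E →L[ℂ] E} (hQ : DenseRange Q)
    {M : ℝ} (hM : ∀ n, ‖S n‖ ≤ M) (h : ∀ x, Tendsto (fun n => S n (Q x)) atTop (𝓝 (T (Q x))))
    (x : E) : Tendsto (fun n => S n x) atTop (𝓝 (T x)) := by
  have hM0 : 0 ≤ M := (norm_nonneg _).trans (hM 0)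
  rw [Metric.tendsto_atTop]
  intro ε hε
  set A := M + ‖T‖ + 1
  have hA : 0 < A := by positivity
  obtain ⟨y, hy⟩ := hQ.exists_dist_lt x (ε := ε / (2 * A)) (by positivity)
  obtain ⟨N, hN⟩ := Metric.tendsto_atTop.1 (h y) (ε / 2) (by positivity)
  refine ⟨N, fun n hn => ?_⟩
  have h1 := hN n hn
  rw [dist_eq_norm] at h1 hy ⊢
  have h2 : S n x - T x = (S n - T) (x - Q y) + (S n (Q y) - T (Q y)) := by
    simp only [sub_apply, map_sub]
    abel
  have h3 : ‖(S n - T) (x - Q y)‖ ≤ A * (ε / (2 * A)) := by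
    refine ((S n - T).le_opNorm _).trans (mul_le_mul ?_ hy.le (norm_nonneg _) hA.le)
    refine (norm_sub_le _ _).trans ?_
    linarith [hM n]
  have h4 : A * (ε / (2 * A)) = ε / 2 := by field_simp
  rw [h2]
  refine (norm_add_le _ _).trans_lt ?_
  linarith

variable [CompleteSpace E]

lemma spectrum_subset_Icc {R : E →L[ℂ] E} (hpos : R.IsPositive) (hle : ‖R‖ ≤ 1) :
    spectrum ℝ R ⊆ Set.Icc 0 1 := by
  intro r hr
  have h0 : 0 ≤ r :=
    spectrum_nonneg_of_nonneg ((ContinuousLinearMap.nonneg_iff_isPositive R).2 hpos) hr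
  have h1 : ‖r‖ ≤ ‖R‖ * ‖(1 : E →L[ℂ] E)‖ := spectrum.norm_le_norm_mul_of_mem hr
  have h2 : ‖(1 : E →L[ℂ] E)‖ ≤ 1 := ContinuousLinearMap.norm_id_le
  refine ⟨h0, ?_⟩
  rw [Real.norm_of_nonneg h0] at h1
  exact h1.trans (mul_le_one₀ hle (norm_nonneg _) h2)

lemma continuousOn_mul_comp_inv_sub_one {f : ℝ → ℝ} (hf : ContinuousOn f (Set.Ici 0)) {M : ℝ}
    (hM : ∀ l, 0 ≤ l → |f l| ≤ M) : ContinuousOn (fun r : ℝ => r * f (r⁻¹ - 1)) (Set.Icc 0 1) := by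
  have hmaps : ∀ r : ℝ, 0 < r → r ≤ 1 → 0 ≤ r⁻¹ - 1 := fun r h0 h1 =>
    sub_nonneg.2 ((one_le_inv₀ h0).2 h1)
  intro r hr
  rcases hr.1.eq_or_lt with rfl | h0
  · have : Tendsto (fun r : ℝ => r * f (r⁻¹ - 1)) (𝓝[Set.Icc 0 1] 0) (𝓝 0) := by
      refine squeeze_zero_norm' (a := fun r => r * M) ?_ ?_
      · filter_upwards [self_mem_nhdsWithin] with r hr
        rcases hr.1.eq_or_lt with rfl | h0
        · simp
        · rw [norm_mul, Real.norm_of_nonneg hr.1]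
          exact mul_le_mul_of_nonneg_left (hM _ (hmaps r h0 hr.2)) hr.1
      · have : Tendsto (fun r : ℝ => r * M) (𝓝 0) (𝓝 (0 * M)) :=
          (continuous_id.mul continuous_const).tendsto 0
        rw [zero_mul] at this
        exact this.mono_left nhdsWithin_le_nhds
    simpa [ContinuousWithinAt] using this
  · have h1 : ContinuousWithinAt (fun r : ℝ => r⁻¹ - 1) (Set.Icc 0 1 ∩ Set.Ioi 0) r :=
      ((continuousAt_inv₀ h0.ne').sub continuousAt_const).continuousWithinAt
    have h2 : ContinuousWithinAt (fun r : ℝ => r * f (r⁻¹ - 1)) (Set.Icc 0 1 ∩ Set.Ioi 0) r :=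
      continuousWithinAt_id.mul (ContinuousWithinAt.comp (t := Set.Ici 0)
        (hf _ (hmaps r h0 hr.2)) h1 fun s hs => hmaps s hs.2 hs.1.2)
    exact (continuousWithinAt_inter (Ioi_mem_nhds h0)).1 h2

/-- If `|g(r)| ≤ M r` on the spectrum of `R`, then `‖g(R) x‖ ≤ M ‖R x‖`. -/
lemma norm_cfc_apply_le {R : E →L[ℂ] E} (hpos : R.IsPositive) (hle : ‖R‖ ≤ 1)
    {g : ℝ → ℝ} (hg : ContinuousOn g (Set.Icc 0 1)) {M : ℝ} (hM0 : 0 ≤ M)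
    (hM : ∀ r ∈ Set.Icc (0 : ℝ) 1, |g r| ≤ M * r) (x : E) : ‖cfc g R x‖ ≤ M * ‖R x‖ := by
  have hspec := spectrum_subset_Icc hpos hle
  have hR : IsSelfAdjoint R := hpos.isSelfAdjoint
  have hgR : IsSelfAdjoint (cfc g R) := cfc_predicate g R
  have hg' := hg.mono hspec
  have h1 : 0 ≤ cfc (fun r => M ^ 2 * (r * r) - g r * g r) R := by
    refine cfc_nonneg fun r hr => ?_
    have := hM r (hspec hr)
    have h := abs_le_abs_of_nonneg (abs_nonneg _) this
    have := sq_le_sq' (by linarith [abs_nonneg (g r)]) this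
    rw [sq_abs] at this
    nlinarith
  have h2 : cfc (fun r => M ^ 2 * (r * r) - g r * g r) R = (M ^ 2) • (R * R) - cfc g R * cfc g R := by
    rw [cfc_sub (fun r => M ^ 2 * (r * r)) (fun r => g r * g r) R (by fun_prop) (hg'.mul hg'),
      cfc_mul g g R hg' hg', cfc_const_mul (M ^ 2) (fun r => r * r) R (by fun_prop),
      cfc_mul (fun r => r) (fun r => r) R (by fun_prop) (by fun_prop), cfc_id' ℝ R]
  rw [h2, ContinuousLinearMap.nonneg_iff_isPositive] at h1
  have h3 := h1.2 x
  have hs : ∀ {A : E →L[ℂ] E}, IsSelfAdjoint A → inner ℂ (A (A x)) x = ((‖A x‖ ^ 2 : ℝ) : ℂ) := by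
    intro A hA
    have := hA.isSymmetric (A x) x
    change inner ℂ (A (A x)) x = _ at this
    rw [this]
    exact (inner_self_eq_norm_sq_to_K (𝕜 := ℂ) (A x)).trans (by norm_cast)
  have h4 : ((M ^ 2 : ℝ) • (R * R) - cfc g R * cfc g R).reApplyInnerSelf x =
      M ^ 2 * ‖R x‖ ^ 2 - ‖cfc g R x‖ ^ 2 := by
    change (inner ℂ (((M ^ 2 : ℝ) • R (R x)) - cfc g R (cfc g R x)) x).re = _
    rw [inner_sub_left, hs hgR, inner_smul_left_eq_smul, hs hR, Complex.sub_re, Complex.ofReal_re,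
      Complex.smul_re, Complex.ofReal_re, smul_eq_mul]
  rw [h4] at h3
  refine le_of_sq_le_sq ?_ (by positivity)
  nlinarith

/-- The bounded operator `f(H)` exists: `R x ↦ g(R) x`, with `g(r) = r f(1 / r - 1)`, is bounded on
the dense range of `R`. -/
theorem exists_mul_eq_cfc {R : E →L[ℂ] E} (hpos : R.IsPositive) (hle : ‖R‖ ≤ 1)
    (hd : DenseRange R) {f : ℝ → ℝ} (hf : ContinuousOn f (Set.Ici 0)) {M : ℝ}
    (hM : ∀ l, 0 ≤ l → |f l| ≤ M) :
    ∃ T : E →L[ℂ] E, T * R = cfc (fun r : ℝ => r * f (r⁻¹ - 1)) R := by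
  set g : ℝ → ℝ := fun r => r * f (r⁻¹ - 1)
  have hM0 : 0 ≤ M := (abs_nonneg _).trans (hM 0 le_rfl)
  have hb : ∀ x, ‖cfc g R x‖ ≤ M * ‖R x‖ := by
    refine norm_cfc_apply_le hpos hle (continuousOn_mul_comp_inv_sub_one hf hM) hM0 fun r hr => ?_
    rcases hr.1.eq_or_lt with rfl | h0
    · simp
    · rw [abs_mul, abs_of_nonneg hr.1, mul_comm]
      exact mul_le_mul_of_nonneg_right (hM _ (sub_nonneg.2 ((one_le_inv₀ h0).2 hr.2))) hr.1
  refine ⟨(cfc g R).toLinearMap.extendOfNorm R.toLinearMap, ?_⟩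
  ext x
  exact LinearMap.extendOfNorm_eq (f := (cfc g R).toLinearMap) (e := R.toLinearMap) hd ⟨M, hb⟩ x

theorem isFunctionOf_functionOf {H : E →ₗ.[ℂ] E} {R : E →L[ℂ] E} (hR : IsResolvent H R)
    (hpos : R.IsPositive) (hle : ‖R‖ ≤ 1) (hd : DenseRange R) {f : ℝ → ℝ}
    (hf : ContinuousOn f (Set.Ici 0)) {M : ℝ} (hM : ∀ l, 0 ≤ l → |f l| ≤ M) :
    IsFunctionOf H f (functionOf H f) := by
  obtain ⟨T, hT⟩ := exists_mul_eq_cfc hpos hle hd hf hM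
  exact Classical.epsilon_spec (p := IsFunctionOf H f) ⟨T, R, hR, hT⟩

lemma IsFunctionOf.mul_eq {H : E →ₗ.[ℂ] E} {R T : E →L[ℂ] E} {f : ℝ → ℝ}
    (h : IsFunctionOf H f T) (hR : IsResolvent H R) :
    T * R = cfc (fun r : ℝ => r * f (r⁻¹ - 1)) R := by
  obtain ⟨R', hR', hT⟩ := h
  rwa [hR'.unique hR] at hT

/-- Bounded functions `p n` of `R` converge strongly to `f(H)` as soon as `r ^ 2 p n (r)` converges
uniformly to `r ^ 2 f (1 / r - 1)`, since the range of `R ^ 2` is dense. -/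
theorem tendsto_cfc_apply {R T : E →L[ℂ] E} (hpos : R.IsPositive) (hle : ‖R‖ ≤ 1)
    (hd : DenseRange R) {f : ℝ → ℝ} (hf : ContinuousOn f (Set.Ici 0)) {M : ℝ}
    (hM : ∀ l, 0 ≤ l → |f l| ≤ M) (hT : T * R = cfc (fun r : ℝ => r * f (r⁻¹ - 1)) R)
    {p : ℕ → ℝ → ℝ} (hp : ∀ n, ContinuousOn (p n) (Set.Icc 0 1))
    (hp1 : ∀ n, ∀ r ∈ Set.Icc (0 : ℝ) 1, |p n r| ≤ M) {δ : ℕ → ℝ} (hδ : Tendsto δ atTop (𝓝 0))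
    (hpf : ∀ n, ∀ r ∈ Set.Ioc (0 : ℝ) 1, r ^ 2 * |p n r - f (r⁻¹ - 1)| ≤ δ n) (x : E) :
    Tendsto (fun n => cfc (p n) R x) atTop (𝓝 (T x)) := by
  have hM0 : 0 ≤ M := (abs_nonneg _).trans (hM 0 le_rfl)
  have hspec := spectrum_subset_Icc hpos hle
  have hR : IsSelfAdjoint R := hpos.isSelfAdjoint
  have hd2 : DenseRange (R * R : E →L[ℂ] E) := hd.comp hd R.continuous
  have hδ0 : ∀ n, 0 ≤ δ n := fun n =>
    (by positivity : (0 : ℝ) ≤ 1 ^ 2 * |p n 1 - f (1⁻¹ - 1)|).trans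
      (hpf n 1 ⟨zero_lt_one, le_rfl⟩)
  refine tendsto_apply_of_denseRange hd2 (M := M) (fun n => norm_cfc_le hM0 fun r hr =>
    hp1 n r (hspec hr)) (fun y => ?_) x
  have hg := (continuousOn_mul_comp_inv_sub_one hf hM).mono hspec
  have e1 : ∀ n, cfc (p n) R * (R * R) = cfc (fun r => p n r * (r * r)) R := fun n => by
    rw [cfc_mul (p n) (fun r => r * r) R ((hp n).mono hspec) (by fun_prop),
      cfc_mul (fun r => r) (fun r => r) R (by fun_prop) (by fun_prop), cfc_id' ℝ R]
  have e2 : T * (R * R) = cfc (fun r => (r * f (r⁻¹ - 1)) * r) R := by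
    rw [cfc_mul _ (fun r => r) R hg (by fun_prop), cfc_id' ℝ R, ← hT, mul_assoc]
  have key : ∀ n, ‖cfc (p n) R ((R * R) y) - T ((R * R) y)‖ ≤ δ n * ‖y‖ := by
    intro n
    have : cfc (p n) R ((R * R) y) - T ((R * R) y) =
        (cfc (p n) R * (R * R) - T * (R * R)) y := rfl
    rw [this, e1, e2, ← cfc_sub (fun r => p n r * (r * r)) (fun r => (r * f (r⁻¹ - 1)) * r) R
      (((hp n).mono hspec).mul (by fun_prop)) (hg.mul (by fun_prop))]
    refine ContinuousLinearMap.le_of_opNorm_le _ (norm_cfc_le (hδ0 n) fun r hr => ?_) y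
    rcases (hspec hr).1.eq_or_lt with rfl | h0
    · simpa using hδ0 n
    · have h1 := hpf n r ⟨h0, (hspec hr).2⟩
      rw [← abs_of_nonneg (sq_nonneg r), ← abs_mul] at h1
      rw [Real.norm_eq_abs]
      refine le_trans (le_of_eq (congrArg _ ?_)) h1
      ring
  rw [tendsto_iff_norm_sub_tendsto_zero]
  refine squeeze_zero (fun _ => norm_nonneg _) key ?_
  simpa using hδ.mul_const ‖y‖

/-- Pairs of functions of the resolvent which lie in the graph `G` of `H`: in terms of the spectral
variable `l` of `H`, with `r = (1 + l)⁻¹`, the condition on `φ` and `η` is `η = l φ`. -/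
lemma cfc_mem_graph {G : Submodule ℂ (E × E)} {R : E →L[ℂ] E}
    (hR : ∀ f u : E, R f = u ↔ (u, f - u) ∈ G) (hpos : R.IsPositive) (hle : ‖R‖ ≤ 1)
    {φ η : ℝ → ℝ} (hφ : ContinuousOn φ (Set.Icc 0 1)) (hη : ContinuousOn η (Set.Icc 0 1))
    (h : ∀ r ∈ Set.Icc (0 : ℝ) 1, r * (φ r + η r) = φ r) (x : E) :
    (cfc φ R x, cfc η R x) ∈ G := by
  have hspec := spectrum_subset_Icc hpos hle
  have hsa : IsSelfAdjoint R := hpos.isSelfAdjoint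
  have h1 : R * (cfc φ R + cfc η R) = cfc φ R := by
    rw [← cfc_add (a := R) φ η (hφ.mono hspec) (hη.mono hspec)]
    conv_lhs => rw [← cfc_id' ℝ R]
    conv_lhs => enter [2]; rw [cfc_id' ℝ R]
    rw [← cfc_mul (fun r => r) (fun r => φ r + η r) R (by fun_prop)
      ((hφ.mono hspec).add (hη.mono hspec))]
    exact cfc_congr fun r hr => h r (hspec hr)
  have h2 := (hR (cfc φ R x + cfc η R x) (cfc φ R x)).1 (DFunLike.congr_fun h1 x)
  simpa using h2

end Calculus

/-! ### Scalar Euler schemes -/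

lemma norm_pow_sub_pow_le {a b : ℂ} (ha : ‖a‖ ≤ 1) (hb : ‖b‖ ≤ 1) (n : ℕ) :
    ‖a ^ n - b ^ n‖ ≤ n * ‖a - b‖ := by
  induction n with
  | zero => simp
  | succ n ih =>
    have h : a ^ (n + 1) - b ^ (n + 1) = a * (a ^ n - b ^ n) + (a - b) * b ^ n := by ring
    rw [h]
    refine (norm_add_le _ _).trans ?_
    rw [norm_mul, norm_mul, norm_pow]
    have h1 : ‖a‖ * ‖a ^ n - b ^ n‖ ≤ 1 * (n * ‖a - b‖) :=
      mul_le_mul ha ih (norm_nonneg _) zero_le_one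
    have h2 : ‖a - b‖ * ‖b‖ ^ n ≤ ‖a - b‖ * 1 :=
      mul_le_mul_of_nonneg_left (pow_le_one₀ (norm_nonneg _) hb) (norm_nonneg _)
    push_cast
    linarith

lemma one_le_norm_one_sub_mul_I (y : ℝ) : 1 ≤ ‖(1 : ℂ) - y * Complex.I‖ := by
  have : (1 : ℝ) = ((1 : ℂ) - y * Complex.I).re := by simp
  exact this.le.trans (Complex.re_le_norm _)

lemma norm_inv_one_sub_mul_I_sub_exp_le (y : ℝ) :
    ‖((1 : ℂ) - y * Complex.I)⁻¹ - Complex.exp (y * Complex.I)‖ ≤ 3 * y ^ 2 := by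
  have hn := one_le_norm_one_sub_mul_I y
  have hne : (1 : ℂ) - y * Complex.I ≠ 0 := fun h => by
    rw [h, norm_zero] at hn
    linarith
  have h1 : ((1 : ℂ) - y * Complex.I)⁻¹ - Complex.exp (y * Complex.I) =
      ((1 : ℂ) - y * Complex.I)⁻¹ * Complex.exp (y * Complex.I) *
        (Complex.exp (-(y * Complex.I)) - 1 - -(y * Complex.I)) := by
    have h : Complex.exp (y * Complex.I) * Complex.exp (-(y * Complex.I)) = 1 := by
      rw [← Complex.exp_add, add_neg_cancel, Complex.exp_zero]
    field_simp
    linear_combination -h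
  have h2 : ‖Complex.exp (-(y * Complex.I)) - 1 - -(y * Complex.I)‖ ≤ 3 * y ^ 2 := by
    have hny : ‖-((y : ℂ) * Complex.I)‖ = |y| := by simp
    by_cases hy : |y| ≤ 1
    · refine (Complex.norm_exp_sub_one_sub_id_le (by rwa [hny])).trans ?_
      rw [hny, sq_abs]
      nlinarith [sq_nonneg y]
    · push Not at hy
      have h3 : ‖Complex.exp (-(y * Complex.I))‖ = 1 := by
        rw [← neg_mul, ← Complex.ofReal_neg]
        exact Complex.norm_exp_ofReal_mul_I _
      refine (norm_sub_le _ _).trans ?_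
      have := norm_sub_le (Complex.exp (-(y * Complex.I))) 1
      rw [h3, norm_one] at this
      rw [hny]
      nlinarith [sq_abs y]
  rw [h1, norm_mul, norm_mul, Complex.norm_exp_ofReal_mul_I, mul_one, norm_inv]
  exact (mul_le_of_le_one_left (norm_nonneg _) (inv_le_one_of_one_le₀ hn)).trans h2

lemma abs_inv_one_add_sub_exp_le {y : ℝ} (hy : 0 ≤ y) : |(1 + y)⁻¹ - Real.exp (-y)| ≤ y ^ 2 := by
  have h1 : Real.exp (-y) ≤ (1 + y)⁻¹ := by
    rw [Real.exp_neg]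
    exact inv_anti₀ (by positivity) (by linarith [Real.add_one_le_exp y])
  have h2 : 1 - y ≤ Real.exp (-y) := by linarith [Real.add_one_le_exp (-y)]
  have h3 : (1 + y)⁻¹ ≤ 1 - y + y ^ 2 := by
    rw [inv_le_iff_one_le_mul₀ (by positivity)]
    nlinarith [mul_nonneg hy (sq_nonneg y)]
  rw [abs_of_nonneg (by linarith)]
  linarith

/-- The pair `(α, γ)` obtained after `k` implicit Euler steps of size `ε` for `α' = -l γ`, `γ' = α`
with initial value `(1, 0)`, written in the variable `r = (1 + l)⁻¹`. -/
def waveEuler (ε : ℝ) : ℕ → ℝ → ℝ × ℝ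
  | 0, _ => (1, 0)
  | k + 1, r =>
    let α := (r * (waveEuler ε k r).1 - ε * (1 - r) * (waveEuler ε k r).2) /
      (r + ε ^ 2 * (1 - r))
    (α, (waveEuler ε k r).2 + ε * α)

lemma euler_denom_pos {δ r : ℝ} (hδ : 0 < δ) (hr : r ∈ Set.Icc (0 : ℝ) 1) :
    0 < r + δ * (1 - r) := by
  rcases hr.1.eq_or_lt with rfl | h
  · simpa using hδ
  · have : 0 ≤ δ * (1 - r) := mul_nonneg hδ.le (by linarith [hr.2])
    linarith

lemma continuousOn_waveEuler {ε : ℝ} (hε : 0 < ε) (k : ℕ) :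
    ContinuousOn (fun r => waveEuler ε k r) (Set.Icc 0 1) := by
  induction k with
  | zero => exact continuousOn_const
  | succ k ih =>
    have h1 := continuous_fst.comp_continuousOn ih
    have h2 := continuous_snd.comp_continuousOn ih
    have hα : ContinuousOn (fun r => (r * (waveEuler ε k r).1 - ε * (1 - r) * (waveEuler ε k r).2) /
      (r + ε ^ 2 * (1 - r))) (Set.Icc 0 1) := by
      refine ContinuousOn.div ?_ (by fun_prop) fun r hr =>
        (euler_denom_pos (by positivity) hr).ne'
      exact (continuousOn_id.mul h1).sub ((by fun_prop : ContinuousOn (fun r : ℝ => ε * (1 - r))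
        (Set.Icc 0 1)).mul h2)
    exact hα.prodMk (h2.add (continuousOn_const.mul hα))

lemma waveEuler_snd_succ (ε : ℝ) (k : ℕ) (r : ℝ) : (waveEuler ε (k + 1) r).2 =
    (waveEuler ε k r).2 + ε * (waveEuler ε (k + 1) r).1 := rfl

/-- The other equation of the implicit Euler step, `α_{k+1} = α_k - ε l γ_{k+1}`. -/
lemma waveEuler_fst_succ {ε : ℝ} (hε : 0 < ε) (k : ℕ) {r : ℝ} (hr : r ∈ Set.Icc (0 : ℝ) 1) :
    r * ((waveEuler ε (k + 1) r).2 +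
      ε⁻¹ * ((waveEuler ε k r).1 - (waveEuler ε (k + 1) r).1)) = (waveEuler ε (k + 1) r).2 := by
  have hd := euler_denom_pos (δ := ε ^ 2) (by positivity) hr
  have h1 : (waveEuler ε (k + 1) r).1 * (r + ε ^ 2 * (1 - r)) =
      r * (waveEuler ε k r).1 - ε * (1 - r) * (waveEuler ε k r).2 := div_mul_cancel₀ _ hd.ne'
  rw [waveEuler_snd_succ]
  have : ε * ε⁻¹ = 1 := mul_inv_cancel₀ hε.ne'
  apply mul_left_cancel₀ hε.ne'
  linear_combination (-1 : ℝ) * h1 +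
    r * ((waveEuler ε k r).1 - (waveEuler ε (k + 1) r).1) * this

/-- In terms of `z = α + i √l γ` an implicit Euler step is division by `1 - i ε √l`. -/
lemma waveEuler_eq_pow {ε : ℝ} (hε : 0 < ε) (k : ℕ) {r : ℝ} (hr : r ∈ Set.Ioc (0 : ℝ) 1) :
    (((waveEuler ε k r).1 : ℂ) + √(r⁻¹ - 1) * (waveEuler ε k r).2 * Complex.I) =
      (((1 : ℂ) - (ε * √(r⁻¹ - 1) : ℝ) * Complex.I)⁻¹) ^ k := by
  have hs : √(r⁻¹ - 1) ^ 2 = r⁻¹ - 1 :=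
    Real.sq_sqrt (sub_nonneg.2 ((one_le_inv₀ hr.1).2 hr.2))
  set s := √(r⁻¹ - 1)
  have hne : (1 : ℂ) - (ε * s : ℝ) * Complex.I ≠ 0 := fun h => by
    have := one_le_norm_one_sub_mul_I (ε * s)
    rw [h, norm_zero] at this
    linarith
  induction k with
  | zero => simp [waveEuler]
  | succ k ih =>
    rw [pow_succ, ← ih, eq_mul_inv_iff_mul_eq₀ hne]
    have h1 := waveEuler_fst_succ hε k (Set.Ioc_subset_Icc_self hr)
    have h2 := waveEuler_snd_succ ε k r
    set α := (waveEuler ε k r).1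
    set γ := (waveEuler ε k r).2
    set α' := (waveEuler ε (k + 1) r).1
    set γ' := (waveEuler ε (k + 1) r).2
    have h3 : α' + ε * s ^ 2 * γ' = α := by
      rw [hs]
      have hr0 := hr.1.ne'
      field_simp
      field_simp at h1
      linear_combination -h1
    apply Complex.ext
    · simp
      linear_combination h3
    · simp
      linear_combination s * h2

lemma abs_waveEuler_fst_le {ε : ℝ} (hε : 0 < ε) (k : ℕ) {r : ℝ} (hr : r ∈ Set.Icc (0 : ℝ) 1) :
    |(waveEuler ε k r).1| ≤ 1 := by
  rcases hr.1.eq_or_lt with rfl | h0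
  -- `r = 0` corresponds to `l = ∞`, where `√(r⁻¹ - 1)` is meaningless
  · have : |(waveEuler ε k 0).1| ≤ 1 ∧ (waveEuler ε k 0).2 = 0 := by
      induction k with
      | zero => simp [waveEuler]
      | succ k ih => simp [waveEuler, ih.2]
    exact this.1
  · have h1 := waveEuler_eq_pow hε k ⟨h0, hr.2⟩
    have h2 : (waveEuler ε k r).1 =
        (((waveEuler ε k r).1 : ℂ) + √(r⁻¹ - 1) * (waveEuler ε k r).2 * Complex.I).re := by simp
    rw [h2, h1]
    refine (Complex.abs_re_le_norm _).trans ?_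
    rw [norm_pow, norm_inv]
    exact pow_le_one₀ (by positivity) (inv_le_one_of_one_le₀ (one_le_norm_one_sub_mul_I _))

/-- The global error of the Euler scheme is of order `t² l / n`; the factor `r = (1 + l)⁻¹` makes the
bound uniform in `l`. -/
lemma waveEuler_sub_cos_le {t : ℝ} (ht : 0 < t) (n : ℕ) {r : ℝ} (hr : r ∈ Set.Ioc (0 : ℝ) 1) :
    r * |(waveEuler (t / (n + 1 : ℕ)) (n + 1) r).1 - Real.cos (t * √(r⁻¹ - 1))| ≤
      3 * t ^ 2 / (n + 1 : ℕ) := by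
  have hs : √(r⁻¹ - 1) ^ 2 = r⁻¹ - 1 :=
    Real.sq_sqrt (sub_nonneg.2 ((one_le_inv₀ hr.1).2 hr.2))
  have hN : (0 : ℝ) < (n + 1 : ℕ) := by positivity
  generalize hNk : n + 1 = k at *
  have hε : 0 < t / k := by positivity
  have h1 := waveEuler_eq_pow hε k hr
  set s := √(r⁻¹ - 1)
  set y : ℝ := t / k * s with hy
  have h2 : Real.cos (t * s) = (Complex.exp (y * Complex.I) ^ k).re := by
    rw [← Complex.exp_nat_mul]
    have : (k : ℂ) * (y * Complex.I) = ((t * s : ℝ) : ℂ) * Complex.I := by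
      have : (k : ℝ) * y = t * s := by rw [hy]; field_simp
      rw [← this]
      push_cast
      ring
    rw [this, Complex.exp_ofReal_mul_I_re]
  have h3 : |(waveEuler (t / k) k r).1 - Real.cos (t * s)| ≤ k * (3 * y ^ 2) := by
    have h4 : (waveEuler (t / k) k r).1 =
        (((waveEuler (t / k) k r).1 : ℂ) + s * (waveEuler (t / k) k r).2 * Complex.I).re := by
      simp
    rw [h2, h4, h1, ← Complex.sub_re]
    refine (Complex.abs_re_le_norm _).trans ((norm_pow_sub_pow_le ?_ ?_ _).trans ?_)
    · rw [norm_inv]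
      exact inv_le_one_of_one_le₀ (one_le_norm_one_sub_mul_I _)
    · rw [Complex.norm_exp_ofReal_mul_I]
    · gcongr
      exact norm_inv_one_sub_mul_I_sub_exp_le y
  refine (mul_le_mul_of_nonneg_left h3 hr.1.le).trans ?_
  have h5 : r * (k * (3 * y ^ 2)) = 3 * t ^ 2 / k * (r * s ^ 2) := by
    rw [hy]
    field_simp
  rw [h5]
  refine mul_le_of_le_one_right (by positivity) ?_
  rw [hs, mul_sub, mul_inv_cancel₀ hr.1.ne']
  linarith [hr.1]

/-- The result of `n` implicit Euler steps of size `ε` for `α' = -l α` with `α(0) = 1`, written in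
the variable `r = (1 + l)⁻¹`. -/
def heatEuler (ε : ℝ) (n : ℕ) (r : ℝ) : ℝ := (r / (r + ε * (1 - r))) ^ n

lemma continuousOn_heatEuler {ε : ℝ} (hε : 0 < ε) (n : ℕ) :
    ContinuousOn (heatEuler ε n) (Set.Icc 0 1) :=
  (continuousOn_id.div (by fun_prop) fun _ hr => (euler_denom_pos hε hr).ne').pow n

lemma heatEuler_succ {ε : ℝ} (hε : 0 < ε) (n : ℕ) {r : ℝ} (hr : r ∈ Set.Icc (0 : ℝ) 1) :
    r * (heatEuler ε (n + 1) r + ε⁻¹ * (heatEuler ε n r - heatEuler ε (n + 1) r)) =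
      heatEuler ε (n + 1) r := by
  have hd := (euler_denom_pos hε hr).ne'
  rw [heatEuler, heatEuler, pow_succ]
  set A := (r / (r + ε * (1 - r))) ^ n
  field_simp
  ring

lemma abs_heatEuler_le {ε : ℝ} (hε : 0 < ε) (n : ℕ) {r : ℝ} (hr : r ∈ Set.Icc (0 : ℝ) 1) :
    |heatEuler ε n r| ≤ 1 := by
  have hd := euler_denom_pos hε hr
  rw [heatEuler, abs_pow, abs_of_nonneg (div_nonneg hr.1 hd.le)]
  refine pow_le_one₀ (div_nonneg hr.1 hd.le) ?_
  rw [div_le_one hd]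
  have : 0 ≤ ε * (1 - r) := mul_nonneg hε.le (by linarith [hr.2])
  linarith

/-- The global error of the Euler scheme is of order `t² l² / n`, which the factor `r ^ 2` makes
uniform in `l`. -/
lemma heatEuler_sub_exp_le {t : ℝ} (ht : 0 < t) (n : ℕ) {r : ℝ} (hr : r ∈ Set.Ioc (0 : ℝ) 1) :
    r ^ 2 * |heatEuler (t / (n + 1 : ℕ)) (n + 1) r - Real.exp (-t * (r⁻¹ - 1))| ≤
      t ^ 2 / (n + 1 : ℕ) := by
  have hl : 0 ≤ r⁻¹ - 1 := sub_nonneg.2 ((one_le_inv₀ hr.1).2 hr.2)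
  have hN : (0 : ℝ) < (n + 1 : ℕ) := by positivity
  generalize hNk : n + 1 = k at *
  set y : ℝ := t / k * (r⁻¹ - 1) with hy
  have hy0 : 0 ≤ y := by positivity
  have h1 : heatEuler (t / k) k r = ((1 + y)⁻¹) ^ k := by
    rw [heatEuler]
    congr 1
    have hr0 := hr.1.ne'
    have h3 := (euler_denom_pos (δ := t / k) (by positivity) (Set.Ioc_subset_Icc_self hr)).ne'
    rw [div_eq_iff h3, eq_comm, inv_mul_eq_iff_eq_mul₀ (by positivity), hy]
    field_simp
  have h2 : Real.exp (-t * (r⁻¹ - 1)) = Real.exp (-y) ^ k := by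
    rw [← Real.exp_nat_mul]
    congr 1
    rw [hy]
    field_simp
  have h3 : |heatEuler (t / k) k r - Real.exp (-t * (r⁻¹ - 1))| ≤ k * y ^ 2 := by
    rw [h1, h2]
    have h4 := norm_pow_sub_pow_le (a := (((1 + y)⁻¹ : ℝ) : ℂ)) (b := ((Real.exp (-y) : ℝ) : ℂ))
      (by
        rw [Complex.norm_real, Real.norm_of_nonneg (by positivity)]
        exact inv_le_one_of_one_le₀ (by linarith))
      (by
        rw [Complex.norm_real, Real.norm_of_nonneg (by positivity)]
        exact Real.exp_le_one_iff.2 (by linarith)) k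
    rw [← Complex.ofReal_pow, ← Complex.ofReal_pow, ← Complex.ofReal_sub, ← Complex.ofReal_sub,
      Complex.norm_real, Complex.norm_real] at h4
    refine h4.trans ?_
    gcongr
    exact abs_inv_one_add_sub_exp_le hy0
  refine (mul_le_mul_of_nonneg_left h3 (sq_nonneg r)).trans ?_
  have h5 : r ^ 2 * (k * y ^ 2) = t ^ 2 / k * (1 - r) ^ 2 := by
    have hr0 := hr.1.ne'
    rw [hy]
    field_simp
  rw [h5]
  refine mul_le_of_le_one_right (by positivity) ?_
  nlinarith [hr.1, hr.2]

section Weights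

variable {E F : Type*} [NormedAddCommGroup E] [InnerProductSpace ℂ E]
  [NormedAddCommGroup F] [InnerProductSpace ℂ F]

/-! ### Weighted energy estimates -/

/-- An abstract form of the multiplication by `exp (ρ ψ)`, where `ψ` is a Lipschitz function with
`|S ∇ψ| ≤ 1`. Here `m` and `n` are the multiplication operators on `E` and `F`, `B` is the
multiplication by the vector field `S ∇ψ`, and the last clause is the product rule
`T (m² u) = n² T u + 2 ρ n B m u` on a linear relation `K`. -/
structure IsWeight (K : Submodule ℂ (E × F)) (ρ : ℝ) (m : E →L[ℂ] E) (n : F →L[ℂ] F)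
    (B : E →L[ℂ] F) : Prop where
  inner_left : ∀ u v, inner ℂ (m u) v = inner ℂ u (m v)
  inner_right : ∀ w z, inner ℂ (n w) z = inner ℂ w (n z)
  comm : ∀ u, n (B u) = B (m u)
  norm_le : ∀ u, ‖B u‖ ≤ ‖u‖
  mem : ∀ u w, (u, w) ∈ K → (m (m u), n (n w) + ((2 * ρ : ℝ) : ℂ) • n (B (m u))) ∈ K

variable {K : Submodule ℂ (E × F)} {ρ : ℝ} {m : E →L[ℂ] E} {n : F →L[ℂ] F} {B : E →L[ℂ] F}

/-- The product rule extends to the closure of the relation. -/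
lemma IsWeight.topologicalClosure (h : IsWeight K ρ m n B) :
    IsWeight K.topologicalClosure ρ m n B := by
  refine ⟨h.inner_left, h.inner_right, h.comm, h.norm_le, fun u w huw => ?_⟩
  have hc : Continuous fun p : E × F =>
      (m (m p.1), n (n p.2) + ((2 * ρ : ℝ) : ℂ) • n (B (m p.1))) := by fun_prop
  exact map_mem_closure hc huw (f := fun p : E × F =>
    (m (m p.1), n (n p.2) + ((2 * ρ : ℝ) : ℂ) • n (B (m p.1)))) (fun p hp => h.mem p.1 p.2 hp)

/-- The identity `(m a, m H c) = (n T a, n T c) + 2 ρ (B m a, n T c)`: pair `H c` with `m² a`. The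
product rule yields an element of `K` over `m² a` which need not lie in the operator part `T`, but
it is paired with `T c` only. -/
lemma IsWeight.inner_operator (h : IsWeight K ρ m n B) [CompleteSpace F]
    (hK : IsClosed (K : Set (E × F))) {a c f : E} {w z : F} (ha : (a, w) ∈ operatorPart K)
    (hc : (c, z) ∈ operatorPart K) (hf : (c, f) ∈ (relForm K).operatorGraph) :
    inner ℂ (m a) (m f) = inner ℂ (n w) (n z) + ((2 * ρ : ℝ) : ℂ) * inner ℂ (B (m a)) (n z) := by
  have h1 := h.mem _ _ (operatorPart_le ha)
  obtain ⟨w₀, h₀, -⟩ := exists_operatorPart hK h1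
  obtain ⟨z', hz', h2⟩ := mem_relForm_operatorGraph.1 hf
  obtain rfl := operatorPart_unique hc hz'
  rw [← h.inner_left, ← h2 _ _ h₀, inner_operatorPart_eq h1 h₀ hc, inner_add_left,
    inner_smul_left, Complex.conj_ofReal, h.inner_right, h.inner_right (B (m a)) z]

/-- One implicit Euler step for the heat equation. -/
lemma IsWeight.heat_step (h : IsWeight K ρ m n B) [CompleteSpace F]
    (hK : IsClosed (K : Set (E × F))) {ε : ℝ} (hε : 0 < ε) {a a' : E}
    (ha : (a', ((ε⁻¹ : ℝ) : ℂ) • (a - a')) ∈ (relForm K).operatorGraph) :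
    (1 - ε * ρ ^ 2) * ‖m a'‖ ≤ ‖m a‖ := by
  obtain ⟨z, hz, -⟩ := mem_relForm_operatorGraph.1 ha
  have h1 := congrArg Complex.re (h.inner_operator hK hz hz ha)
  rw [map_smul, inner_smul_right, map_sub, inner_sub_right, Complex.add_re, Complex.re_ofReal_mul,
    Complex.re_ofReal_mul, Complex.sub_re, inner_self_eq_norm_sq_to_K,
    inner_self_eq_norm_sq_to_K] at h1
  have h2 : (inner ℂ (m a') (m a)).re ≤ ‖m a'‖ * ‖m a‖ := re_inner_le_norm (𝕜 := ℂ) _ _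
  have h3 : |(inner ℂ (B (m a')) (n z)).re| ≤ ‖m a'‖ * ‖n z‖ :=
    (Complex.abs_re_le_norm _).trans ((norm_inner_le_norm (𝕜 := ℂ) _ _).trans
      (mul_le_mul_of_nonneg_right (h.norm_le _) (norm_nonneg _)))
  have e1 : (((‖m a'‖ : ℝ) : ℂ) ^ 2).re = ‖m a'‖ ^ 2 := by norm_cast
  have e2 : (((‖n z‖ : ℝ) : ℂ) ^ 2).re = ‖n z‖ ^ 2 := by norm_cast
  rw [show ((RCLike.ofReal ‖m a'‖ : ℂ) ^ 2).re = ‖m a'‖ ^ 2 from e1,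
    show ((RCLike.ofReal ‖n z‖ : ℂ) ^ 2).re = ‖n z‖ ^ 2 from e2] at h1
  set x := ‖m a'‖
  set y := ‖n z‖
  set b := (inner ℂ (B (m a')) (n z)).re
  have hx : 0 ≤ x := norm_nonneg _
  -- complete the square in `|2 ρ b| ≤ 2 |ρ| x y`
  have h4 : -(ρ ^ 2 * x ^ 2) ≤ y ^ 2 + 2 * ρ * b := by
    have h5 : |ρ * b| ≤ |ρ| * (x * y) := by
      rw [abs_mul]
      exact mul_le_mul_of_nonneg_left h3 (abs_nonneg _)
    nlinarith [sq_nonneg (y - |ρ| * x), sq_abs ρ, neg_abs_le (ρ * b)]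
  have h5 : (inner ℂ (m a') (m a)).re - x ^ 2 = ε * (y ^ 2 + 2 * ρ * b) := by
    rw [← h1]
    field_simp
  have h6 : (1 - ε * ρ ^ 2) * x * x ≤ ‖m a‖ * x := by
    nlinarith [mul_le_mul_of_nonneg_left h4 hε.le]
  rcases hx.eq_or_lt with h0 | h0
  · rw [← h0, mul_zero]
    exact norm_nonneg _
  · exact le_of_mul_le_mul_right h6 h0

/-- One implicit Euler step for the wave equation, written as the first order system
`c' = a`, `a' = -H c`. The energy is `‖m a‖² + ‖n T c‖²`. -/
lemma IsWeight.wave_step (h : IsWeight K ρ m n B) [CompleteSpace F]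
    (hK : IsClosed (K : Set (E × F))) {ε : ℝ} (hε : 0 < ε) {a a' c c' : E} {z z' : F}
    (hcc : c' = c + (ε : ℂ) • a')
    (ha : (c', ((ε⁻¹ : ℝ) : ℂ) • (a - a')) ∈ (relForm K).operatorGraph)
    (hz : (c, z) ∈ operatorPart K) (hz' : (c', z') ∈ operatorPart K) :
    (1 - ε * |ρ|) * √(‖m a'‖ ^ 2 + ‖n z'‖ ^ 2) ≤ √(‖m a‖ ^ 2 + ‖n z‖ ^ 2) := by
  have hw : (a', ((ε⁻¹ : ℝ) : ℂ) • (z' - z)) ∈ operatorPart K := by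
    have h1 := (operatorPart K).smul_mem ((ε⁻¹ : ℝ) : ℂ) ((operatorPart K).sub_mem hz' hz)
    have h2 : a' = ((ε⁻¹ : ℝ) : ℂ) • (c' - c) := by
      rw [hcc, add_sub_cancel_left, smul_smul, ← Complex.ofReal_mul, inv_mul_cancel₀ hε.ne']
      simp
    rw [h2]
    exact h1
  have h1 := congrArg Complex.re (h.inner_operator hK hw hz' ha)
  rw [map_smul, inner_smul_right, map_sub, inner_sub_right, Complex.add_re, Complex.re_ofReal_mul,
    Complex.re_ofReal_mul, Complex.sub_re, inner_self_eq_norm_sq_to_K, map_smul, inner_smul_left,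
    Complex.conj_ofReal, Complex.re_ofReal_mul, map_sub, inner_sub_left, Complex.sub_re,
    inner_self_eq_norm_sq_to_K] at h1
  have h2 : (inner ℂ (m a') (m a)).re ≤ ‖m a'‖ * ‖m a‖ := re_inner_le_norm (𝕜 := ℂ) _ _
  have h2' : (inner ℂ (n z) (n z')).re ≤ ‖n z‖ * ‖n z'‖ := re_inner_le_norm (𝕜 := ℂ) _ _
  have h3 : |(inner ℂ (B (m a')) (n z')).re| ≤ ‖m a'‖ * ‖n z'‖ :=
    (Complex.abs_re_le_norm _).trans ((norm_inner_le_norm (𝕜 := ℂ) _ _).trans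
      (mul_le_mul_of_nonneg_right (h.norm_le _) (norm_nonneg _)))
  have e1 : (((‖m a'‖ : ℝ) : ℂ) ^ 2).re = ‖m a'‖ ^ 2 := by norm_cast
  have e2 : (((‖n z'‖ : ℝ) : ℂ) ^ 2).re = ‖n z'‖ ^ 2 := by norm_cast
  rw [show ((RCLike.ofReal ‖m a'‖ : ℂ) ^ 2).re = ‖m a'‖ ^ 2 from e1,
    show ((RCLike.ofReal ‖n z'‖ : ℂ) ^ 2).re = ‖n z'‖ ^ 2 from e2] at h1
  set x := ‖m a‖
  set y := ‖n z‖
  set x' := ‖m a'‖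
  set y' := ‖n z'‖
  set b := (inner ℂ (B (m a')) (n z')).re
  set p := (inner ℂ (m a') (m a)).re
  set q := (inner ℂ (n z) (n z')).re
  have hx : 0 ≤ x := norm_nonneg _
  have hy : 0 ≤ y := norm_nonneg _
  have hx' : 0 ≤ x' := norm_nonneg _
  have hy' : 0 ≤ y' := norm_nonneg _
  have h4 : x' ^ 2 + y' ^ 2 = p + q - 2 * ρ * ε * b := by
    have := congrArg (ε * ·) h1
    simp only [mul_add, mul_inv_cancel_left₀ hε.ne'] at this
    linarith
  set N := √(x ^ 2 + y ^ 2)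
  set N' := √(x' ^ 2 + y' ^ 2)
  have hN : N ^ 2 = x ^ 2 + y ^ 2 := Real.sq_sqrt (by positivity)
  have hN' : N' ^ 2 = x' ^ 2 + y' ^ 2 := Real.sq_sqrt (by positivity)
  have hN0 : 0 ≤ N := Real.sqrt_nonneg _
  have hN0' : 0 ≤ N' := Real.sqrt_nonneg _
  have h5 : x' * x + y * y' ≤ N' * N := by
    refine le_of_sq_le_sq ?_ (by positivity)
    rw [mul_pow, hN, hN']
    nlinarith [sq_nonneg (x * y' - y * x')]
  have h6 : -(2 * ρ * ε * b) ≤ ε * |ρ| * N' ^ 2 := by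
    have h7 : |ρ * b| ≤ |ρ| * (x' * y') := by
      rw [abs_mul]
      exact mul_le_mul_of_nonneg_left h3 (abs_nonneg _)
    have h8 : 2 * (x' * y') ≤ N' ^ 2 := by
      rw [hN']
      nlinarith [sq_nonneg (x' - y')]
    have h9 : -(2 * (ρ * b)) ≤ |ρ| * N' ^ 2 := by
      have := mul_le_mul_of_nonneg_left h8 (abs_nonneg ρ)
      linarith [neg_abs_le (ρ * b)]
    have := mul_le_mul_of_nonneg_left h9 hε.le
    linarith
  have h7 : (1 - ε * |ρ|) * N' * N' ≤ N * N' := by nlinarith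
  rcases hN0'.eq_or_lt with h0 | h0
  · rw [← h0, mul_zero]
    exact hN0
  · exact le_of_mul_le_mul_right h7 h0

lemma tendsto_inv_one_sub_div_pow (x : ℝ) :
    Tendsto (fun k : ℕ => ((1 - x / (k + 1 : ℕ)) ^ (k + 1))⁻¹) atTop (𝓝 (Real.exp x)) := by
  have h1 : Tendsto (fun k : ℕ => (1 + (-x) / k) ^ k) atTop (𝓝 (Real.exp (-x))) :=
    Real.tendsto_one_add_div_pow_exp (-x)
  have h2 := ((h1.comp (tendsto_add_atTop_nat 1)).inv₀ (Real.exp_pos _).ne')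
  rw [Real.exp_neg, inv_inv] at h2
  refine h2.congr fun k => ?_
  simp only [Function.comp, neg_div, ← sub_eq_add_neg]

/-- If each of `k + 1` steps gains at most a factor `(1 - x / (k + 1))⁻¹`, then the limit as
`k → ∞` gains at most the factor `exp x`. -/
lemma norm_le_exp_mul_of_steps {x y : ℝ} {N : ℕ → ℕ → ℝ} (hN0 : ∀ k, N k 0 ≤ y)
    (hN : ∀ k j, (1 - x / (k + 1 : ℕ)) * N k (j + 1) ≤ N k j) {L : ℝ} {u : ℕ → ℝ}
    (hu : Tendsto u atTop (𝓝 L)) (huN : ∀ k, u k ≤ N k (k + 1)) : L ≤ Real.exp x * y := by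
  refine le_of_tendsto_of_tendsto hu ((tendsto_inv_one_sub_div_pow x).mul_const y) ?_
  obtain ⟨k₀, hk₀⟩ := exists_nat_gt x
  filter_upwards [eventually_ge_atTop k₀] with k hk
  have hpos : 0 < 1 - x / (k + 1 : ℕ) := by
    rw [sub_pos, div_lt_one (by positivity)]
    have : (k₀ : ℝ) ≤ k := by exact_mod_cast hk
    push_cast
    linarith
  have hj : ∀ j, (1 - x / (k + 1 : ℕ)) ^ j * N k j ≤ y := by
    intro j
    induction j with
    | zero => simpa using hN0 k
    | succ j ih =>
      refine le_trans ?_ ih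
      rw [pow_succ, mul_assoc]
      exact mul_le_mul_of_nonneg_left (hN k j) (by positivity)
  refine (huN k).trans ?_
  rw [inv_mul_eq_div, le_div_iff₀ (by positivity), mul_comm]
  exact hj (k + 1)

variable [CompleteSpace E] [CompleteSpace F]

lemma cfc_const_mul_sub_apply {R : E →L[ℂ] E} {φ η : ℝ → ℝ} {c : ℝ}
    (hφ : ContinuousOn φ (spectrum ℝ R)) (hη : ContinuousOn η (spectrum ℝ R)) (x : E) :
    cfc (fun r => c * (φ r - η r)) R x = (c : ℂ) • (cfc φ R x - cfc η R x) := by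
  rw [cfc_const_mul c (fun r => φ r - η r) R (hφ.sub hη), cfc_sub φ η R hφ hη]
  rfl

lemma cfc_add_const_mul_apply {R : E →L[ℂ] E} {φ η : ℝ → ℝ} {c : ℝ}
    (hφ : ContinuousOn φ (spectrum ℝ R)) (hη : ContinuousOn η (spectrum ℝ R)) (x : E) :
    cfc (fun r => φ r + c * η r) R x = cfc φ R x + (c : ℂ) • cfc η R x := by
  rw [cfc_add (a := R) φ (fun r => c * η r) hφ (continuousOn_const.mul hη),
    cfc_const_mul c η R hη]
  rfl

/-- The weighted estimate `‖exp (ρ ψ) S_t φ‖ ≤ exp (ρ² t) ‖exp (ρ ψ) φ‖` for the semigroup. -/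
theorem IsWeight.norm_heat_le (h : IsWeight K ρ m n B) (hK : IsClosed (K : Set (E × F)))
    {R T : E →L[ℂ] E} (hR : ∀ f u : E, R f = u ↔ (u, f - u) ∈ (relForm K).operatorGraph)
    (hpos : R.IsPositive) (hle : ‖R‖ ≤ 1) (hd : DenseRange R) {t : ℝ} (ht : 0 < t)
    (hT : T * R = cfc (fun r : ℝ => r * Real.exp (-t * (r⁻¹ - 1))) R) (x : E) :
    ‖m (T x)‖ ≤ Real.exp (ρ ^ 2 * t) * ‖m x‖ := by
  have hsa : IsSelfAdjoint R := hpos.isSelfAdjoint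
  have hε : ∀ k : ℕ, 0 < t / (k + 1 : ℕ) := fun k => by positivity
  have hconv := tendsto_cfc_apply hpos hle hd (f := fun l => Real.exp (-t * l)) (M := 1)
    (by fun_prop) (fun l hl => by
      rw [abs_of_pos (Real.exp_pos _)]
      exact Real.exp_le_one_iff.2 (by nlinarith)) hT
    (p := fun k => heatEuler (t / (k + 1 : ℕ)) (k + 1))
    (fun k => continuousOn_heatEuler (hε k) _) (fun k r hr => abs_heatEuler_le (hε k) _ hr)
    (δ := fun k => t ^ 2 / (k + 1 : ℕ))
    ((tendsto_const_div_atTop_nhds_zero_nat (t ^ 2)).comp (tendsto_add_atTop_nat 1))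
    (fun k r hr => heatEuler_sub_exp_le ht k hr) x
  refine norm_le_exp_mul_of_steps
    (N := fun k j => ‖m (cfc (heatEuler (t / (k + 1 : ℕ)) j) R x)‖) (fun k => ?_) (fun k j => ?_)
    (((m.continuous.tendsto _).comp hconv).norm) (fun k => le_rfl)
  · have : cfc (heatEuler (t / (k + 1 : ℕ)) 0) R = 1 := by
      have : heatEuler (t / (k + 1 : ℕ)) 0 = fun _ => 1 := by
        ext r
        simp [heatEuler]
      rw [this]
      exact cfc_const_one ℝ R
    rw [this]
    exact le_rfl
  · have hspec := spectrum_subset_Icc hpos hle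
    have h0 := continuousOn_heatEuler (hε k) j
    have h1 := continuousOn_heatEuler (hε k) (j + 1)
    have key := cfc_mem_graph hR hpos hle h1 (η := fun r => (t / (k + 1 : ℕ))⁻¹ *
      (heatEuler (t / (k + 1 : ℕ)) j r - heatEuler (t / (k + 1 : ℕ)) (j + 1) r))
      (continuousOn_const.mul (h0.sub h1)) (fun r hr => heatEuler_succ (hε k) j hr) x
    rw [cfc_const_mul_sub_apply (h0.mono hspec) (h1.mono hspec)] at key
    have := h.heat_step hK (hε k) (a := cfc (heatEuler (t / (k + 1 : ℕ)) j) R x) key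
    rwa [show ρ ^ 2 * t / (k + 1 : ℕ) = t / (k + 1 : ℕ) * ρ ^ 2 by ring]

/-- The weighted estimate `‖exp (ρ ψ) cos (t H^{1/2}) φ‖ ≤ exp (|ρ| t) ‖exp (ρ ψ) φ‖` for the
wave equation. -/
theorem IsWeight.norm_wave_le (h : IsWeight K ρ m n B) (hK : IsClosed (K : Set (E × F)))
    {R T : E →L[ℂ] E} (hR : ∀ f u : E, R f = u ↔ (u, f - u) ∈ (relForm K).operatorGraph)
    (hpos : R.IsPositive) (hle : ‖R‖ ≤ 1) (hd : DenseRange R) {t : ℝ} (ht : 0 < t)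
    (hT : T * R = cfc (fun r : ℝ => r * Real.cos (t * √(r⁻¹ - 1))) R) (x : E) :
    ‖m (T x)‖ ≤ Real.exp (|ρ| * t) * ‖m x‖ := by
  have hsa : IsSelfAdjoint R := hpos.isSelfAdjoint
  have hε : ∀ k : ℕ, 0 < t / (k + 1 : ℕ) := fun k => by positivity
  have hα : ∀ k j : ℕ, ContinuousOn (fun r => (waveEuler (t / (k + 1 : ℕ)) j r).1)
    (Set.Icc 0 1) := fun k j => continuous_fst.comp_continuousOn (continuousOn_waveEuler (hε k) j)
  have hγ : ∀ k j : ℕ, ContinuousOn (fun r => (waveEuler (t / (k + 1 : ℕ)) j r).2)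
    (Set.Icc 0 1) := fun k j => continuous_snd.comp_continuousOn (continuousOn_waveEuler (hε k) j)
  have hspec := spectrum_subset_Icc hpos hle
  have hconv := tendsto_cfc_apply hpos hle hd (f := fun l => Real.cos (t * √l)) (M := 1)
    (by fun_prop) (fun l hl => Real.abs_cos_le_one _) hT
    (p := fun k r => (waveEuler (t / (k + 1 : ℕ)) (k + 1) r).1)
    (fun k => hα k _) (fun k r hr => abs_waveEuler_fst_le (hε k) _ hr)
    (δ := fun k => 3 * t ^ 2 / (k + 1 : ℕ))
    ((tendsto_const_div_atTop_nhds_zero_nat (3 * t ^ 2)).comp (tendsto_add_atTop_nat 1))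
    (fun k r hr => by
      refine le_trans ?_ (waveEuler_sub_cos_le ht k hr)
      rw [pow_two, mul_assoc]
      exact mul_le_of_le_one_left (mul_nonneg hr.1.le (abs_nonneg _)) hr.2) x
  have hgraph : ∀ k j : ℕ, (cfc (fun r => (waveEuler (t / (k + 1 : ℕ)) (j + 1) r).2) R x,
      (((t / (k + 1 : ℕ))⁻¹ : ℝ) : ℂ) • (cfc (fun r => (waveEuler (t / (k + 1 : ℕ)) j r).1) R x -
        cfc (fun r => (waveEuler (t / (k + 1 : ℕ)) (j + 1) r).1) R x)) ∈
      (relForm K).operatorGraph := by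
    intro k j
    have key := cfc_mem_graph hR hpos hle (hγ k (j + 1)) (η := fun r => (t / (k + 1 : ℕ))⁻¹ *
      ((waveEuler (t / (k + 1 : ℕ)) j r).1 - (waveEuler (t / (k + 1 : ℕ)) (j + 1) r).1))
      (continuousOn_const.mul ((hα k j).sub (hα k (j + 1))))
      (fun r hr => waveEuler_fst_succ (hε k) j hr) x
    rwa [cfc_const_mul_sub_apply ((hα k j).mono hspec) ((hα k (j + 1)).mono hspec)] at key
  have hdom : ∀ k j : ℕ, ∃ z, (cfc (fun r => (waveEuler (t / (k + 1 : ℕ)) j r).2) R x, z) ∈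
      operatorPart K := by
    intro k j
    cases j with
    | zero =>
      refine ⟨0, ?_⟩
      have : cfc (fun r => (waveEuler (t / (k + 1 : ℕ)) 0 r).2) R = 0 := cfc_const_zero ℝ R
      rw [this]
      exact (operatorPart K).zero_mem
    | succ j =>
      obtain ⟨z, hz, -⟩ := mem_relForm_operatorGraph.1 (hgraph k j)
      exact ⟨z, hz⟩
  choose z hz using hdom
  refine norm_le_exp_mul_of_steps
    (N := fun k j => √(‖m (cfc (fun r => (waveEuler (t / (k + 1 : ℕ)) j r).1) R x)‖ ^ 2 +
      ‖n (z k j)‖ ^ 2)) (fun k => ?_) (fun k j => ?_)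
    (((m.continuous.tendsto _).comp hconv).norm) (fun k => ?_)
  · have h1 : cfc (fun r => (waveEuler (t / (k + 1 : ℕ)) 0 r).1) R = 1 := cfc_const_one ℝ R
    have h2 : z k 0 = 0 := by
      refine operatorPart_singleValued _ (hz k 0) ?_
      have : cfc (fun r => (waveEuler (t / (k + 1 : ℕ)) 0 r).2) R = 0 := cfc_const_zero ℝ R
      exact DFunLike.congr_fun this x
    rw [h1, h2]
    simp
  · have hcc : cfc (fun r => (waveEuler (t / (k + 1 : ℕ)) (j + 1) r).2) R x =
        cfc (fun r => (waveEuler (t / (k + 1 : ℕ)) j r).2) R x + ((t / (k + 1 : ℕ) : ℝ) : ℂ) •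
        cfc (fun r => (waveEuler (t / (k + 1 : ℕ)) (j + 1) r).1) R x := by
      simp_rw [waveEuler_snd_succ]
      exact cfc_add_const_mul_apply ((hγ k j).mono hspec) ((hα k (j + 1)).mono hspec) x
    have := h.wave_step hK (hε k) hcc (hgraph k j) (hz k j) (hz k (j + 1))
    rwa [show |ρ| * t / (k + 1 : ℕ) = t / (k + 1 : ℕ) * |ρ| by ring]
  · exact Real.le_sqrt_of_sq_le (le_add_of_nonneg_right (sq_nonneg _))

theorem IsWeight.norm_wave_le_abs (h : IsWeight K ρ m n B) (hK : IsClosed (K : Set (E × F)))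
    {R T : E →L[ℂ] E} (hR : ∀ f u : E, R f = u ↔ (u, f - u) ∈ (relForm K).operatorGraph)
    (hpos : R.IsPositive) (hle : ‖R‖ ≤ 1) (hd : DenseRange R) {t : ℝ} (ht : t ≠ 0)
    (hT : T * R = cfc (fun r : ℝ => r * Real.cos (t * √(r⁻¹ - 1))) R) (x : E) :
    ‖m (T x)‖ ≤ Real.exp (|ρ| * |t|) * ‖m x‖ := by
  refine h.norm_wave_le hK hR hpos hle hd (abs_pos.2 ht) (hT.trans ?_) x
  refine congrArg (fun f => cfc f R) (funext fun r => ?_)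
  rcases abs_cases t with ⟨h, -⟩ | ⟨h, -⟩
  · rw [h]
  · rw [h, neg_mul, Real.cos_neg]

lemma wave_zero_apply {R T : E →L[ℂ] E} (hpos : R.IsPositive) (hd : DenseRange R)
    (hT : T * R = cfc (fun r : ℝ => r * Real.cos (0 * √(r⁻¹ - 1))) R) (x : E) : T x = x := by
  have hsa : IsSelfAdjoint R := hpos.isSelfAdjoint
  have hR : T * R = R := by
    rw [hT]
    simpa using cfc_id' ℝ R
  exact hd.induction_on (p := fun z => T z = z) x (isClosed_eq (by fun_prop) continuous_id)
    fun y => DFunLike.congr_fun hR y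

/-- The operators `cos (t H^{1/2})` depend continuously on `t` in the strong topology. -/
theorem tendsto_wave {R : E →L[ℂ] E} (hpos : R.IsPositive) (hle : ‖R‖ ≤ 1) (hd : DenseRange R)
    {T : ℝ → E →L[ℂ] E}
    (hT : ∀ t, T t * R = cfc (fun r : ℝ => r * Real.cos (t * √(r⁻¹ - 1))) R) {s : ℕ → ℝ} {t : ℝ}
    (hs : Tendsto s atTop (𝓝 t)) (x : E) : Tendsto (fun k => T (s k) x) atTop (𝓝 (T t x)) := by
  have hspec := spectrum_subset_Icc hpos hle
  have hsa : IsSelfAdjoint R := hpos.isSelfAdjoint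
  have hg : ∀ t : ℝ, ContinuousOn (fun r : ℝ => r * Real.cos (t * √(r⁻¹ - 1))) (Set.Icc 0 1) :=
    fun t => continuousOn_mul_comp_inv_sub_one (f := fun l => Real.cos (t * √l)) (by fun_prop)
      (M := 1) fun l _ => Real.abs_cos_le_one _
  have happly : ∀ t y, T t (R y) = cfc (fun r : ℝ => r * Real.cos (t * √(r⁻¹ - 1))) R y :=
    fun t y => DFunLike.congr_fun (hT t) y
  have hbound : ∀ t, ‖T t‖ ≤ 1 := by
    intro t
    refine ContinuousLinearMap.opNorm_le_bound _ zero_le_one fun z => ?_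
    refine hd.induction_on (p := fun z => ‖T t z‖ ≤ 1 * ‖z‖) z
      (isClosed_le (by fun_prop) (by fun_prop)) fun y => ?_
    rw [happly]
    refine norm_cfc_apply_le hpos hle (hg t) zero_le_one (fun r hr => ?_) y
    rw [abs_mul, abs_of_nonneg hr.1, one_mul]
    exact mul_le_of_le_one_right hr.1 (Real.abs_cos_le_one _)
  refine tendsto_apply_of_denseRange hd (fun k => hbound (s k)) (fun y => ?_) x
  rw [tendsto_iff_norm_sub_tendsto_zero]
  have key : ∀ k, ‖T (s k) (R y) - T t (R y)‖ ≤ |s k - t| * ‖y‖ := by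
    intro k
    have : T (s k) (R y) - T t (R y) = (cfc (fun r : ℝ => r * Real.cos (s k * √(r⁻¹ - 1)) -
        r * Real.cos (t * √(r⁻¹ - 1))) R) y := by
      rw [cfc_sub _ _ R ((hg (s k)).mono hspec) ((hg t).mono hspec), happly, happly]
      rfl
    rw [this]
    refine ContinuousLinearMap.le_of_opNorm_le _ (norm_cfc_le (abs_nonneg _) fun r hr => ?_) y
    have hr := hspec hr
    rw [← mul_sub, norm_mul, Real.norm_of_nonneg hr.1, Real.norm_eq_abs]
    refine (mul_le_mul_of_nonneg_left (Real.abs_cos_sub_cos_le _ _) hr.1).trans ?_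
    rw [← sub_mul, abs_mul, abs_of_nonneg (Real.sqrt_nonneg _), mul_left_comm]
    refine mul_le_of_le_one_right (abs_nonneg _) ?_
    rcases hr.1.eq_or_lt with rfl | h0
    · simp
    · refine le_of_sq_le_sq ?_ zero_le_one
      rw [mul_pow, Real.sq_sqrt (sub_nonneg.2 ((one_le_inv₀ h0).2 hr.2))]
      have : r ^ 2 * (r⁻¹ - 1) = r * (1 - r) := by field_simp
      rw [this]
      nlinarith
  refine squeeze_zero (fun _ => norm_nonneg _) key ?_
  have : Tendsto (fun k => |s k - t| * ‖y‖) atTop (𝓝 (|t - t| * ‖y‖)) :=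
    ((hs.sub_const t).abs).mul_const _
  simpa using this

end Weights

variable {d : ℕ}

/-! ### Weak derivatives and mollification -/

/-- A sequence of bump functions which shrinks to the origin. -/
def shrinkingBump (d n : ℕ) : ContDiffBump (0 : EuclideanSpace ℝ (Fin d)) where
  rIn := 1 / (n + 1 : ℝ) / 2
  rOut := 1 / (n + 1 : ℝ)
  rIn_pos := by positivity
  rIn_lt_rOut := half_lt_self (by positivity)

/-- The mollification of a real function at scale `1 / (n + 1)`. -/
def mollify (n : ℕ) (f : EuclideanSpace ℝ (Fin d) → ℝ) : EuclideanSpace ℝ (Fin d) → ℝ :=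
  convolution ((shrinkingBump d n).normed volume) f (ContinuousLinearMap.lsmul ℝ ℝ) volume

lemma tendsto_rOut_shrinkingBump : Tendsto (fun n => (shrinkingBump d n).rOut) atTop (𝓝 0) :=
  tendsto_one_div_add_atTop_nhds_zero_nat

lemma contDiff_mollify (n : ℕ) {f : EuclideanSpace ℝ (Fin d) → ℝ} (hf : LocallyIntegrable f) :
    ContDiff ℝ ∞ (mollify n f) :=
  (shrinkingBump d n).hasCompactSupport_normed.contDiff_convolution_left _
    ((shrinkingBump d n).contDiff_normed (n := (⊤ : ℕ∞))) hf

lemma tendsto_mollify {f : EuclideanSpace ℝ (Fin d) → ℝ} (hf : Continuous f)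
    (x : EuclideanSpace ℝ (Fin d)) : Tendsto (fun n => mollify n f x) atTop (𝓝 (f x)) :=
  ContDiffBump.convolution_tendsto_right_of_continuous tendsto_rOut_shrinkingBump hf x

lemma ae_tendsto_mollify {f : EuclideanSpace ℝ (Fin d) → ℝ} (hf : LocallyIntegrable f) :
    ∀ᵐ x, Tendsto (fun n => mollify n f x) atTop (𝓝 (f x)) :=
  ContDiffBump.ae_convolution_tendsto_right_of_locallyIntegrable (K := 2)
    tendsto_rOut_shrinkingBump (Eventually.of_forall fun n => by
      simp only [shrinkingBump]
      linarith) hf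

lemma abs_mollify_le (n : ℕ) {f : EuclideanSpace ℝ (Fin d) → ℝ} {M : ℝ}
    (hM : ∀ᵐ x, |f x| ≤ M) (x : EuclideanSpace ℝ (Fin d)) : |mollify n f x| ≤ M := by
  rw [mollify, convolution_def]
  have hM' : ∀ᵐ t, |f (x - t)| ≤ M :=
    (quasiMeasurePreserving_sub_left volume x).ae hM
  have hint : Integrable (fun t => (shrinkingBump d n).normed volume t * M) :=
    (shrinkingBump d n).integrable_normed.mul_const M
  rw [← Real.norm_eq_abs]
  refine (norm_integral_le_of_norm_le hint ?_).trans ?_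
  · filter_upwards [hM'] with t ht
    rw [ContinuousLinearMap.lsmul_apply, norm_smul, Real.norm_eq_abs, Real.norm_eq_abs,
      abs_of_nonneg ((shrinkingBump d n).nonneg_normed t)]
    exact mul_le_mul_of_nonneg_left ht ((shrinkingBump d n).nonneg_normed t)
  · rw [integral_mul_const, (shrinkingBump d n).integral_normed, one_mul]

lemma fderiv_mollify (n : ℕ) {f g : EuclideanSpace ℝ (Fin d) → ℝ} (hf : LocallyIntegrable f)
    {i : Fin d} (hg : IsWeakPartialDeriv i f g) (x : EuclideanSpace ℝ (Fin d)) :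
    fderiv ℝ (mollify n f) x (EuclideanSpace.single i 1) = mollify n g x := by
  set φ := (shrinkingBump d n).normed (volume : Measure (EuclideanSpace ℝ (Fin d))) with hφ
  have hsupp : HasCompactSupport φ := (shrinkingBump d n).hasCompactSupport_normed
  have hsmooth : ContDiff ℝ ∞ φ := (shrinkingBump d n).contDiff_normed
  have h1 := hsupp.hasFDerivAt_convolution_left (ContinuousLinearMap.lsmul ℝ ℝ)
    (hsmooth.of_le (by exact_mod_cast le_top)) hf x
  have h2 : fderiv ℝ (mollify n f) x = _ := h1.fderiv
  have hint : Integrable (fun t => ((ContinuousLinearMap.lsmul ℝ ℝ).precompL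
      (EuclideanSpace ℝ (Fin d)) (fderiv ℝ φ (x - t))) (f t)) := by
    have := (hsupp.fderiv (𝕜 := ℝ)).convolutionExists_left
      ((ContinuousLinearMap.lsmul ℝ ℝ).precompL (EuclideanSpace ℝ (Fin d)))
      (hsmooth.continuous_fderiv (by simp)) hf x
    exact (convolutionExistsAt_iff_integrable_swap (𝕜 := ℝ)).1 this
  have h3 := hg (fun t => φ (x - t)) (hsmooth.comp (contDiff_const.sub contDiff_id))
    (hsupp.comp_homeomorph (Homeomorph.subLeft x))
  have h4 : ∀ t, fderiv ℝ (fun t => φ (x - t)) t (EuclideanSpace.single i 1) =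
      -fderiv ℝ φ (x - t) (EuclideanSpace.single i 1) := by
    intro t
    have h5 : HasFDerivAt φ (fderiv ℝ φ (x - t)) (x - t) :=
      ((hsmooth.differentiable (by simp)) _).hasFDerivAt
    have h6 : HasFDerivAt (fun t => x - t)
        (-ContinuousLinearMap.id ℝ (EuclideanSpace ℝ (Fin d))) t := (hasFDerivAt_id t).const_sub x
    rw [show fderiv ℝ (fun t => φ (x - t)) t = _ from (h5.comp t h6).fderiv]
    simp
  simp_rw [h4, neg_smul, integral_neg, neg_inj] at h3
  rw [h2, convolution_eq_swap, ContinuousLinearMap.integral_apply hint, mollify,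
    convolution_eq_swap]
  exact h3

lemma IsWeakPartialDeriv.congr {F : Type*} [NormedAddCommGroup F] [NormedSpace ℝ F] {i : Fin d}
    {u u' g g' : EuclideanSpace ℝ (Fin d) → F} (h : IsWeakPartialDeriv i u g) (hu : u =ᵐ[volume] u')
    (hg : g =ᵐ[volume] g') : IsWeakPartialDeriv i u' g' := by
  intro η hη hη'
  have h1 : ∫ x, (fderiv ℝ η x (EuclideanSpace.single i 1)) • u' x =
      ∫ x, (fderiv ℝ η x (EuclideanSpace.single i 1)) • u x :=
    integral_congr_ae (hu.mono fun x hx => by simp only [hx])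
  have h2 : ∫ x, η x • g' x = ∫ x, η x • g x :=
    integral_congr_ae (hg.mono fun x hx => by simp only [hx])
  rw [h1, h2, h η hη hη']

lemma opNorm_le_sum_single (L : EuclideanSpace ℝ (Fin d) →L[ℝ] ℝ) :
    ‖L‖ ≤ ∑ i, |L (EuclideanSpace.single i 1)| := by
  refine L.opNorm_le_bound (Finset.sum_nonneg fun _ _ => abs_nonneg _) fun v => ?_
  have hv : L v = ∑ i, v i * L (EuclideanSpace.single i 1) := by
    conv_lhs => rw [← (EuclideanSpace.basisFun (Fin d) ℝ).sum_repr v]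
    simp [map_sum]
  rw [hv, Finset.sum_mul]
  refine (norm_sum_le _ _).trans (Finset.sum_le_sum fun i _ => ?_)
  rw [norm_mul, mul_comm]
  exact mul_le_mul_of_nonneg_left (PiLp.norm_apply_le v i) (abs_nonneg _)

/-- A continuous function with bounded weak derivatives is Lipschitz. -/
theorem exists_lipschitzWith_of_weakDeriv {f : EuclideanSpace ℝ (Fin d) → ℝ} (hf : Continuous f)
    {g : Fin d → EuclideanSpace ℝ (Fin d) → ℝ}
    (hg : ∀ i, MemLp (g i) ∞ volume ∧ IsWeakPartialDeriv i f (g i)) :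
    ∃ K, LipschitzWith K f := by
  have hM : ∀ i, ∃ M : ℝ, 0 ≤ M ∧ ∀ᵐ x, |g i x| ≤ M := fun i =>
    ⟨(eLpNorm (g i) ∞ volume).toReal, ENNReal.toReal_nonneg, by
      filter_upwards [ae_le_eLpNormEssSup (f := g i) (μ := volume)] with x hx
      rw [← eLpNorm_exponent_top] at hx
      rw [← Real.norm_eq_abs, ← toReal_enorm]
      exact ENNReal.toReal_mono (hg i).1.eLpNorm_ne_top hx⟩
  choose M hM0 hM using hM
  have hloc : LocallyIntegrable f := hf.locallyIntegrable
  have hlip : ∀ n, LipschitzWith (∑ i, (M i).toNNReal) (mollify n f) := by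
    intro n
    refine lipschitzWith_of_nnnorm_fderiv_le
      ((contDiff_mollify n hloc).differentiable (by simp)) fun x => ?_
    rw [← NNReal.coe_le_coe, coe_nnnorm, NNReal.coe_sum]
    refine (opNorm_le_sum_single _).trans (Finset.sum_le_sum fun i _ => ?_)
    rw [fderiv_mollify n hloc (hg i).2, Real.coe_toNNReal _ (hM0 i)]
    exact abs_mollify_le n (hM i) x
  refine ⟨∑ i, (M i).toNNReal, LipschitzWith.of_dist_le_mul fun x y => ?_⟩
  exact le_of_tendsto ((tendsto_mollify hf x).dist (tendsto_mollify hf y))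
    (Eventually.of_forall fun n => (hlip n).dist_le_mul x y)

/-- The almost everywhere defined derivative of a Lipschitz function is its weak derivative. -/
theorem isWeakPartialDeriv_lineDeriv {f : EuclideanSpace ℝ (Fin d) → ℝ} {K : NNReal}
    (hf : LipschitzWith K f) (i : Fin d) :
    IsWeakPartialDeriv i f (fun x => lineDeriv ℝ f x (EuclideanSpace.single i 1)) := by
  intro η hη hη'
  obtain ⟨D, hD⟩ := hη.lipschitzWith_of_hasCompactSupport hη' (by simp)
  have h1 := hf.integral_lineDeriv_mul_eq (μ := volume) hD hη' (EuclideanSpace.single i 1)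
  have h2 : ∀ x, lineDeriv ℝ η x (-EuclideanSpace.single i 1) =
      -fderiv ℝ η x (EuclideanSpace.single i 1) := fun x => by
    rw [((hη.differentiable (by simp)) x).lineDeriv_eq_fderiv, map_neg]
  simp_rw [h2, neg_mul, integral_neg] at h1
  simp only [smul_eq_mul]
  rw [← neg_eq_iff_eq_neg, ← h1]
  exact integral_congr_ae (Eventually.of_forall fun x => mul_comm _ _)

lemma ae_eq_lineDeriv {f g : EuclideanSpace ℝ (Fin d) → ℝ} {K : NNReal} (hf : LipschitzWith K f)
    {i : Fin d} (hg : LocallyIntegrable g) (h : IsWeakPartialDeriv i f g) :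
    ∀ᵐ x, g x = lineDeriv ℝ f x (EuclideanSpace.single i 1) := by
  refine ae_eq_of_integral_contDiff_smul_eq hg (hf.locallyIntegrable_lineDeriv _)
    fun η hη hη' => ?_
  have h1 := h η hη hη'
  have h2 := isWeakPartialDeriv_lineDeriv hf i η hη hη'
  rw [h1] at h2
  exact neg_injective h2

/-- The product rule for a bounded Lipschitz function and a weakly differentiable function. -/
theorem IsWeakPartialDeriv.smul_lipschitz {F : Type*} [NormedAddCommGroup F] [NormedSpace ℝ F]
    {f : EuclideanSpace ℝ (Fin d) → ℝ} {K : NNReal} (hf : LipschitzWith K f) {M : ℝ}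
    (hM : ∀ x, |f x| ≤ M) {u g : EuclideanSpace ℝ (Fin d) → F} (hu : LocallyIntegrable u)
    (hg : LocallyIntegrable g) {i : Fin d} (h : IsWeakPartialDeriv i u g) :
    IsWeakPartialDeriv i (fun x => f x • u x)
      (fun x => f x • g x + lineDeriv ℝ f x (EuclideanSpace.single i 1) • u x) := by
  intro η hη hη'
  set e : EuclideanSpace ℝ (Fin d) := EuclideanSpace.single i 1 with he
  have hfl : LocallyIntegrable f := hf.continuous.locallyIntegrable
  have hfd : LocallyIntegrable (fun x => lineDeriv ℝ f x e) := hf.locallyIntegrable_lineDeriv e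
  have hfd_le : ∀ x, |lineDeriv ℝ f x e| ≤ K := fun x => by
    have := norm_lineDeriv_le_of_lipschitz ℝ hf (x₀ := x) (v := e)
    simpa [he] using this
  have hdη : Continuous fun x => fderiv ℝ η x e :=
    (hη.continuous_fderiv (by simp)).clm_apply continuous_const
  have hdη' : HasCompactSupport fun x => fderiv ℝ η x e := hη'.fderiv_apply (𝕜 := ℝ) e
  have hdiff : ∀ n, Differentiable ℝ (mollify n f) := fun n =>
    (contDiff_mollify n hfl).differentiable (by simp)
  have hder : ∀ n x, fderiv ℝ (mollify n f) x e = mollify n (fun x => lineDeriv ℝ f x e) x :=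
    fun n x => fderiv_mollify n hfl (isWeakPartialDeriv_lineDeriv hf i) x
  -- integrate against the test function `η * mollify n f` and let `n → ∞`
  have key : ∀ n, ∫ x, (fderiv ℝ η x e * mollify n f x +
      η x * mollify n (fun x => lineDeriv ℝ f x e) x) • u x = -∫ x, (η x * mollify n f x) • g x := by
    intro n
    rw [← h (fun x => η x * mollify n f x) (hη.mul (contDiff_mollify n hfl)) hη'.mul_right]
    refine integral_congr_ae (Eventually.of_forall fun x => ?_)
    have := fderiv_mul ((hη.differentiable (by simp)) x) (hdiff n x)
    have h2 := DFunLike.congr_fun this e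
    simp only [add_apply, smul_apply, smul_eq_mul] at h2
    change _ = (fderiv ℝ (fun x => η x * mollify n f x) x e) • u x
    rw [show (fderiv ℝ (fun x => η x * mollify n f x) x e) = _ from h2, hder]
    simp only [add_smul, mul_comm]
    abel
  have iu1 : Integrable fun x => fderiv ℝ η x e • u x :=
    hu.integrable_smul_left_of_hasCompactSupport hdη hdη'
  have iu2 : Integrable fun x => η x • u x :=
    hu.integrable_smul_left_of_hasCompactSupport hη.continuous hη'
  have ig : Integrable fun x => η x • g x :=
    hg.integrable_smul_left_of_hasCompactSupport hη.continuous hη'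
  have lim1 : Tendsto (fun n => ∫ x, (fderiv ℝ η x e * mollify n f x +
      η x * mollify n (fun x => lineDeriv ℝ f x e) x) • u x) atTop
      (𝓝 (∫ x, (fderiv ℝ η x e * f x + η x * lineDeriv ℝ f x e) • u x)) := by
    refine tendsto_integral_of_dominated_convergence
      (fun x => M * ‖fderiv ℝ η x e • u x‖ + K * ‖η x • u x‖) (fun n => ?_)
      ((iu1.norm.const_mul M).add (iu2.norm.const_mul K)) (fun n => ?_) ?_
    · refine AEStronglyMeasurable.smul (Continuous.aestronglyMeasurable ?_)
        hu.aestronglyMeasurable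
      exact (hdη.mul (contDiff_mollify n hfl).continuous).add
        (hη.continuous.mul (contDiff_mollify n hfd).continuous)
    · refine Eventually.of_forall fun x => ?_
      rw [add_smul, mul_comm (fderiv ℝ η x e), mul_comm (η x), mul_smul, mul_smul]
      refine (norm_add_le _ _).trans (add_le_add ?_ ?_)
      · rw [norm_smul]
        exact mul_le_mul_of_nonneg_right
          (abs_mollify_le n (Eventually.of_forall hM) x) (norm_nonneg _)
      · rw [norm_smul]
        exact mul_le_mul_of_nonneg_right
          (abs_mollify_le n (Eventually.of_forall hfd_le) x) (norm_nonneg _)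
    · filter_upwards [ae_tendsto_mollify hfd] with x hx
      exact ((tendsto_const_nhds.mul (tendsto_mollify hf.continuous x)).add
        (tendsto_const_nhds.mul hx)).smul_const _
  have lim2 : Tendsto (fun n => ∫ x, (η x * mollify n f x) • g x) atTop
      (𝓝 (∫ x, (η x * f x) • g x)) := by
    refine tendsto_integral_of_dominated_convergence (fun x => M * ‖η x • g x‖) (fun n => ?_)
      (ig.norm.const_mul M) (fun n => ?_) ?_
    · exact (hη.continuous.mul
        (contDiff_mollify n hfl).continuous).aestronglyMeasurable.smul hg.aestronglyMeasurable
    · refine Eventually.of_forall fun x => ?_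
      rw [mul_comm (η x), mul_smul, norm_smul]
      exact mul_le_mul_of_nonneg_right
        (abs_mollify_le n (Eventually.of_forall hM) x) (norm_nonneg _)
    · exact Eventually.of_forall fun x =>
        (tendsto_const_nhds.mul (tendsto_mollify hf.continuous x)).smul_const _
  have main := tendsto_nhds_unique (lim1.congr key) lim2.neg
  have hbdd : ∀ {φ : EuclideanSpace ℝ (Fin d) → ℝ} {v : EuclideanSpace ℝ (Fin d) → F} {M : ℝ},
      Integrable v → AEStronglyMeasurable φ volume → (∀ x, |φ x| ≤ M) →
      Integrable fun x => φ x • v x := fun hv hφ hM =>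
    hv.bdd_smul _ hφ (Eventually.of_forall hM)
  have j1 : Integrable fun x => (fderiv ℝ η x e * f x) • u x := by
    refine (hbdd iu1 hf.continuous.aestronglyMeasurable hM).congr
      (Eventually.of_forall fun x => ?_)
    simp only [smul_smul, mul_comm]
  have j2 : Integrable fun x => (η x * lineDeriv ℝ f x e) • u x := by
    refine (hbdd iu2 hfd.aestronglyMeasurable hfd_le).congr (Eventually.of_forall fun x => ?_)
    simp only [smul_smul, mul_comm]
  have j3 : Integrable fun x => (η x * f x) • g x := by
    refine (hbdd ig hf.continuous.aestronglyMeasurable hM).congr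
      (Eventually.of_forall fun x => ?_)
    simp only [smul_smul, mul_comm]
  simp_rw [add_smul] at main
  rw [integral_add j1 j2] at main
  simp_rw [smul_add, smul_smul]
  rw [integral_add j3 j2, neg_add, ← main]
  abel

/-! ### The lattice of test functions -/

section TestFunctions

variable {C : EuclideanSpace ℝ (Fin d) → Matrix (Fin d) (Fin d) ℝ}
  {ψ ψ' : EuclideanSpace ℝ (Fin d) → ℝ}

/-- The test functions are the bounded Lipschitz functions whose almost everywhere defined gradient
satisfies `∑ᵢⱼ cᵢⱼ ∂ᵢψ ∂ⱼψ ≤ 1`. -/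
theorem mem_testFunctions_iff : ψ ∈ testFunctions C ↔ (∃ K, LipschitzWith K ψ) ∧
    (∃ M : ℝ, ∀ x, |ψ x| ≤ M) ∧
    ∀ᵐ x, ∑ i, ∑ j, C x i j * lineDeriv ℝ ψ x (EuclideanSpace.single i 1) *
      lineDeriv ℝ ψ x (EuclideanSpace.single j 1) ≤ 1 := by
  constructor
  · rintro ⟨hc, hψ, g, hg, hC⟩
    obtain ⟨K, hK⟩ := exists_lipschitzWith_of_weakDeriv hc hg
    refine ⟨⟨K, hK⟩, ⟨(eLpNorm ψ ∞ volume).toReal, ?_⟩, ?_⟩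
    -- by continuity the almost everywhere bound holds everywhere
    · have h1 : ∀ᵐ x, ψ x ∈ Set.Icc (-(eLpNorm ψ ∞ volume).toReal) (eLpNorm ψ ∞ volume).toReal := by
        filter_upwards [ae_le_eLpNormEssSup (f := ψ) (μ := volume)] with x hx
        rw [← eLpNorm_exponent_top] at hx
        rw [Set.mem_Icc, ← abs_le, ← Real.norm_eq_abs, ← toReal_enorm]
        exact ENNReal.toReal_mono hψ.eLpNorm_ne_top hx
      have h2 : Dense {x | ψ x ∈ Set.Icc (-(eLpNorm ψ ∞ volume).toReal)
        (eLpNorm ψ ∞ volume).toReal} := Measure.dense_of_ae h1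
      have h3 : IsClosed {x | ψ x ∈ Set.Icc (-(eLpNorm ψ ∞ volume).toReal)
        (eLpNorm ψ ∞ volume).toReal} := isClosed_Icc.preimage hc
      intro x
      have h4 : x ∈ {x | ψ x ∈ Set.Icc (-(eLpNorm ψ ∞ volume).toReal)
        (eLpNorm ψ ∞ volume).toReal} := by
        rw [← h3.closure_eq, h2.closure_eq]
        trivial
      exact abs_le.2 h4
    · have h1 : ∀ᵐ x, ∀ i, g i x = lineDeriv ℝ ψ x (EuclideanSpace.single i 1) :=
        ae_all_iff.2 fun i => ae_eq_lineDeriv hK ((hg i).1.locallyIntegrable le_top) (hg i).2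
      filter_upwards [hC, h1] with x hx h1
      simpa only [h1] using hx
  · rintro ⟨⟨K, hK⟩, ⟨M, hM⟩, hC⟩
    exact ⟨hK.continuous, memLp_top_of_bound hK.continuous.aestronglyMeasurable M
      (Eventually.of_forall hM), _, fun i => ⟨hK.memLp_lineDeriv _,
        isWeakPartialDeriv_lineDeriv hK i⟩, hC⟩

lemma const_mem_testFunctions (c : ℝ) : (fun _ => c) ∈ testFunctions C := by
  refine mem_testFunctions_iff.2 ⟨⟨0, LipschitzWith.const c⟩, ⟨|c|, fun _ => le_rfl⟩, ?_⟩
  exact Eventually.of_forall fun x => by simp [lineDeriv]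

lemma sub_const_mem_testFunctions (h : ψ ∈ testFunctions C) (c : ℝ) :
    (fun x => ψ x - c) ∈ testFunctions C := by
  obtain ⟨⟨K, hK⟩, ⟨M, hM⟩, hC⟩ := mem_testFunctions_iff.1 h
  refine mem_testFunctions_iff.2 ⟨⟨K, ?_⟩, ⟨M + |c|, fun x => ?_⟩, ?_⟩
  · exact fun x y => by simpa using hK x y
  · exact (abs_sub _ _).trans (add_le_add_left (hM x) _)
  · have : ∀ x v, lineDeriv ℝ (fun x => ψ x - c) x v = lineDeriv ℝ ψ x v := fun x v => by
      simp [lineDeriv]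
    simpa only [this] using hC

lemma neg_mem_testFunctions (h : ψ ∈ testFunctions C) : (fun x => -ψ x) ∈ testFunctions C := by
  obtain ⟨⟨K, hK⟩, ⟨M, hM⟩, hC⟩ := mem_testFunctions_iff.1 h
  refine mem_testFunctions_iff.2 ⟨⟨K, hK.neg⟩, ⟨M, fun x => by simpa using hM x⟩, ?_⟩
  have : ∀ x v, lineDeriv ℝ (fun x => -ψ x) x v = -lineDeriv ℝ ψ x v := fun x v => by
    simp [lineDeriv]
  simpa only [this, mul_neg, neg_mul, neg_neg] using hC

/-- At a point where `φ ≥ ψ`, `φ = ψ` and both are differentiable, they have the same derivative. -/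
lemma lineDeriv_eq_of_le_of_eq {φ : EuclideanSpace ℝ (Fin d) → ℝ} {x : EuclideanSpace ℝ (Fin d)}
    (hle : ∀ y, ψ y ≤ φ y) (heq : φ x = ψ x) (hφ : DifferentiableAt ℝ φ x)
    (hψ : DifferentiableAt ℝ ψ x) (v : EuclideanSpace ℝ (Fin d)) :
    lineDeriv ℝ φ x v = lineDeriv ℝ ψ x v := by
  have hmin : IsLocalMin (fun y => φ y - ψ y) x := Eventually.of_forall fun y => by
    simp only [heq, sub_self]
    exact sub_nonneg.2 (hle y)
  have h1 := hmin.fderiv_eq_zero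
  rw [show (fun y => φ y - ψ y) = φ - ψ from rfl, fderiv_sub hφ hψ, sub_eq_zero] at h1
  rw [hφ.lineDeriv_eq_fderiv, hψ.lineDeriv_eq_fderiv, h1]

lemma max_mem_testFunctions (h : ψ ∈ testFunctions C) (h' : ψ' ∈ testFunctions C) :
    (fun x => max (ψ x) (ψ' x)) ∈ testFunctions C := by
  obtain ⟨⟨K, hK⟩, ⟨M, hM⟩, hC⟩ := mem_testFunctions_iff.1 h
  obtain ⟨⟨K', hK'⟩, ⟨M', hM'⟩, hC'⟩ := mem_testFunctions_iff.1 h'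
  have hmax := hK.max hK'
  refine mem_testFunctions_iff.2 ⟨⟨_, hmax⟩, ⟨max M M', fun x => ?_⟩, ?_⟩
  · exact abs_max_le_max_abs_abs.trans (max_le_max (hM x) (hM' x))
  · filter_upwards [hC, hC', hK.ae_differentiableAt, hK'.ae_differentiableAt,
      hmax.ae_differentiableAt] with x hx hx' d1 d2 d3
    rcases le_total (ψ' x) (ψ x) with hle | hle
    · have : ∀ v, lineDeriv ℝ (fun x => max (ψ x) (ψ' x)) x v = lineDeriv ℝ ψ x v :=
        lineDeriv_eq_of_le_of_eq (fun y => le_max_left _ _) (max_eq_left hle) d3 d1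
      simpa only [this] using hx
    · have : ∀ v, lineDeriv ℝ (fun x => max (ψ x) (ψ' x)) x v = lineDeriv ℝ ψ' x v :=
        lineDeriv_eq_of_le_of_eq (fun y => le_max_right _ _) (max_eq_right hle) d3 d2
      simpa only [this] using hx'

lemma min_mem_testFunctions (h : ψ ∈ testFunctions C) (h' : ψ' ∈ testFunctions C) :
    (fun x => min (ψ x) (ψ' x)) ∈ testFunctions C := by
  have := neg_mem_testFunctions (max_mem_testFunctions (neg_mem_testFunctions h)
    (neg_mem_testFunctions h'))
  simpa only [max_neg_neg, neg_neg] using this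

/-- The points of two compact sets at distance larger than `r` are separated by a single test
function. This interchange of the infimum over the points and the supremum over the test functions
in `d(A; B)` holds because the test functions form a lattice. -/
theorem exists_testFunction_separating {A B : Set (EuclideanSpace ℝ (Fin d))} (hA : IsCompact A)
    (hB : IsCompact B) {r : ℝ} (hr : 0 ≤ r) (h : ENNReal.ofReal r < setDist C A B) :
    ∃ ψ ∈ testFunctions C, (∀ x ∈ A, 0 < ψ x) ∧ ∀ y ∈ B, ψ y < -r := by
  have hpt : ∀ x ∈ A, ∀ y ∈ B, ∃ ψ ∈ testFunctions C, 0 < ψ x ∧ ψ y < -r := by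
    intro x hx y hy
    have h1 : ENNReal.ofReal r < quasiDist C x y :=
      h.trans_le ((iInf₂_le x hx).trans (iInf₂_le y hy))
    obtain ⟨ψ, hψ⟩ := lt_iSup_iff.1 h1
    obtain ⟨hmem, hlt⟩ := lt_iSup_iff.1 hψ
    have h2 : r < ψ x - ψ y := (ENNReal.ofReal_lt_ofReal_iff_of_nonneg hr).1 hlt
    -- shift `ψ` so that the value `-r / 2` lies midway between the values at `y` and `x`
    refine ⟨_, sub_const_mem_testFunctions hmem ((ψ x + ψ y + r) / 2), ?_, ?_⟩
    · linarith
    · linarith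
  have hB' : ∀ x ∈ A, ∃ ψ ∈ testFunctions C, 0 < ψ x ∧ ∀ y ∈ B, ψ y < -r := by
    intro x hx
    refine hB.induction_on (p := fun s => ∃ ψ ∈ testFunctions C, 0 < ψ x ∧ ∀ y ∈ s, ψ y < -r)
      ⟨_, const_mem_testFunctions 1, zero_lt_one, by simp⟩ ?_ ?_ ?_
    · rintro s t hst ⟨ψ, h1, h2, h3⟩
      exact ⟨ψ, h1, h2, fun y hy => h3 y (hst hy)⟩
    · rintro s t ⟨ψ, h1, h2, h3⟩ ⟨ψ', h1', h2', h3'⟩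
      refine ⟨_, min_mem_testFunctions h1 h1', lt_min h2 h2', fun y hy => ?_⟩
      rcases hy with hy | hy
      · exact (min_le_left _ _).trans_lt (h3 y hy)
      · exact (min_le_right _ _).trans_lt (h3' y hy)
    · intro y hy
      obtain ⟨ψ, h1, h2, h3⟩ := hpt x hx y hy
      exact ⟨{y | ψ y < -r}, mem_nhdsWithin_of_mem_nhds
        ((isOpen_lt h1.1 continuous_const).mem_nhds h3), ψ, h1, h2, fun y hy => hy⟩
  refine hA.induction_on (p := fun s => ∃ ψ ∈ testFunctions C, (∀ x ∈ s, 0 < ψ x) ∧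
    ∀ y ∈ B, ψ y < -r) ⟨_, const_mem_testFunctions (-r - 1), by simp, by simp⟩ ?_ ?_ ?_
  · rintro s t hst ⟨ψ, h1, h2, h3⟩
    exact ⟨ψ, h1, fun x hx => h2 x (hst hx), h3⟩
  · rintro s t ⟨ψ, h1, h2, h3⟩ ⟨ψ', h1', h2', h3'⟩
    refine ⟨_, max_mem_testFunctions h1 h1', fun x hx => ?_, fun y hy => max_lt (h3 y hy)
      (h3' y hy)⟩
    rcases hx with hx | hx
    · exact (h2 x hx).trans_le (le_max_left _ _)
    · exact (h2' x hx).trans_le (le_max_right _ _)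
  · intro x hx
    obtain ⟨ψ, h1, h2, h3⟩ := hB' x hx
    exact ⟨{x | 0 < ψ x}, mem_nhdsWithin_of_mem_nhds
      ((isOpen_lt continuous_const h1.1).mem_nhds h2), ψ, h1, fun x hx => hx, h3⟩

end TestFunctions

/-! ### Exponential weights -/

lemma abs_exp_sub_exp_le {a b M : ℝ} (ha : |a| ≤ M) (hb : |b| ≤ M) :
    |Real.exp a - Real.exp b| ≤ Real.exp M * |a - b| := by
  have key : ∀ {a b : ℝ}, |a| ≤ M → Real.exp a - Real.exp b ≤ Real.exp M * |a - b| := by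
    intro a b ha
    have h1 : Real.exp b = Real.exp a * Real.exp (b - a) := by
      rw [← Real.exp_add]
      ring_nf
    have h2 : Real.exp a * (1 + (b - a)) ≤ Real.exp a * Real.exp (b - a) :=
      mul_le_mul_of_nonneg_left (by linarith [Real.add_one_le_exp (b - a)]) (Real.exp_pos a).le
    have h3 : Real.exp a * (a - b) ≤ Real.exp M * |a - b| :=
      (mul_le_mul_of_nonneg_left (le_abs_self (a - b)) (Real.exp_pos a).le).trans
        (mul_le_mul_of_nonneg_right (Real.exp_le_exp.2 ((le_abs_self a).trans ha)) (abs_nonneg _))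
    rw [h1]
    linarith
  refine abs_le.2 ⟨?_, key ha⟩
  have := key (b := a) hb
  rw [abs_sub_comm] at this
  linarith

section ExpWeight

variable {ψ : EuclideanSpace ℝ (Fin d) → ℝ} {K : NNReal} {M : ℝ}

lemma abs_exp_mul_le (hM : ∀ x, |ψ x| ≤ M) (c : ℝ) (x : EuclideanSpace ℝ (Fin d)) :
    |Real.exp (c * ψ x)| ≤ Real.exp (|c| * M) := by
  rw [abs_of_pos (Real.exp_pos _), Real.exp_le_exp]
  refine (le_abs_self _).trans ?_
  rw [abs_mul]
  exact mul_le_mul_of_nonneg_left (hM x) (abs_nonneg _)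

lemma exists_lipschitzWith_exp_mul (hψ : LipschitzWith K ψ) (hM : ∀ x, |ψ x| ≤ M) (c : ℝ) :
    ∃ K', LipschitzWith K' fun x => Real.exp (c * ψ x) := by
  have hcM : ∀ x, |c * ψ x| ≤ |c| * M := fun x => by
    rw [abs_mul]
    exact mul_le_mul_of_nonneg_left (hM x) (abs_nonneg _)
  refine ⟨(Real.exp (|c| * M)).toNNReal * (‖c‖₊ * K), LipschitzWith.of_dist_le_mul fun x y => ?_⟩
  rw [Real.dist_eq]
  refine (abs_exp_sub_exp_le (hcM x) (hcM y)).trans ?_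
  push_cast
  rw [Real.coe_toNNReal _ (Real.exp_pos _).le, mul_assoc, mul_assoc, ← mul_sub, abs_mul]
  have := hψ.dist_le_mul x y
  rw [Real.dist_eq] at this
  gcongr
  exact le_rfl

lemma ae_lineDeriv_exp_mul (hψ : LipschitzWith K ψ) (c : ℝ) (v : EuclideanSpace ℝ (Fin d)) :
    ∀ᵐ x, lineDeriv ℝ (fun x => Real.exp (c * ψ x)) x v =
      c * (Real.exp (c * ψ x) * lineDeriv ℝ ψ x v) := by
  filter_upwards [hψ.ae_lineDifferentiableAt (μ := volume) v] with x hx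
  have h1 : HasDerivAt (fun t : ℝ => ψ (x + t • v)) (lineDeriv ℝ ψ x v) 0 := hx.hasLineDerivAt
  have h2 := ((h1.const_mul c).exp)
  have h3 : HasLineDerivAt ℝ (fun x => Real.exp (c * ψ x))
    (Real.exp (c * ψ (x + (0 : ℝ) • v)) * (c * lineDeriv ℝ ψ x v)) x v := h2
  rw [h3.lineDeriv, zero_smul, add_zero]
  ring

end ExpWeight

/-! ### A measurable square root of the coefficients -/

section Sqrt

open scoped Matrix.Norms.L2Operator MatrixOrder

/-- The square root of `|C|` is used: it agrees with that of `C` where `C` is positive, and is a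
continuous function of all matrices, which gives measurability. -/
lemma exists_measurable_sqrt {α : Type*} [MeasurableSpace α] {μ : Measure α} {d : ℕ}
    {C : α → Matrix (Fin d) (Fin d) ℝ} (hC : ∀ i j, AEStronglyMeasurable (fun x => C x i j) μ)
    (hpos : ∀ᵐ x ∂μ, (C x).PosSemidef) :
    ∃ S : α → Matrix (Fin d) (Fin d) ℝ, (∀ i j, AEStronglyMeasurable (fun x => S x i j) μ) ∧
      ∀ᵐ x ∂μ, ∀ i j, C x i j = ∑ k, S x k i * S x k j := by
  have hCm : AEStronglyMeasurable C μ := by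
    have : C = fun x => ∑ i, ∑ j, C x i j • Matrix.single i j (1 : ℝ) := by
      ext1 x
      conv_lhs => rw [Matrix.matrix_eq_sum_single (C x)]
      simp
    rw [this]
    exact Finset.aestronglyMeasurable_fun_sum _ fun i _ =>
      Finset.aestronglyMeasurable_fun_sum _ fun j _ => (hC i j).smul_const _
  have habs : Continuous fun a : Matrix (Fin d) (Fin d) ℝ => CFC.abs a :=
    CFC.continuousOn_sqrt.comp_continuous (by fun_prop) fun a => star_mul_self_nonneg a
  have hsqrt : Continuous fun a : Matrix (Fin d) (Fin d) ℝ => CFC.sqrt (CFC.abs a) :=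
    CFC.continuousOn_sqrt.comp_continuous habs fun a => CFC.abs_nonneg a
  refine ⟨fun x => CFC.sqrt (CFC.abs (C x)), fun i j => ?_, ?_⟩
  · have hij : Continuous fun a : Matrix (Fin d) (Fin d) ℝ => a i j := by fun_prop
    exact (hij.comp hsqrt).comp_aestronglyMeasurable hCm
  · filter_upwards [hpos] with x hx i j
    have h0 : 0 ≤ C x := Matrix.nonneg_iff_posSemidef.2 hx
    have h1 : CFC.sqrt (C x) * CFC.sqrt (C x) = C x := CFC.sqrt_mul_sqrt_self (C x) h0
    have h2 : IsSelfAdjoint (CFC.sqrt (C x)) := (CFC.sqrt_nonneg (C x)).isSelfAdjoint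
    have h3 : ∀ k, CFC.sqrt (C x) i k = CFC.sqrt (C x) k i := fun k => by
      have := congrFun (congrFun h2.star_eq i) k
      simpa using this.symm
    simp only [CFC.abs_of_nonneg (C x) h0]
    conv_lhs => rw [← h1, Matrix.mul_apply]
    exact Finset.sum_congr rfl fun k _ => by rw [h3]

end Sqrt

/-! ### Pointwise operators on `L₂` spaces -/

section Pointwise

variable {α V W : Type*} [MeasurableSpace α] {μ : Measure α}
  [NormedAddCommGroup V] [NormedSpace ℂ V] [NormedAddCommGroup W] [NormedSpace ℂ W]

/-- A bounded measurable field of operators acts on `L₂`. -/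
theorem exists_pointwise_operator {A : α → V →L[ℂ] W} (hA : AEStronglyMeasurable A μ) {M : ℝ}
    (hM0 : 0 ≤ M) (hM : ∀ᵐ x ∂μ, ‖A x‖ ≤ M) :
    ∃ T : Lp V 2 μ →L[ℂ] Lp W 2 μ, ‖T‖ ≤ M ∧ ∀ u : Lp V 2 μ, T u =ᵐ[μ] fun x => A x (u x) := by
  have hmeas : ∀ u : Lp V 2 μ, AEStronglyMeasurable (fun x => A x (u x)) μ := fun u =>
    isBoundedBilinearMap_apply.continuous.comp_aestronglyMeasurable
      (hA.prodMk (Lp.aestronglyMeasurable u))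
  have hle : ∀ u : Lp V 2 μ, ∀ᵐ x ∂μ, ‖A x (u x)‖ ≤ M * ‖u x‖ := fun u => by
    filter_upwards [hM] with x hx
    exact ContinuousLinearMap.le_of_opNorm_le _ hx _
  have hmem : ∀ u : Lp V 2 μ, MemLp (fun x => A x (u x)) 2 μ := fun u =>
    (Lp.memLp u).of_le_mul (hmeas u) (hle u)
  let T : Lp V 2 μ →ₗ[ℂ] Lp W 2 μ :=
    { toFun := fun u => (hmem u).toLp
      map_add' := fun u v => by
        ext1
        filter_upwards [(hmem (u + v)).coeFn_toLp, (hmem u).coeFn_toLp, (hmem v).coeFn_toLp,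
          Lp.coeFn_add u v, Lp.coeFn_add (hmem u).toLp (hmem v).toLp] with x h1 h2 h3 h4 h5
        rw [h1, h5, Pi.add_apply, h2, h3, h4, Pi.add_apply, map_add]
      map_smul' := fun c u => by
        ext1
        filter_upwards [(hmem (c • u)).coeFn_toLp, (hmem u).coeFn_toLp,
          Lp.coeFn_smul c u, Lp.coeFn_smul c (hmem u).toLp] with x h1 h2 h3 h4
        rw [h1, RingHom.id_apply, h4, Pi.smul_apply, h2, h3, Pi.smul_apply, map_smul] }
  have hT : ∀ u : Lp V 2 μ, T u =ᵐ[μ] fun x => A x (u x) := fun u => (hmem u).coeFn_toLp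
  refine ⟨T.mkContinuous M fun u => ?_, T.mkContinuous_norm_le hM0 _, hT⟩
  refine Lp.norm_le_mul_norm_of_ae_le_mul ?_
  filter_upwards [hT u, hle u] with x h1 h2
  rw [h1]
  exact h2

end Pointwise

section Multiplication

variable {α V : Type*} [MeasurableSpace α] {μ : Measure α} [NormedAddCommGroup V]
  [InnerProductSpace ℂ V]

lemma norm_sq_eq_integral (w : Lp V 2 μ) : ‖w‖ ^ 2 = ∫ x, ‖w x‖ ^ 2 ∂μ := by
  have h := L2.inner_def (𝕜 := ℂ) w w
  rw [inner_self_eq_norm_sq_to_K] at h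
  have h2 : ∀ x, inner ℂ (w x) (w x) = ((‖w x‖ ^ 2 : ℝ) : ℂ) := fun x => by
    rw [inner_self_eq_norm_sq_to_K]
    norm_cast
  simp_rw [h2] at h
  rw [integral_complex_ofReal] at h
  exact Complex.ofReal_injective (by simpa using h)

/-- Multiplication by a bounded real function is a bounded symmetric operator on `L₂`. -/
theorem exists_mul_operator {f : α → ℝ} (hf : AEStronglyMeasurable f μ) {M : ℝ}
    (hM : ∀ᵐ x ∂μ, |f x| ≤ M) :
    ∃ T : Lp V 2 μ →L[ℂ] Lp V 2 μ, (∀ u : Lp V 2 μ, T u =ᵐ[μ] fun x => (f x : ℂ) • u x) ∧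
      ∀ u v, inner ℂ (T u) v = inner ℂ u (T v) := by
  obtain ⟨T, -, hT⟩ := exists_pointwise_operator (V := V) (W := V) (μ := μ)
    (A := fun x => (f x : ℂ) • ContinuousLinearMap.id ℂ V) (M := max M 0)
    ((Complex.continuous_ofReal.comp_aestronglyMeasurable hf).smul_const _) (le_max_right _ _) (by
      filter_upwards [hM] with x hx
      rw [norm_smul, Complex.norm_real]
      exact (mul_le_of_le_one_right (norm_nonneg _) ContinuousLinearMap.norm_id_le).trans
        (hx.trans (le_max_left _ _)))
  refine ⟨T, hT, fun u v => ?_⟩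
  rw [L2.inner_def, L2.inner_def]
  refine integral_congr_ae ?_
  filter_upwards [hT u, hT v] with x h1 h2
  rw [h1, h2, smul_apply, smul_apply, inner_smul_left, inner_smul_right, Complex.conj_ofReal]
  rfl

end Multiplication

/-! ### The elliptic form as the energy of a linear relation -/

/-- The product of a real matrix and a complex vector, as an element of Euclidean space. -/
def matVec (S : Matrix (Fin d) (Fin d) ℝ) (z : Fin d → ℂ) : EuclideanSpace ℂ (Fin d) :=
  WithLp.toLp 2 fun k => ∑ j, (S k j : ℂ) * z j

lemma matVec_add (S : Matrix (Fin d) (Fin d) ℝ) (z z' : Fin d → ℂ) :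
    matVec S (fun j => z j + z' j) = matVec S z + matVec S z' := by
  ext k
  simp [matVec, mul_add, Finset.sum_add_distrib]

lemma matVec_smul (S : Matrix (Fin d) (Fin d) ℝ) (c : ℂ) (z : Fin d → ℂ) :
    matVec S (fun j => c * z j) = c • matVec S z := by
  ext k
  simp only [matVec, PiLp.smul_apply, smul_eq_mul, Finset.mul_sum]
  exact Finset.sum_congr rfl fun j _ => by ring

/-- With `C = Sᵀ S` one has `|S z|² = ∑ᵢⱼ cᵢⱼ conj(zᵢ) zⱼ`. -/
lemma norm_matVec_sq {S C : Matrix (Fin d) (Fin d) ℝ} (hC : ∀ i j, C i j = ∑ k, S k i * S k j)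
    (z : Fin d → ℂ) :
    ‖matVec S z‖ ^ 2 = (∑ i, ∑ j, (C i j : ℂ) * (starRingEnd ℂ (z i) * z j)).re := by
  have h : ((‖matVec S z‖ ^ 2 : ℝ) : ℂ) = ∑ i, ∑ j, (C i j : ℂ) * (starRingEnd ℂ (z i) * z j) := by
    rw [EuclideanSpace.norm_sq_eq, Complex.ofReal_sum]
    have h1 : ∀ k, ((‖matVec S z k‖ ^ 2 : ℝ) : ℂ) = ∑ i, ∑ j,
        ((S k i : ℂ) * S k j) * (starRingEnd ℂ (z i) * z j) := by
      intro k
      rw [Complex.ofReal_pow, ← Complex.conj_mul']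
      simp only [matVec, map_sum, map_mul, Complex.conj_ofReal, Finset.sum_mul_sum]
      exact Finset.sum_congr rfl fun i _ => Finset.sum_congr rfl fun j _ => by ring
    simp_rw [h1]
    rw [Finset.sum_comm]
    refine Finset.sum_congr rfl fun i _ => ?_
    rw [Finset.sum_comm]
    refine Finset.sum_congr rfl fun j _ => ?_
    rw [hC i j, ← Finset.sum_mul]
    push_cast
    rfl
  rw [← h, Complex.ofReal_re]

lemma norm_matVec_ofReal_sq {S C : Matrix (Fin d) (Fin d) ℝ}
    (hC : ∀ i j, C i j = ∑ k, S k i * S k j) (v : Fin d → ℝ) :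
    ‖matVec S (fun j => (v j : ℂ))‖ ^ 2 = ∑ i, ∑ j, C i j * v i * v j := by
  rw [norm_matVec_sq hC]
  simp only [Complex.conj_ofReal]
  rw [← Complex.ofReal_re (∑ i, ∑ j, C i j * v i * v j)]
  push_cast
  simp only [mul_assoc]

lemma aestronglyMeasurable_matVec {S : EuclideanSpace ℝ (Fin d) → Matrix (Fin d) (Fin d) ℝ}
    (hS : ∀ i j, AEStronglyMeasurable (fun x => S x i j) volume)
    {z : Fin d → EuclideanSpace ℝ (Fin d) → ℂ} (hz : ∀ j, AEStronglyMeasurable (z j) volume) :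
    AEStronglyMeasurable (fun x => matVec (S x) (fun j => z j x)) volume := by
  have h : Continuous fun f : Fin d → ℂ => (WithLp.toLp 2 f : EuclideanSpace ℂ (Fin d)) := by
    fun_prop
  refine h.comp_aestronglyMeasurable (AEMeasurable.aestronglyMeasurable
    (aemeasurable_pi_iff.2 fun k => AEStronglyMeasurable.aemeasurable ?_))
  exact Finset.aestronglyMeasurable_fun_sum _ fun j _ =>
    (Complex.continuous_ofReal.comp_aestronglyMeasurable (hS k j)).mul (hz j)

/-- The Hilbert space of square integrable complex vector fields. -/
abbrev L2Vec (d : ℕ) : Type :=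
  Lp (EuclideanSpace ℂ (Fin d)) 2 (volume : Measure (EuclideanSpace ℝ (Fin d)))

lemma L2.locallyIntegrable (u : L2 d) :
    LocallyIntegrable (u : EuclideanSpace ℝ (Fin d) → ℂ) volume :=
  (Lp.memLp u).locallyIntegrable one_le_two

/-- The linear relation `{(u, S ∇u)}`, where `u` runs over the functions in `W^{1,2}` for which
`S ∇u` is square integrable. -/
def gradRel (S : EuclideanSpace ℝ (Fin d) → Matrix (Fin d) (Fin d) ℝ) :
    Submodule ℂ (L2 d × L2Vec d) where
  carrier := {p | ∃ g : Fin d → L2 d,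
    (∀ i, IsWeakPartialDeriv i (p.1 : EuclideanSpace ℝ (Fin d) → ℂ) (g i)) ∧
    p.2 =ᵐ[volume] fun x => matVec (S x) fun j => g j x}
  zero_mem' := by
    have h0 : ∀ᵐ x, (0 : L2 d) x = 0 := by
      filter_upwards [Lp.coeFn_zero ℂ 2 (volume : Measure (EuclideanSpace ℝ (Fin d)))] with x hx
      exact hx
    refine ⟨0, fun i η hη hη' => ?_, ?_⟩
    · rw [integral_eq_zero_of_ae, integral_eq_zero_of_ae, neg_zero]
      · filter_upwards [h0] with x hx
        simp only [Pi.zero_apply, hx, smul_zero]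
      · filter_upwards [h0] with x hx
        simp only [Prod.fst_zero, Pi.zero_apply, hx, smul_zero]
    · filter_upwards [h0, Lp.coeFn_zero (EuclideanSpace ℂ (Fin d)) 2
        (volume : Measure (EuclideanSpace ℝ (Fin d)))] with x hx hx'
      simp only [Prod.snd_zero, hx', Pi.zero_apply, hx]
      ext k
      simp [matVec]
  add_mem' := by
    rintro ⟨u, w⟩ ⟨u', w'⟩ ⟨g, hg, hw⟩ ⟨g', hg', hw'⟩
    refine ⟨fun i => g i + g' i, fun i η hη hη' => ?_, ?_⟩
    · have hdη : Continuous fun x => fderiv ℝ η x (EuclideanSpace.single i 1) :=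
        (hη.continuous_fderiv (by simp)).clm_apply continuous_const
      have hdη' : HasCompactSupport fun x => fderiv ℝ η x (EuclideanSpace.single i 1) :=
        hη'.fderiv_apply (𝕜 := ℝ) _
      have e1 : ∫ x, fderiv ℝ η x (EuclideanSpace.single i 1) • (u + u' : L2 d) x =
          ∫ x, (fderiv ℝ η x (EuclideanSpace.single i 1) • u x +
            fderiv ℝ η x (EuclideanSpace.single i 1) • u' x) := by
        refine integral_congr_ae ?_
        filter_upwards [Lp.coeFn_add u u'] with x hx
        rw [hx, Pi.add_apply, smul_add]
      have e2 : ∫ x, η x • (g i + g' i : L2 d) x = ∫ x, (η x • g i x + η x • g' i x) := by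
        refine integral_congr_ae ?_
        filter_upwards [Lp.coeFn_add (g i) (g' i)] with x hx
        rw [hx, Pi.add_apply, smul_add]
      change ∫ x, fderiv ℝ η x (EuclideanSpace.single i 1) • (u + u' : L2 d) x = _
      rw [e1, e2, integral_add
        ((L2.locallyIntegrable u).integrable_smul_left_of_hasCompactSupport hdη hdη')
        ((L2.locallyIntegrable u').integrable_smul_left_of_hasCompactSupport hdη hdη'),
        integral_add
        ((L2.locallyIntegrable _).integrable_smul_left_of_hasCompactSupport hη.continuous hη')
        ((L2.locallyIntegrable _).integrable_smul_left_of_hasCompactSupport hη.continuous hη'),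
        neg_add, ← hg i η hη hη', ← hg' i η hη hη']
    · have h1 : ∀ᵐ x, ∀ i, (g i + g' i : L2 d) x = g i x + g' i x :=
        ae_all_iff.2 fun i => Lp.coeFn_add (g i) (g' i)
      filter_upwards [hw, hw', Lp.coeFn_add w w', h1] with x h2 h3 h4 h5
      simp only [h5, matVec_add]
      rw [← h2, ← h3]
      exact h4
  smul_mem' := by
    rintro c ⟨u, w⟩ ⟨g, hg, hw⟩
    refine ⟨fun i => c • g i, fun i η hη hη' => ?_, ?_⟩
    · have e1 : ∫ x, fderiv ℝ η x (EuclideanSpace.single i 1) • (c • u : L2 d) x =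
          ∫ x, c • (fderiv ℝ η x (EuclideanSpace.single i 1) • u x) := by
        refine integral_congr_ae ?_
        filter_upwards [Lp.coeFn_smul c u] with x hx
        rw [hx, Pi.smul_apply, smul_comm]
      have e2 : ∫ x, η x • (c • g i : L2 d) x = ∫ x, c • (η x • g i x) := by
        refine integral_congr_ae ?_
        filter_upwards [Lp.coeFn_smul c (g i)] with x hx
        rw [hx, Pi.smul_apply, smul_comm]
      change ∫ x, fderiv ℝ η x (EuclideanSpace.single i 1) • (c • u : L2 d) x = _
      rw [e1, e2, integral_smul, integral_smul, hg i η hη hη', smul_neg]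
    · have h1 : ∀ᵐ x, ∀ i, (c • g i : L2 d) x = c * g i x :=
        ae_all_iff.2 fun i => Lp.coeFn_smul c (g i)
      filter_upwards [hw, Lp.coeFn_smul c w, h1] with x h2 h4 h5
      simp only [h5, matVec_smul]
      rw [← h2]
      exact h4

variable {C S : EuclideanSpace ℝ (Fin d) → Matrix (Fin d) (Fin d) ℝ}

lemma ofReal_norm_sq_eq_lintegral (w : L2Vec d) :
    ENNReal.ofReal (‖w‖ ^ 2) = ∫⁻ x, ENNReal.ofReal (‖w x‖ ^ 2) := by
  rw [norm_sq_eq_integral]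
  exact ofReal_integral_eq_lintegral_ofReal ((Lp.memLp w).integrable_norm_pow two_ne_zero)
    (Eventually.of_forall fun x => by positivity)

/-- With `C = Sᵀ S`, the elliptic form is `u ↦ ‖S ∇u‖²`. -/
theorem ellipticForm_eq_relEnergy (hS : ∀ i j, AEStronglyMeasurable (fun x => S x i j) volume)
    (hSC : ∀ᵐ x, ∀ i j, C x i j = ∑ k, S x k i * S x k j) :
    ellipticForm C = relEnergy (gradRel S) := by
  have hkey : ∀ g : Fin d → L2 d, ∀ᵐ x, ENNReal.ofReal
      (∑ i, ∑ j, (C x i j : ℂ) * (starRingEnd ℂ (g i x) * g j x)).re =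
      ENNReal.ofReal (‖matVec (S x) fun j => g j x‖ ^ 2) := by
    intro g
    filter_upwards [hSC] with x hx
    rw [norm_matVec_sq hx]
  ext u
  refine le_antisymm ?_ ?_
  · refine le_iInf₂ fun w hw => ?_
    obtain ⟨g, hg, hw⟩ := hw
    refine (iInf₂_le g hg).trans (le_of_eq ?_)
    rw [ofReal_norm_sq_eq_lintegral, lintegral_congr_ae (hkey g)]
    refine lintegral_congr_ae ?_
    filter_upwards [hw] with x hx
    rw [hx]
  · refine le_iInf₂ fun g hg => ?_
    rw [lintegral_congr_ae (hkey g)]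
    by_cases hfin : ∫⁻ x, ENNReal.ofReal (‖matVec (S x) fun j => g j x‖ ^ 2) = ⊤
    · rw [hfin]
      exact le_top
    · have hm := aestronglyMeasurable_matVec hS fun j => Lp.aestronglyMeasurable (g j)
      have hmem : MemLp (fun x => matVec (S x) fun j => g j x) 2 volume := by
        rw [memLp_two_iff_integrable_sq_norm hm]
        refine ⟨(hm.norm.pow 2), ?_⟩
        rw [hasFiniteIntegral_iff_ofReal (Eventually.of_forall fun x => by positivity)]
        exact lt_top_iff_ne_top.2 hfin
      refine (iInf₂_le hmem.toLp ⟨g, hg, hmem.coeFn_toLp⟩).trans (le_of_eq ?_)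
      rw [ofReal_norm_sq_eq_lintegral]
      refine lintegral_congr_ae ?_
      filter_upwards [hmem.coeFn_toLp] with x hx
      rw [hx]

/-- The form domain contains the smooth functions `η` of compact support, hence is dense: since `C` is
locally integrable, `|S ∇η|² = ∑ᵢⱼ cᵢⱼ ∂ᵢη ∂ⱼη` is integrable. -/
theorem dense_domain_gradRel (hC_int : ∀ i j, LocallyIntegrable (fun x => C x i j) volume)
    (hS : ∀ i j, AEStronglyMeasurable (fun x => S x i j) volume)
    (hSC : ∀ᵐ x, ∀ i j, C x i j = ∑ k, S x k i * S x k j) :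
    Dense ((relForm (gradRel S).topologicalClosure).domain : Set (L2 d)) := by
  rw [Submodule.dense_iff_topologicalClosure_eq_top, Submodule.topologicalClosure_eq_top_iff,
    Submodule.eq_bot_iff]
  intro u hu
  have hη : ∀ η : EuclideanSpace ℝ (Fin d) → ℝ, ContDiff ℝ ∞ η → HasCompactSupport η →
      ∫ x, η x • u x = 0 := by
    intro η hη hη'
    set dη : Fin d → EuclideanSpace ℝ (Fin d) → ℝ :=
      fun i x => fderiv ℝ η x (EuclideanSpace.single i 1) with hdη
    have hdc : ∀ i, Continuous (dη i) := fun i =>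
      (hη.continuous_fderiv (by simp)).clm_apply continuous_const
    have hds : ∀ i, HasCompactSupport (dη i) := fun i => hη'.fderiv_apply (𝕜 := ℝ) _
    have hmemLp : ∀ f : EuclideanSpace ℝ (Fin d) → ℝ, Continuous f → HasCompactSupport f →
        MemLp (fun x => (f x : ℂ)) 2 volume := fun f hf hf' =>
      (Complex.continuous_ofReal.comp hf).memLp_of_hasCompactSupport
        (hf'.comp_left (g := fun y : ℝ => (y : ℂ)) Complex.ofReal_zero)
    have hm : AEStronglyMeasurable (fun x => matVec (S x) fun j => (dη j x : ℂ)) volume :=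
      aestronglyMeasurable_matVec hS fun j =>
        (Complex.continuous_ofReal.comp (hdc j)).aestronglyMeasurable
    have hmem : MemLp (fun x => matVec (S x) fun j => (dη j x : ℂ)) 2 volume := by
      rw [memLp_two_iff_integrable_sq_norm hm]
      have hint : Integrable fun x => ∑ i, ∑ j, C x i j * dη i x * dη j x := by
        refine integrable_finsetSum _ fun i _ => integrable_finsetSum _ fun j _ => ?_
        refine ((hC_int i j).integrable_smul_left_of_hasCompactSupport ((hdc i).mul (hdc j))
          (hds i).mul_right).congr (Eventually.of_forall fun x => ?_)
        simp only [smul_eq_mul, Pi.mul_apply]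
        ring
      refine hint.congr ?_
      filter_upwards [hSC] with x hx
      rw [norm_matVec_ofReal_sq hx]
    have hrel : ((hmemLp η hη.continuous hη').toLp, hmem.toLp) ∈ gradRel S := by
      refine ⟨fun i => (hmemLp (dη i) (hdc i) (hds i)).toLp, fun i => ?_, ?_⟩
      · refine IsWeakPartialDeriv.congr (u := fun x => (η x : ℂ)) (g := fun x => (dη i x : ℂ)) ?_
          (hmemLp η hη.continuous hη').coeFn_toLp.symm
          (hmemLp (dη i) (hdc i) (hds i)).coeFn_toLp.symm
        intro θ hθ hθ'
        have hdθ : Continuous fun x => fderiv ℝ θ x (EuclideanSpace.single i 1) :=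
          (hθ.continuous_fderiv (by simp)).clm_apply continuous_const
        have key := integral_mul_fderiv_eq_neg_fderiv_mul_of_integrable (μ := volume)
          (f := η) (g := θ) (v := EuclideanSpace.single i 1)
          (((hdc i).mul hθ.continuous).integrable_of_hasCompactSupport (hds i).mul_right)
          ((hη.continuous.mul hdθ).integrable_of_hasCompactSupport hη'.mul_right)
          ((hη.continuous.mul hθ.continuous).integrable_of_hasCompactSupport hη'.mul_right)
          (fun x _ => (hη.differentiable (by simp)) x) (fun x _ => (hθ.differentiable (by simp)) x)
        have e1 : ∫ x, fderiv ℝ θ x (EuclideanSpace.single i 1) • (η x : ℂ) =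
            ((∫ x, η x * fderiv ℝ θ x (EuclideanSpace.single i 1) : ℝ) : ℂ) := by
          rw [← integral_complex_ofReal]
          refine integral_congr_ae (Eventually.of_forall fun x => ?_)
          simp [mul_comm]
        have e2 : ∫ x, θ x • (dη i x : ℂ) = ((∫ x, dη i x * θ x : ℝ) : ℂ) := by
          rw [← integral_complex_ofReal]
          refine integral_congr_ae (Eventually.of_forall fun x => ?_)
          simp [mul_comm]
        rw [e1, e2, key, Complex.ofReal_neg]
      · have h1 : ∀ᵐ x, ∀ i, ((hmemLp (dη i) (hdc i) (hds i)).toLp : L2 d) x = (dη i x : ℂ) :=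
          ae_all_iff.2 fun i => (hmemLp (dη i) (hdc i) (hds i)).coeFn_toLp
        filter_upwards [hmem.coeFn_toLp, h1] with x h2 h3
        simp only [h2, h3]
    obtain ⟨w₀, hw₀, -⟩ := exists_operatorPart (gradRel S).isClosed_topologicalClosure
      ((gradRel S).le_topologicalClosure hrel)
    have h0 := (Submodule.mem_orthogonal _ _).1 hu _ (mem_relForm_domain.2 ⟨w₀, hw₀⟩)
    rw [L2.inner_def] at h0
    rw [← h0]
    refine integral_congr_ae ?_
    filter_upwards [(hmemLp η hη.continuous hη').coeFn_toLp] with x hx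
    rw [hx]
    simp [mul_comm]
  have := ae_eq_zero_of_integral_contDiff_smul_eq_zero (L2.locallyIntegrable u) hη
  exact Lp.eq_zero_iff_ae_eq_zero.2 this

/-- Multiplication by `exp (ρ ψ)`, for a test function `ψ`, is a weight for the relation
`{(u, S ∇u)}`. -/
theorem exists_isWeight (hS : ∀ i j, AEStronglyMeasurable (fun x => S x i j) volume)
    (hSC : ∀ᵐ x, ∀ i j, C x i j = ∑ k, S x k i * S x k j)
    {ψ : EuclideanSpace ℝ (Fin d) → ℝ} (hψ : ψ ∈ testFunctions C) (ρ : ℝ) :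
    ∃ (m : L2 d →L[ℂ] L2 d) (n : L2Vec d →L[ℂ] L2Vec d) (B : L2 d →L[ℂ] L2Vec d),
      (∀ u : L2 d, m u =ᵐ[volume] fun x => ((Real.exp (ρ * ψ x) : ℝ) : ℂ) • u x) ∧
      IsWeight (gradRel S) ρ m n B := by
  obtain ⟨⟨K, hK⟩, ⟨M, hM⟩, hgrad⟩ := mem_testFunctions_iff.1 hψ
  set dψ : Fin d → EuclideanSpace ℝ (Fin d) → ℝ :=
    fun i x => lineDeriv ℝ ψ x (EuclideanSpace.single i 1) with hdψ
  have hdm : ∀ i, AEStronglyMeasurable (dψ i) volume := fun i =>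
    (hK.memLp_lineDeriv (μ := volume) _).aestronglyMeasurable
  have hdb : ∀ i x, |dψ i x| ≤ K := fun i x => by
    have := norm_lineDeriv_le_of_lipschitz ℝ hK (x₀ := x) (v := EuclideanSpace.single i (1 : ℝ))
    simpa using this
  have hem : ∀ c : ℝ, AEStronglyMeasurable (fun x => Real.exp (c * ψ x)) volume := fun c =>
    (Real.continuous_exp.comp (continuous_const.mul hK.continuous)).aestronglyMeasurable
  obtain ⟨m, hm, hm'⟩ := exists_mul_operator (V := ℂ) (hem ρ)
    (Eventually.of_forall (abs_exp_mul_le hM ρ))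
  obtain ⟨n, hn, hn'⟩ := exists_mul_operator (V := EuclideanSpace ℂ (Fin d)) (hem ρ)
    (Eventually.of_forall (abs_exp_mul_le hM ρ))
  -- the vector field `S ∇ψ`, which has length at most one
  set b : EuclideanSpace ℝ (Fin d) → EuclideanSpace ℂ (Fin d) :=
    fun x => matVec (S x) fun j => (dψ j x : ℂ) with hb
  have hbm : AEStronglyMeasurable b volume := aestronglyMeasurable_matVec hS fun j =>
    Complex.continuous_ofReal.comp_aestronglyMeasurable (hdm j)
  have hb1 : ∀ᵐ x, ‖b x‖ ≤ 1 := by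
    filter_upwards [hSC, hgrad] with x h1 h2
    rw [← sq_le_one_iff₀ (norm_nonneg _), hb, norm_matVec_ofReal_sq h1]
    exact h2
  obtain ⟨B, hB1, hB⟩ := exists_pointwise_operator (V := ℂ) (W := EuclideanSpace ℂ (Fin d))
    (A := fun x => ContinuousLinearMap.toSpanSingleton ℂ (b x))
    ((ContinuousLinearMap.toSpanSingletonCLE (𝕜 := ℂ)).continuous.comp_aestronglyMeasurable hbm)
    zero_le_one (by
      filter_upwards [hb1] with x hx
      rwa [ContinuousLinearMap.norm_toSpanSingleton])
  have hBx : ∀ u : L2 d, B u =ᵐ[volume] fun x => u x • b x := hB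
  -- the operators of multiplication by `∂ᵢ exp (2 ρ ψ)`
  have hQ : ∀ i, ∃ Q : L2 d →L[ℂ] L2 d, ∀ u : L2 d, Q u =ᵐ[volume] fun x =>
      ((2 * ρ * (Real.exp (2 * ρ * ψ x) * dψ i x) : ℝ) : ℂ) • u x := by
    intro i
    obtain ⟨Q, hQ, -⟩ := exists_mul_operator (V := ℂ) (M := |2 * ρ| * (Real.exp (|2 * ρ| * M) * K))
      (((hem (2 * ρ)).mul (hdm i)).const_mul (2 * ρ)) (Eventually.of_forall fun x => by
        simp only [Pi.mul_apply]
        rw [abs_mul, abs_mul (Real.exp _)]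
        exact mul_le_mul_of_nonneg_left (mul_le_mul (abs_exp_mul_le hM (2 * ρ) x) (hdb i x)
          (abs_nonneg _) (Real.exp_pos _).le) (abs_nonneg _))
    exact ⟨Q, hQ⟩
  choose Q hQ using hQ
  have hexp : ∀ x, Real.exp (2 * ρ * ψ x) = Real.exp (ρ * ψ x) * Real.exp (ρ * ψ x) := fun x => by
    rw [← Real.exp_add]
    ring_nf
  have hmm : ∀ u : L2 d, m (m u) =ᵐ[volume] fun x => Real.exp (2 * ρ * ψ x) • u x := by
    intro u
    filter_upwards [hm (m u), hm u] with x h1 h2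
    rw [h1, h2, hexp, smul_smul, ← Complex.ofReal_mul]
    rfl
  refine ⟨m, n, B, hm, hm', hn', fun u => ?_, fun u => ?_, ?_⟩
  · ext1
    filter_upwards [hn (B u), hBx u, hBx (m u), hm u] with x h1 h2 h3 h4
    rw [h1, h2, h3, h4, smul_smul, smul_eq_mul]
  · exact (B.le_of_opNorm_le hB1 u).trans_eq (one_mul _)
  · rintro u w ⟨g, hg, hw⟩
    refine ⟨fun i => m (m (g i)) + Q i u, fun i => ?_, ?_⟩
    · obtain ⟨K', hK'⟩ := exists_lipschitzWith_exp_mul hK hM (2 * ρ)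
      have h := IsWeakPartialDeriv.smul_lipschitz hK' (abs_exp_mul_le hM (2 * ρ))
        (L2.locallyIntegrable u) (L2.locallyIntegrable (g i)) (hg i)
      refine h.congr (hmm u).symm ?_
      filter_upwards [hmm (g i), hQ i u, Lp.coeFn_add (m (m (g i))) (Q i u),
        ae_lineDeriv_exp_mul hK (2 * ρ) (EuclideanSpace.single i 1)] with x h1 h2 h3 h4
      rw [h3, Pi.add_apply, h1, h2, h4]
      rfl
    · have h1 : ∀ᵐ x, ∀ i, (m (m (g i)) + Q i u : L2 d) x =
          ((Real.exp (2 * ρ * ψ x) : ℝ) : ℂ) * g i x +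
            ((2 * ρ * Real.exp (2 * ρ * ψ x) : ℝ) : ℂ) * u x * (dψ i x : ℂ) := by
        refine ae_all_iff.2 fun i => ?_
        filter_upwards [hmm (g i), hQ i u, Lp.coeFn_add (m (m (g i))) (Q i u)] with x h1 h2 h3
        rw [h3, Pi.add_apply, h1, h2, Complex.real_smul, smul_eq_mul]
        push_cast
        ring
      filter_upwards [h1, hw, hn (n w), hn w, hn (B (m u)), hBx (m u), hm u,
        Lp.coeFn_add (n (n w)) (((2 * ρ : ℝ) : ℂ) • n (B (m u))),
        Lp.coeFn_smul ((2 * ρ : ℝ) : ℂ) (n (B (m u)))] with x h1 h2 h3 h4 h5 h6 h7 h8 h9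
      simp only [h1, matVec_add, matVec_smul]
      rw [h8, Pi.add_apply, h9, Pi.smul_apply, h3, h4, h5, h6, h7, h2, hexp]
      simp only [smul_smul, smul_eq_mul, hb]
      congr 2 <;> push_cast <;> ring

/-! ### Supports and separation -/

lemma setDist_mono {C : EuclideanSpace ℝ (Fin d) → Matrix (Fin d) (Fin d) ℝ}
    {A A' B B' : Set (EuclideanSpace ℝ (Fin d))} (hA : A' ⊆ A) (hB : B' ⊆ B) :
    setDist C A B ≤ setDist C A' B' :=
  le_iInf₂ fun x hx => le_iInf₂ fun y hy => (iInf₂_le x (hA hx)).trans (iInf₂_le y (hB hy))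

/-- A function in `L₂(A)`, with `A` open, is a limit of functions with support in compact subsets
of `A`. -/
lemma SupportedIn.exists_tendsto_compact {A : Set (EuclideanSpace ℝ (Fin d))} (hA : IsOpen A)
    {φ : L2 d} (hφ : SupportedIn φ A) :
    ∃ (L : ℕ → Set (EuclideanSpace ℝ (Fin d))) (φn : ℕ → L2 d), (∀ n, IsCompact (L n)) ∧
      (∀ n, L n ⊆ A) ∧ (∀ n, SupportedIn (φn n) (L n)) ∧ Tendsto φn atTop (𝓝 φ) := by
  obtain ⟨F, hFc, hFA, hFU, hFmono⟩ := hA.exists_iUnion_isClosed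
  set L : ℕ → Set (EuclideanSpace ℝ (Fin d)) := fun n => F n ∩ Metric.closedBall 0 n with hL
  have hLc : ∀ n, IsCompact (L n) := fun n => (isCompact_closedBall _ _).inter_left (hFc n)
  have hmem : ∀ n, MemLp ((L n).indicator φ) 2 volume := fun n =>
    (Lp.memLp φ).indicator (hLc n).measurableSet
  refine ⟨L, fun n => (hmem n).toLp, hLc, fun n => Set.inter_subset_left.trans (hFA n),
    fun n => ?_, ?_⟩
  · filter_upwards [(hmem n).coeFn_toLp] with x hx hxL
    rw [hx, Set.indicator_of_notMem hxL]
  · have h1 : ∀ n, ‖(hmem n).toLp - φ‖ ^ 2 = ∫ x, ‖(L n).indicator φ x - φ x‖ ^ 2 := by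
      intro n
      rw [norm_sq_eq_integral]
      refine integral_congr_ae ?_
      filter_upwards [Lp.coeFn_sub (hmem n).toLp φ, (hmem n).coeFn_toLp] with x h1 h2
      rw [h1, Pi.sub_apply, h2]
    have h2 : Tendsto (fun n => ∫ x, ‖(L n).indicator φ x - φ x‖ ^ 2) atTop
        (𝓝 (∫ _x : EuclideanSpace ℝ (Fin d), (0 : ℝ))) := by
      refine tendsto_integral_of_dominated_convergence (fun x => ‖φ x‖ ^ 2) (fun n => ?_)
        ((Lp.memLp φ).integrable_norm_pow two_ne_zero) (fun n => ?_) ?_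
      · exact (((hmem n).aestronglyMeasurable.sub (Lp.aestronglyMeasurable φ)).norm.pow 2)
      · refine Eventually.of_forall fun x => ?_
        by_cases hx : x ∈ L n
        · simp [Set.indicator_of_mem hx]
        · simp [Set.indicator_of_notMem hx]
      · filter_upwards [hφ] with x hx
        by_cases hxA : x ∈ A
        · rw [← hFU] at hxA
          obtain ⟨N, hN⟩ := Set.mem_iUnion.1 hxA
          obtain ⟨N', hN'⟩ := exists_nat_ge ‖x‖
          refine tendsto_const_nhds.congr' ?_
          filter_upwards [eventually_ge_atTop (max N N')] with n hn
          have : x ∈ L n := ⟨hFmono ((le_max_left _ _).trans hn) hN, by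
            rw [mem_closedBall_zero_iff]
            exact hN'.trans (by exact_mod_cast (le_max_right _ _).trans hn)⟩
          simp [Set.indicator_of_mem this]
        · have h0 : φ x = 0 := hx hxA
          refine tendsto_const_nhds.congr fun n => ?_
          have h1 : (L n).indicator φ x = 0 := Set.indicator_apply_eq_zero.2 fun _ => h0
          simp [h1, h0]
    rw [integral_zero] at h2
    simp_rw [← h1] at h2
    rw [tendsto_iff_norm_sub_tendsto_zero]
    have := h2.sqrt
    simpa [Real.sqrt_sq] using this

/-- A weighted bound `‖exp (ρ ψ) T φ‖ ≤ c ‖exp (ρ ψ) φ‖` yields an off-diagonal bound for `T`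
between sets which are separated by `ψ`. -/
lemma norm_inner_le_of_weighted {ψ : EuclideanSpace ℝ (Fin d) → ℝ} (hψ : Continuous ψ) {M : ℝ}
    (hM : ∀ x, |ψ x| ≤ M) {ρ : ℝ} (hρ : 0 ≤ ρ) {m : L2 d →L[ℂ] L2 d}
    (hm : ∀ u : L2 d, m u =ᵐ[volume] fun x => ((Real.exp (ρ * ψ x) : ℝ) : ℂ) • u x)
    (hm' : ∀ u v, inner ℂ (m u) v = inner ℂ u (m v)) {A B : Set (EuclideanSpace ℝ (Fin d))}
    {r : ℝ} (hA : ∀ x ∈ A, 0 ≤ ψ x) (hB : ∀ y ∈ B, ψ y ≤ -r) {φA φB : L2 d}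
    (hφA : SupportedIn φA A) (hφB : SupportedIn φB B) {T : L2 d →L[ℂ] L2 d} {c : ℝ} (hc : 0 ≤ c)
    (hT : ‖m (T φB)‖ ≤ c * ‖m φB‖) :
    ‖inner ℂ φA (T φB)‖ ≤ c * Real.exp (-(ρ * r)) * ‖φA‖ * ‖φB‖ := by
  obtain ⟨m', hm1, -⟩ := exists_mul_operator (V := ℂ) (f := fun x => Real.exp (-ρ * ψ x))
    (μ := volume) (Real.continuous_exp.comp (continuous_const.mul hψ)).aestronglyMeasurable
    (Eventually.of_forall (abs_exp_mul_le hM (-ρ)))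
  -- `m'` is the multiplication by `exp (-ρ ψ)`, the inverse of `m`
  have hA1 : m (m' φA) = φA := by
    ext1
    filter_upwards [hm (m' φA), hm1 φA] with x h1 h2
    rw [h1, h2, smul_smul, ← Complex.ofReal_mul, ← Real.exp_add]
    simp
  have hA2 : ‖m' φA‖ ≤ ‖φA‖ := by
    refine Lp.norm_le_norm_of_ae_le ?_
    filter_upwards [hm1 φA, hφA] with x h1 h2
    rw [h1, norm_smul, Complex.norm_real, Real.norm_of_nonneg (Real.exp_pos _).le]
    by_cases hx : x ∈ A
    · refine mul_le_of_le_one_left (norm_nonneg _) (Real.exp_le_one_iff.2 ?_)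
      nlinarith [mul_nonneg hρ (hA x hx)]
    · simp [h2 hx]
  have hB2 : ‖m φB‖ ≤ Real.exp (-(ρ * r)) * ‖φB‖ := by
    refine Lp.norm_le_mul_norm_of_ae_le_mul ?_
    filter_upwards [hm φB, hφB] with x h1 h2
    rw [h1, norm_smul, Complex.norm_real, Real.norm_of_nonneg (Real.exp_pos _).le]
    by_cases hx : x ∈ B
    · refine mul_le_mul_of_nonneg_right (Real.exp_le_exp.2 ?_) (norm_nonneg _)
      nlinarith [mul_le_mul_of_nonneg_left (hB x hx) hρ]
    · simp [h2 hx]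
  rw [← hA1, hm', hA1]
  refine (norm_inner_le_norm _ _).trans ?_
  calc ‖m' φA‖ * ‖m (T φB)‖ ≤ ‖φA‖ * (c * (Real.exp (-(ρ * r)) * ‖φB‖)) :=
        mul_le_mul hA2 (hT.trans (mul_le_mul_of_nonneg_left hB2 hc)) (norm_nonneg _)
          (norm_nonneg _)
    _ = c * Real.exp (-(ρ * r)) * ‖φA‖ * ‖φB‖ := by ring

/-- The off-diagonal bound for open sets follows if every test function `ψ` gives a weighted
estimate. -/
theorem norm_inner_le_of_lt_setDist {C S : EuclideanSpace ℝ (Fin d) → Matrix (Fin d) (Fin d) ℝ}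
    (hS : ∀ i j, AEStronglyMeasurable (fun x => S x i j) volume)
    (hSC : ∀ᵐ x, ∀ i j, C x i j = ∑ k, S x k i * S x k j)
    {T : L2 d →L[ℂ] L2 d} {ρ c : ℝ} (hρ : 0 ≤ ρ) (hc : 0 ≤ c)
    (hT : ∀ m n B, IsWeight (gradRel S) ρ m n B → ∀ φ, ‖m (T φ)‖ ≤ c * ‖m φ‖)
    {A B : Set (EuclideanSpace ℝ (Fin d))} (hA : IsOpen A) (hB : IsOpen B) {φA φB : L2 d}
    (hφA : SupportedIn φA A) (hφB : SupportedIn φB B) {r : ℝ} (hr : 0 ≤ r)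
    (h : ENNReal.ofReal r < setDist C A B) :
    ‖inner ℂ φA (T φB)‖ ≤ c * Real.exp (-(ρ * r)) * ‖φA‖ * ‖φB‖ := by
  obtain ⟨L, φn, hLc, hLA, hφn, hlim⟩ := hφA.exists_tendsto_compact hA
  obtain ⟨L', φn', hLc', hLB, hφn', hlim'⟩ := hφB.exists_tendsto_compact hB
  refine le_of_tendsto_of_tendsto'
    ((hlim.inner (((T.continuous.tendsto _).comp hlim'))).norm)
    ((hlim.norm.const_mul (c * Real.exp (-(ρ * r)))).mul hlim'.norm) fun k => ?_
  obtain ⟨ψ, hψ, h1, h2⟩ := exists_testFunction_separating (hLc k) (hLc' k) hr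
    (h.trans_le (setDist_mono (hLA k) (hLB k)))
  obtain ⟨m, n, B, hm, hw⟩ := exists_isWeight hS hSC hψ ρ
  obtain ⟨-, ⟨M, hM⟩, -⟩ := mem_testFunctions_iff.1 hψ
  exact norm_inner_le_of_weighted hψ.1 hM hρ hm hw.inner_left (fun x hx => (h1 x hx).le)
    (fun y hy => (h2 y hy).le) (hφn k) (hφn' k) hc (hT m n B hw _)

lemma SupportedIn.inner_eq_zero {A B : Set (EuclideanSpace ℝ (Fin d))} (h : Disjoint A B)
    {φA φB : L2 d} (hφA : SupportedIn φA A) (hφB : SupportedIn φB B) : inner ℂ φA φB = 0 := by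
  rw [L2.inner_def]
  refine integral_eq_zero_of_ae ?_
  filter_upwards [hφA, hφB] with x h1 h2
  by_cases hx : x ∈ A
  · simp [h2 (Set.disjoint_left.1 h hx)]
  · simp [h1 hx]

/-- A Gaussian bound for all `r < s` is a Gaussian bound for `s`. -/
lemma le_gaussFactor_mul {s : ℝ≥0∞} {t a b : ℝ} (ht : 0 < t) (h0 : a ≤ b)
    (h : ∀ r : ℝ, 0 ≤ r → ENNReal.ofReal r < s → a ≤ Real.exp (-(r ^ 2 / (4 * t))) * b) :
    a ≤ gaussFactor s t * b := by
  rw [gaussFactor]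
  split_ifs with hs
  · subst hs
    have hlim : Tendsto (fun r : ℝ => Real.exp (-(r ^ 2 / (4 * t))) * b) atTop (𝓝 (0 * b)) := by
      refine Tendsto.mul_const b (Real.tendsto_exp_neg_atTop_nhds_zero.comp ?_)
      exact (tendsto_pow_atTop two_ne_zero).atTop_div_const (by positivity)
    refine ge_of_tendsto hlim ?_
    filter_upwards [eventually_ge_atTop 0] with r hr
    exact h r hr ENNReal.ofReal_lt_top
  · rcases (ENNReal.toReal_nonneg (a := s)).eq_or_lt with h1 | h1
    · rw [← h1]
      simpa using h0
    · have hlim : Tendsto (fun r : ℝ => Real.exp (-(r ^ 2 / (4 * t))) * b) (𝓝[<] s.toReal)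
          (𝓝 (Real.exp (-(s.toReal ^ 2 / (4 * t))) * b)) := by
        have : Continuous fun r : ℝ => Real.exp (-(r ^ 2 / (4 * t))) * b := by fun_prop
        exact (this.tendsto _).mono_left nhdsWithin_le_nhds
      refine ge_of_tendsto hlim ?_
      filter_upwards [Ioo_mem_nhdsLT h1] with r hr
      exact h r hr.1.le ((ENNReal.ofReal_lt_iff_lt_toReal hr.1.le hs).2 hr.2)

end Relax

end

/-- The first four clauses say that the relaxation `h₀` exists, that `H₀` is self-adjoint, and
that the bounded operators `exp (-t H₀)` and `cos (t H₀^{1/2})` are well defined. The last two are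
the Davies-Gaffney estimate and the finite speed of propagation. -/
theorem proposition4p1 {d : ℕ}
    (C : EuclideanSpace ℝ (Fin d) → Matrix (Fin d) (Fin d) ℝ)
    (hC_int : ∀ i j, LocallyIntegrable (fun x => C x i j) volume)
    (hC_pos : ∀ᵐ x, (C x).PosSemidef) :
    Relax.IsRelaxation (Relax.ellipticForm C) (Relax.relaxedForm C) ∧
    ((Relax.relaxedOperator C).graph = (Relax.relaxedForm C).operatorGraph ∧
      IsSelfAdjoint (Relax.relaxedOperator C)) ∧
    (∀ t : ℝ, 0 < t → Relax.IsFunctionOf (Relax.relaxedOperator C)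
      (fun l => Real.exp (-t * l)) (Relax.semigroup C t)) ∧
    (∀ t : ℝ, Relax.IsFunctionOf (Relax.relaxedOperator C)
      (fun l => Real.cos (t * Real.sqrt l)) (Relax.waveOperator C t)) ∧
    ∀ A B : Set (EuclideanSpace ℝ (Fin d)), IsOpen A → IsOpen B →
      (∀ φA φB : Relax.L2 d, Relax.SupportedIn φA A → Relax.SupportedIn φB B →
        ∀ t : ℝ, 0 < t →
          ‖inner ℂ φA (Relax.semigroup C t φB)‖ ≤
            Relax.gaussFactor (Relax.setDist C A B) t * ‖φA‖ * ‖φB‖) ∧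
      (Disjoint A B →
        ∀ φA φB : Relax.L2 d, Relax.SupportedIn φA A → Relax.SupportedIn φB B →
          ∀ t : ℝ, ENNReal.ofReal |t| ≤ Relax.setDist C A B →
            inner ℂ φA (Relax.waveOperator C t φB) = 0) := by
  open Relax in
  obtain ⟨S, hS, hSC⟩ := exists_measurable_sqrt (fun i j => (hC_int i j).aestronglyMeasurable) hC_pos
  set K := (gradRel S).topologicalClosure with hKdef
  have hK : IsClosed (K : Set (L2 d × L2Vec d)) := (gradRel S).isClosed_topologicalClosure
  have hrel : IsRelaxation (ellipticForm C) (relForm K) := by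
    rw [ellipticForm_eq_relEnergy hS hSC]
    exact isRelaxation_relForm (gradRel S)
  have hform : relaxedForm C = relForm K := hrel.relaxation_eq
  have hdense : Dense ((relForm K).domain : Set (L2 d)) := dense_domain_gradRel hC_int hS hSC
  have hgraph : (relaxedOperator C).graph = (relForm K).operatorGraph := by
    rw [relaxedOperator, hform]
    exact PositiveForm.graph_operator hdense
  obtain ⟨R, hR, hpos, hle⟩ := exists_resolvent hK
  have hd : DenseRange R := denseRange_of_resolvent hdense hR hpos
  have hres : IsResolvent (relaxedOperator C) R := fun f u => by rw [hgraph]; exact hR f u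
  have hheat : ∀ t : ℝ, 0 < t → IsFunctionOf (relaxedOperator C)
      (fun l => Real.exp (-t * l)) (semigroup C t) := fun t ht =>
    isFunctionOf_functionOf hres hpos hle hd (M := 1) (by fun_prop) fun l hl => by
      rw [abs_of_pos (Real.exp_pos _)]
      exact Real.exp_le_one_iff.2 (by nlinarith)
  have hwave : ∀ t : ℝ, IsFunctionOf (relaxedOperator C)
      (fun l => Real.cos (t * Real.sqrt l)) (waveOperator C t) := fun t =>
    isFunctionOf_functionOf hres hpos hle hd (M := 1) (by fun_prop) fun l _ =>
      Real.abs_cos_le_one _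
  refine ⟨hform ▸ hrel, ⟨by rw [hgraph, hform], ?_⟩, hheat, hwave, fun A B hA hB =>
    ⟨fun φA φB hφA hφB t ht => ?_, fun hAB φA φB hφA hφB t ht => ?_⟩⟩
  · rw [relaxedOperator, hform]
    refine isSelfAdjoint_of_resolvent (R := R) ?_ hpos hd
    rwa [relaxedOperator, hform] at hres
  · have hT := (hheat t ht).mul_eq hres
    have hweight : ∀ ρ m n B, IsWeight (gradRel S) ρ m n B → ∀ φ,
        ‖m (semigroup C t φ)‖ ≤ Real.exp (ρ ^ 2 * t) * ‖m φ‖ := fun ρ m n B hw φ =>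
      hw.topologicalClosure.norm_heat_le hK hR hpos hle hd ht hT φ
    rw [mul_assoc]
    refine le_gaussFactor_mul ht ?_ fun r hr hrd => ?_
    -- the weight with `ρ = 0` and `ψ = 0` shows that the semigroup is contractive
    · have h0 : (fun _ => (0 : ℝ)) ∈ testFunctions C := const_mem_testFunctions 0
      obtain ⟨m, n, B, hm, hw⟩ := exists_isWeight hS hSC h0 0
      have := norm_inner_le_of_weighted (ψ := fun _ => 0) (M := 0) (r := 0) continuous_const
        (by simp) le_rfl hm hw.inner_left (by simp) (by simp) hφA hφB (Real.exp_pos _).le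
        (hweight 0 m n B hw φB)
      simpa using this
    · -- the exponent `ρ² t - ρ r` is minimal at `ρ = r / (2 t)`
      have := norm_inner_le_of_lt_setDist hS hSC (ρ := r / (2 * t)) (by positivity)
        (Real.exp_pos _).le (fun m n B hw φ => hweight _ m n B hw φ) hA hB hφA hφB hr hrd
      rw [← Real.exp_add, mul_assoc] at this
      convert this using 3
      field_simp
      ring
  · have hT := fun t => (hwave t).mul_eq hres
    -- inside the cone the weighted estimate holds for every `ρ`
    have hlt : ∀ s : ℝ, s ≠ 0 → ENNReal.ofReal |s| < setDist C A B →
        inner ℂ φA (waveOperator C s φB) = 0 := by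
      intro s hs0 hs
      obtain ⟨r, hr0, hsr, hr⟩ : ∃ r : ℝ, 0 ≤ r ∧ |s| < r ∧ ENNReal.ofReal r < setDist C A B := by
        obtain ⟨q, hq1, hq2⟩ := ENNReal.lt_iff_exists_nnreal_btwn.1 hs
        refine ⟨q, q.2, ?_, by simpa using hq2⟩
        rwa [ENNReal.ofReal_lt_coe_iff (abs_nonneg s)] at hq1
      have hbound : ∀ ρ : ℝ, 0 ≤ ρ → ‖inner ℂ φA (waveOperator C s φB)‖ ≤
          Real.exp (-(ρ * (r - |s|))) * (‖φA‖ * ‖φB‖) := by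
        intro ρ hρ
        have := norm_inner_le_of_lt_setDist hS hSC (T := waveOperator C s) hρ
          (Real.exp_pos (|ρ| * |s|)).le (fun m n B hw φ =>
          hw.topologicalClosure.norm_wave_le_abs hK hR hpos hle hd hs0 (hT s) φ)
          hA hB hφA hφB hr0 hr
        rw [← Real.exp_add, mul_assoc, abs_of_nonneg hρ] at this
        convert this using 3
        ring
      have hlim : Tendsto (fun ρ : ℝ => Real.exp (-(ρ * (r - |s|))) * (‖φA‖ * ‖φB‖)) atTop
          (𝓝 (0 * (‖φA‖ * ‖φB‖))) :=
        (Real.tendsto_exp_neg_atTop_nhds_zero.comp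
          (tendsto_id.atTop_mul_const (sub_pos.2 hsr))).mul_const _
      rw [zero_mul] at hlim
      refine norm_le_zero_iff.1 (ge_of_tendsto hlim ?_)
      filter_upwards [eventually_ge_atTop 0] with ρ hρ
      exact hbound ρ hρ
    rcases eq_or_ne t 0 with rfl | ht0
    · rw [wave_zero_apply hpos hd (hT 0)]
      exact hφA.inner_eq_zero hAB hφB
    · -- the boundary of the cone is reached by continuity in time
      set s : ℕ → ℝ := fun k => (1 - 1 / ((k : ℝ) + 2)) * t with hs
      have hk : ∀ k : ℕ, 0 < 1 - 1 / ((k : ℝ) + 2) ∧ 1 - 1 / ((k : ℝ) + 2) < 1 := fun k => by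
        have h2 : (0 : ℝ) < 1 / ((k : ℝ) + 2) := by positivity
        have h3 : 1 / ((k : ℝ) + 2) < 1 := by
          rw [div_lt_one (by positivity)]
          linarith [(Nat.cast_nonneg k : (0 : ℝ) ≤ k)]
        constructor <;> linarith
      have hslim : Tendsto s atTop (𝓝 t) := by
        have h1 : Tendsto (fun k : ℕ => 1 / ((k : ℝ) + 2)) atTop (𝓝 0) := by
          have := (tendsto_const_div_atTop_nhds_zero_nat (1 : ℝ)).comp (tendsto_add_atTop_nat 2)
          simpa [Function.comp_def] using this
        have h2 := (h1.const_sub 1).mul_const t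
        rwa [sub_zero, one_mul] at h2
      have hconv := (tendsto_const_nhds (x := φA)).inner (𝕜 := ℂ)
        (tendsto_wave hpos hle hd (T := waveOperator C) hT hslim φB)
      have hzero : ∀ k, inner ℂ φA (waveOperator C (s k) φB) = 0 := by
        intro k
        refine hlt _ (mul_ne_zero (hk k).1.ne' ht0) (lt_of_lt_of_le ?_ ht)
        rw [ENNReal.ofReal_lt_ofReal_iff (abs_pos.2 ht0), abs_mul, abs_of_pos (hk k).1]
        exact mul_lt_of_lt_one_left (abs_pos.2 ht0) (hk k).2
      simp_rw [hzero] at hconv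
      exact tendsto_nhds_unique hconv tendsto_const_nhds
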